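/- **Theorem (Poly-time completeness of weak affine light typing, WALT).** *Terms.* Take pure $\lambda$-terms up to $\alpha$-equivalence. A *value* is a variable or an abstraction. Let $\to$ be the contextual closure of $(\lambda x.M)N\to M\{N/x\}$, allowed only if (i) $x$ does not occur free in $M$, or (ii) $x$ occurs exactly once in $M$ and $N$ is a value, or (iii) $x$ occurs more than once in $M$ and $N$ is a value with at most one free variable. $\to^+$ is its transitive closure. *Types.* $A::=L\mid{!A}\mid\$A$ and $L::=\alpha\mid A\multimap A\mid\$A\multimap_v A\mid\forall\alpha.L$. Write $L$ for linear (i.e. second-sort) types. *Judgements* $\Gamma;\Delta;\mathcal E\vdash M:A$. $\Gamma$ is a set of assignments $x:L$, $\Delta$ a set of assignments $x:A$, $\mathcal E$ a set of pairs $(\Theta;\Phi)$ of sets of assignments, where each $\Phi$ is empty or a singleton, at most one $\Phi$ is empty, and the $\Phi$'s have distinct domains; each variable has one place in a context. $\mathcal E\sqcup\mathcal E'$ is the union in which pairs with the same $\Phi$ are merged by joining their $\Theta$'s, and $(\emptyset;\emptyset)$ is neutral. In two-premise rules the domains of the two contexts are disjoint, except that the same assignment may be a $\Phi$ in both. The rules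 are: - $(A)$ $\Gamma,x:L;\Delta;\mathcal E\vdash x:L$. - $(C)$ from $\Gamma;\Delta;\mathcal E,(\Theta_x;x:A),(\Theta_y;y:A)\vdash M:B$ infer $\Gamma;\Delta;\mathcal E\sqcup\{(\Theta_x,\Theta_y;z:A)\}\vdash M\{z/x,z/y\}:B$. - Introductions, from a judgement for $M:B$ to one for $\lambda x.M$: $(\multimap I)$ discharges $x:L$ from $\Gamma$, type $L\multimap B$; $(\multimap I_\$)$ discharges $x:A$ from $\Delta$, type $\$A\multimap B$; $(\multimap I_!)$ replaces $(\Theta;x:A)$ in $\mathcal E$ by $(\Theta;\emptyset)$ (merged with $\sqcup$), type ${!A}\multimap B$; $(\multimap_v I)$ discharges $x:A$ from the $\Theta$ of the pair $(\Theta;\emptyset)$, type $\$A\multimap_v B$. - Eliminations, which merge the two contexts and give $MN:B$: $(\multimap E)$ from $M:A\multimap B$ and $N:A$ with $A$ not of the form $!C$; $(\multimap E_!)$ from $M:{!A}\multimap B$ and $N:{!A}$, where all the $\Theta$'s in the context of $M$ are empty; $(\multimap_v E)$ from $M:\$A\multimap_v B$ and $N:\$A$, where the context of $N$ is $\emptyset;\emptyset;\mathcal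 E_N$ with $\mathcal E_N\subseteq\{(\Theta;\emptyset)\}$. - $(\$)$ from $\Gamma;\Delta';\{(\Theta';\emptyset)\}\vdash M:B$ infer $\Gamma';\$\Delta',\Delta;\{(\$\Theta';\emptyset)\}\sqcup\{(\Theta_1;\Phi_1)\}\sqcup\dots\sqcup\{(\Theta_m;\Phi_m)\}\vdash M:\$B$ if $\Gamma\subseteq\Delta\cup\bigcup_i\Theta_i\cup\bigcup_i\Phi_i$ and, for each $i$, $\Theta_i\ne\emptyset$ iff $\Phi_i=\emptyset$. - $(!)$ from $\Gamma;\emptyset;\{(\Theta';\emptyset)\}\vdash M:B$ infer $\Gamma';\Delta;\{(\$\Theta';\emptyset)\}\sqcup\{(\Theta;\Phi)\}\vdash M:{!B}$ if $\Gamma\subseteq\Theta\cup\Phi$ and, when $\Theta\neq\emptyset$, the variable of $\Phi$ exists and occurs free in $M$. - $(\forall I)$ from $M:L$ infer $M:\forall\alpha.L$ if $\alpha$ is not free in the context; $(\forall E)$ from $M:\forall\alpha.L$ infer $M:L\{L'/\alpha\}$. Write $\vdash M:A$ if all three contexts are empty. *Data.* $\bigotimes_{i=1}^m A_i=\forall\alpha.(A_1\multimap\dots\multimap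 A_m\multimap\alpha)\multimap\alpha$, $\langle M_1,\dots,M_m\rangle=\lambda z.zM_1\cdots M_m$; $\mathbf B_m=\forall\alpha.(\bigotimes_{i=1}^m\alpha)\multimap\alpha$, $\pi^m_i=\lambda w.w(\lambda x_0\dots x_{m-1}.x_i)$; $\mathbf N=\forall\alpha.!(\alpha\multimap\alpha)\multimap\$(\alpha\multimap\alpha)$, $\overline n=\lambda fy.f^n y$; $\mathbf LA=\forall\alpha\beta.!(A\multimap(\beta\multimap\alpha)\multimap\alpha)\multimap\$(\alpha\multimap\beta\multimap\alpha)$. For terms $c,x$ put $Q_{c,x}()=x$ and $Q_{c,x}(M_1,\dots,M_m)=c\,M_1(\lambda y.Q_{c,x}(M_2,\dots,M_m))$ with $y$ fresh; $[M_1,\dots,M_m]=\lambda cxy.Q_{c,x}(M_1,\dots,M_m)$. *Machines.* $\mathbf M$ is a deterministic Turing machine with one two-way infinite tape, states $s_0,\dots,s_{q-1}$ (initial state $s_0$, accepting state $s_a$), alphabet $\Sigma=\{\sigma_1,\dots,\sigma_k\}$ with $k\ge3$ ($\sigma_1,\sigma_2,\sigma_3$ being false, true, blank), and transition function $\delta$,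 which from the scanned symbol and the state gives the symbol to write, the move (left, right or stay) and the new state; $\delta(\sigma,s_a)$ is: write $\sigma$, stay, state $s_a$. A configuration is $(\ell,s,r)$: $r\in\Sigma^*$ is the tape from the scanned cell rightwards, $\ell\in\Sigma^*$ the tape to the left of it, nearest cell first, all other cells being blank. One step reads the first symbol of $r$ (blank if $r$ is empty), rewrites that cell (so that it becomes explicit in the word), moves, and, on a left move with $\ell$ empty, adds an explicit blank. The initial configuration on input $w\in\Sigma^*$ is $(\varepsilon,s_0,w)$. The output portion of a configuration is the longest blank-free prefix of $r$. $\mathbf M$ outputs $v$ on $w$ if it reaches $s_a$ on $w$ in a configuration with output portion $v$. *Encodings.* $\mathbf\Sigma=\mathbf B_{k+2}$, $\mathbf S=\mathbf B_q$; $\sigma_i$ is encoded by $\pi^{k+2}_i$, the borders by $\bot=\pi^{k+2}_0$ and $\top=\pi^{k+2}_{k+1}$, and $s_i$ by $\pi^q_i$. $\ulcorner w\urcorner$ is the list of the encoded symbols of $w$. A configuration $(\ell,s,r)$ is encoded by $\ulcorner\ell,s,r\urcorner=\lambda c.\lambda l'r'.\langle\lambda y.Q_{c,l'}(\ell,\bot),\,s,\,\lambda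 y.Q_{c,r'}(r,\top)\rangle$ (with encoded symbols and states). Configurations have type $\mathbf C=\forall\alpha\beta.!(\mathbf\Sigma\multimap((\beta\multimap\beta)\multimap\alpha)\multimap\alpha)\multimap\$(\alpha\multimap\alpha\multimap(((\beta\multimap\beta)\multimap\alpha)\otimes\mathbf S\otimes((\beta\multimap\beta)\multimap\alpha)))$. *Statement.* Let $\mathbf M$ be such a machine, $I\subseteq\Sigma^*$ a set of inputs (for instance $I=\Sigma^*$), and $p$ a polynomial with coefficients in $\mathbb N$ such that, on every $w\in I$, $\mathbf M$ reaches $s_a$ in at most $p(|w|)$ steps. Let $e\ge1$ with $\deg p\le2^e$ (in particular, $e$ may be the least such number). Then there are $K\in\mathbb N$ and closed terms $\overline\delta$, $P$, $\overline{\mathbf M}$ such that: 1. $\vdash\overline\delta:\mathbf C\multimap\mathbf C$, and $\overline\delta\,\ulcorner c\urcorner\to^+\ulcorner c'\urcorner$ for every configuration $c$ of $\mathbf M$, where $c'$ is its successor configuration; 2. $\vdash P:\$\mathbf N\multimap_v\$^{4e}\mathbf N$, and $P\,\overline n\to^+\overline{Kn^{2^e}}$ and $p(n)\le K(n+1)^{2^e}$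 for every $n\ge0$; 3. $\vdash\overline{\mathbf M}:\mathbf L\mathbf\Sigma\multimap\$^{4e+1}\mathbf C$, and for every $w\in\Sigma^*$, with $N=K(|w|+1)^{2^e}$: $\vdash\ulcorner w\urcorner:\mathbf L\mathbf\Sigma$ and $\overline{\mathbf M}\,\ulcorner w\urcorner\to^+(\lambda z.z\,\ulcorner\varepsilon,s_0,w\urcorner)(\overline N\,\overline\delta)$; 4. if $w\in I$ and $\mathbf M$ outputs $v$ on $w$, there are $\ell,r\in\Sigma^*$, with $r$ empty or beginning with a blank, such that $\vdash\ulcorner\ell,s_a,vr\urcorner:\$^{4e+1}\mathbf C$, both $(\lambda z.z\,\ulcorner\varepsilon,s_0,w\urcorner)(\overline N\,\overline\delta)\to^+\ulcorner\ell,s_a,vr\urcorner$ and $\overline{\mathbf M}\,\ulcorner w\urcorner\to^+\ulcorner\ell,s_a,vr\urcorner$. -/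

import Mathlib

namespace WALT

/-! ## Lambda-terms and their rewriting relation -/

/-- Pure `λ`-terms up to `α`-equivalence, in de Bruijn notation. The free variables of a term are
named by natural numbers: `var x`, outside every `lam`, is the variable with name `x`. -/
inductive Tm : Type
  | var (x : ℕ)
  | lam (M : Tm)
  | app (M N : Tm)

/-- Extend a renaming under one binder. -/
def liftRen (f : ℕ → ℕ) : ℕ → ℕ
  | 0 => 0
  | x + 1 => f x + 1

namespace Tm

/-- Capture free renaming of the free variables. -/
def rename : (ℕ → ℕ) → Tm → Tm
  | f, var x => var (f x)
  | f, lam M => lam (rename (liftRen f) M)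
  | f, app M N => app (rename f M) (rename f N)

/-- The term seen under one more binder, which binds nothing in it. -/
def shift (M : Tm) : Tm := M.rename Nat.succ

/-- Extend a substitution under one binder. -/
def liftSub (σ : ℕ → Tm) : ℕ → Tm
  | 0 => var 0
  | x + 1 => (σ x).shift

/-- Capture free simultaneous substitution. -/
def subst : (ℕ → Tm) → Tm → Tm
  | σ, var x => σ x
  | σ, lam M => lam (subst (liftSub σ) M)
  | σ, app M N => app (subst σ M) (subst σ N)

/-- For the body `M` of an abstraction `lam M`, the term `M{N/x}` with `x` the bound variable. -/
def inst (M N : Tm) : Tm :=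
  M.subst fun x => match x with
    | 0 => N
    | y + 1 => var y

/-- The abstraction `\x.M` of the variable named `x`; the other free variables keep their names. -/
def abs (x : ℕ) (M : Tm) : Tm := lam (M.rename fun y => if y = x then 0 else y + 1)

/-- The number of free occurrences of `x` in a term. -/
def occ : ℕ → Tm → ℕ
  | x, var y => if y = x then 1 else 0
  | x, lam M => occ (x + 1) M
  | x, app M N => occ x M + occ x N

/-- A term without free variables. -/
def Closed (M : Tm) : Prop := ∀ x, M.occ x = 0

/-- Values: variables and abstractions. -/
def IsValue : Tm → Prop
  | var _ => True
  | lam _ => True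
  | app _ _ => False

end Tm

/-- The rewriting relation: the contextual closure of `(\x.M)N ▸ M{N/x}`, restricted to the cases
(1) `x` does not occur in `M`; (2) `x` occurs once in `M` and `N` is a value; (3) `x` occurs more
than once in `M`, and `N` is a value with at most one free variable. -/
inductive Step : Tm → Tm → Prop
  | beta (M N : Tm)
      (h : M.occ 0 = 0 ∨ (M.occ 0 = 1 ∧ N.IsValue) ∨
        (1 < M.occ 0 ∧ N.IsValue ∧ ∃ y, ∀ x, N.occ x ≠ 0 → x = y)) :
      Step (.app (.lam M) N) (M.inst N)
  | lam {M M' : Tm} : Step M M' → Step (.lam M) (.lam M')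
  | appL {M M' : Tm} (N : Tm) : Step M M' → Step (.app M N) (.app M' N)
  | appR (M : Tm) {N N' : Tm} : Step N N' → Step (.app M N) (.app M N')

/-- The transitive closure of the rewriting relation. -/
def Reduces : Tm → Tm → Prop := Relation.TransGen Step

/-! ## Types -/

mutual

/-- Formulae `A ::= L | !A | $A`. -/
inductive Ty : Type
  | lin (L : LTy)
  | bang (A : Ty)
  | para (A : Ty)

/-- Linear formulae `L ::= α | A ⊸ A | $A ⊸ᵥ A | ∀α.L`, with de Bruijn indices for the bound
type variables; `limp A B` is `A ⊸ B`, and `eimp A B` is `$A ⊸ᵥ B` (the `$` in front of the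
argument is part of the connective). -/
inductive LTy : Type
  | tvar (a : ℕ)
  | limp (A B : Ty)
  | eimp (A B : Ty)
  | all (L : LTy)

end

mutual

/-- Capture free renaming of the free type variables. -/
def Ty.rename : (ℕ → ℕ) → Ty → Ty
  | f, .lin L => .lin (LTy.rename f L)
  | f, .bang A => .bang (Ty.rename f A)
  | f, .para A => .para (Ty.rename f A)

/-- Capture free renaming of the free type variables. -/
def LTy.rename : (ℕ → ℕ) → LTy → LTy
  | f, .tvar a => .tvar (f a)
  | f, .limp A B => .limp (Ty.rename f A) (Ty.rename f B)
  | f, .eimp A B => .eimp (Ty.rename f A) (Ty.rename f B)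
  | f, .all L => .all (LTy.rename (liftRen f) L)

end

/-- Extend a type substitution under one quantifier. -/
def LTy.liftSub (σ : ℕ → LTy) : ℕ → LTy
  | 0 => .tvar 0
  | a + 1 => (σ a).rename Nat.succ

mutual

/-- Capture free substitution of linear formulae for type variables. -/
def Ty.subst : (ℕ → LTy) → Ty → Ty
  | σ, .lin L => .lin (LTy.subst σ L)
  | σ, .bang A => .bang (Ty.subst σ A)
  | σ, .para A => .para (Ty.subst σ A)

/-- Capture free substitution of linear formulae for type variables. -/
def LTy.subst : (ℕ → LTy) → LTy → LTy
  | σ, .tvar a => σ a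
  | σ, .limp A B => .limp (Ty.subst σ A) (Ty.subst σ B)
  | σ, .eimp A B => .eimp (Ty.subst σ A) (Ty.subst σ B)
  | σ, .all L => .all (LTy.subst (LTy.liftSub σ) L)

end

mutual

/-- The type variable `a` occurs free in a formula. -/
def Ty.Occurs : ℕ → Ty → Prop
  | a, .lin L => LTy.Occurs a L
  | a, .bang A => Ty.Occurs a A
  | a, .para A => Ty.Occurs a A

/-- The type variable `a` occurs free in a linear formula. -/
def LTy.Occurs : ℕ → LTy → Prop
  | a, .tvar b => b = a
  | a, .limp A B => Ty.Occurs a A ∨ Ty.Occurs a B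
  | a, .eimp A B => Ty.Occurs a A ∨ Ty.Occurs a B
  | a, .all L => LTy.Occurs (a + 1) L

end

/-- For the body `L` of a quantified formula `all L`, the formula `L{L'/α}` with `α` the bound
variable. -/
def LTy.inst (L L' : LTy) : LTy :=
  L.subst fun a => match a with
    | 0 => L'
    | b + 1 => .tvar b

/-- The formula `∀a.L`, for a type variable named `a`. -/
def LTy.forallVar (a : ℕ) (L : LTy) : LTy :=
  .all (L.rename fun b => if b = a then 0 else b + 1)

/-- `$ⁿA`. -/
def Ty.paras (n : ℕ) (A : Ty) : Ty := Ty.para^[n] A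

/-! ## Contexts -/

/-- The place of a variable in a context `Γ; Δ; ℰ`, with its type:
`lin L` — an assignment `x : L` of `Γ` (linear);
`disch A` — an assignment `x : A` of `Δ` (linear partially discharged);
`poly A` — the assignment `x : A` is the `Φ` of some pair `(Θ; Φ)` of `ℰ` (polynomial);
`elem none A` — an assignment `x : A` of the `Θ` of the pair `(Θ; ∅)` of `ℰ` (elementary);
`elem (some y) A` — an assignment `x : A` of the `Θ` of the pair `(Θ; {y : B})` of `ℰ`
(elementary). -/
inductive Zone : Type
  | lin (L : LTy)
  | disch (A : Ty)
  | elem (g : Option ℕ) (A : Ty)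
  | poly (A : Ty)

/-- The type assigned to a variable in some place. -/
def Zone.ty : Zone → Ty
  | .lin L => .lin L
  | .disch A => A
  | .elem _ A => A
  | .poly A => A

/-- Change the `Φ`-variable which an elementary assignment is paired with. -/
def Zone.regroup (f : ℕ → Option ℕ) : Zone → Zone
  | .elem (some y) A => .elem (f y) A
  | Z => Z

/-- A context `Γ; Δ; ℰ`, as the partial map that sends each of its variables to its place. Distinct
pairs of `ℰ` have distinct `Φ`, and at most one has `Φ = ∅`, so `ℰ` is determined by the map, up to
the pair `(∅; ∅)`, which is neutral. -/
def Ctx : Type := ℕ → Option Zone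

namespace Ctx

/-- The empty context `∅; ∅; ∅`. -/
def empty : Ctx := fun _ => none

/-- Every elementary assignment paired with `Φ = {y : B}` has its `y` in the context. -/
def WF (C : Ctx) : Prop :=
  ∀ x y A, C x = some (.elem (some y) A) → ∃ B, C y = some (.poly B)

/-- Remove the variable `x`, discharged by an abstraction. If `x` was polynomial, in a pair
`(Θ; {x : A})`, then `Θ` is merged into the pair `(Θ'; ∅)`. -/
def discharge (C : Ctx) (x : ℕ) : Ctx := fun w =>
  if w = x then none else (C w).map (Zone.regroup fun y => if y = x then none else some y)

/-- Replace the pairs `(Θx; {x : A})` and `(Θy; {y : A})` by `(Θx, Θy; {z : A})`. -/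
def contract (C : Ctx) (x y z : ℕ) (A : Ty) : Ctx := fun w =>
  if w = z then some (.poly A)
  else if w = x ∨ w = y then none
  else (C w).map (Zone.regroup fun v => if v = x ∨ v = y then some z else some v)

/-- The type variable `a` occurs free in some type of the context. -/
def Occurs (C : Ctx) (a : ℕ) : Prop := ∃ x Z, C x = some Z ∧ Z.ty.Occurs a

/-- What a variable becomes when the contexts of two premises are merged: a variable belongs to at
most one of them, except that the same polynomial assignment may belong to both. -/
inductive MergeAt : Option Zone → Option Zone → Option Zone → Prop
  | left (o : Option Zone) : MergeAt o none o
  | right (o : Option Zone) : MergeAt none o o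
  | poly (A : Ty) : MergeAt (some (.poly A)) (some (.poly A)) (some (.poly A))

/-- `C` is `Γ₁, Γ₂; Δ₁, Δ₂; ℰ₁ ⊔ ℰ₂`, where `Cᵢ` is `Γᵢ; Δᵢ; ℰᵢ`. -/
def Merge (C₁ C₂ C : Ctx) : Prop := ∀ x, MergeAt (C₁ x) (C₂ x) (C x)

/-- What a variable becomes in the rule `$`, from the premise to the conclusion: the assignments of
`Δ'` and `Θ'` get a `$`, each one of `Γ` goes to `Δ`, or to some `(Θᵢ; ∅)`, or is the `Φᵢ` of some
`(∅; Φᵢ)`, and new assignments can be added in these places and in `Γ'`. -/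
inductive ParaAt : Option Zone → Option Zone → Prop
  | disch (A : Ty) : ParaAt (some (.disch A)) (some (.disch (.para A)))
  | elem (A : Ty) : ParaAt (some (.elem none A)) (some (.elem none (.para A)))
  | toDisch (L : LTy) : ParaAt (some (.lin L)) (some (.disch (.lin L)))
  | toElem (L : LTy) : ParaAt (some (.lin L)) (some (.elem none (.lin L)))
  | toPoly (L : LTy) : ParaAt (some (.lin L)) (some (.poly (.lin L)))
  | absent : ParaAt none none
  | newLin (L : LTy) : ParaAt none (some (.lin L))
  | newDisch (A : Ty) : ParaAt none (some (.disch A))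
  | newElem (A : Ty) : ParaAt none (some (.elem none A))
  | newPoly (A : Ty) : ParaAt none (some (.poly A))

/-- What the variable `x` becomes in the rule `!`, from the premise to the conclusion, where `p` is
the variable of the `Φ` of the new pair `(Θ; Φ)`, if there is one: the assignments of `Θ'` get a `$`,
each one of `Γ` goes to `Θ` or `Φ`, and new assignments can be added to `Γ'`, `Δ`, `Θ`, `Φ`. As
`Φ ≠ ∅` whenever `Θ ≠ ∅`, the assignments of `Θ` are always paired with the variable `p`. -/
inductive BangAt (p : Option ℕ) (x : ℕ) : Option Zone → Option Zone → Prop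
  | elem (A : Ty) : BangAt p x (some (.elem none A)) (some (.elem none (.para A)))
  | toElem (L : LTy) (y : ℕ) (h : p = some y) :
      BangAt p x (some (.lin L)) (some (.elem (some y) (.lin L)))
  | toPoly (L : LTy) (h : p = some x) : BangAt p x (some (.lin L)) (some (.poly (.lin L)))
  | absent : BangAt p x none none
  | newLin (L : LTy) : BangAt p x none (some (.lin L))
  | newDisch (A : Ty) : BangAt p x none (some (.disch A))
  | newElem (A : Ty) (y : ℕ) (h : p = some y) : BangAt p x none (some (.elem (some y) A))
  | newPoly (A : Ty) (h : p = some x) : BangAt p x none (some (.poly A))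

end Ctx

/-! ## Weak affine light typing -/

/-- The judgements `Γ; Δ; ℰ ⊢ M : A` of weak affine light typing. -/
inductive Typing : Ctx → Tm → Ty → Prop
  /-- Rule `A`. -/
  | ax {C : Ctx} {x : ℕ} {L : LTy} (hC : C.WF) (hx : C x = some (.lin L)) :
      Typing C (.var x) (.lin L)
  /-- Rule `C`. -/
  | contr {C : Ctx} {M : Tm} {B : Ty} (x y z : ℕ) (A : Ty) (hM : Typing C M B) (hxy : x ≠ y)
      (hx : C x = some (.poly A)) (hy : C y = some (.poly A))
      (hz : z = x ∨ z = y ∨ C z = none ∨ C z = some (.poly A)) :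
      Typing (C.contract x y z A) (M.rename fun w => if w = x ∨ w = y then z else w) B
  /-- Rule `⊸I`. -/
  | limpI {C : Ctx} {M : Tm} {B : Ty} (x : ℕ) {L : LTy} (hM : Typing C M B)
      (hx : C x = some (.lin L)) :
      Typing (C.discharge x) (.abs x M) (.lin (.limp (.lin L) B))
  /-- Rule `⊸I_$`. -/
  | limpIPara {C : Ctx} {M : Tm} {B : Ty} (x : ℕ) {A : Ty} (hM : Typing C M B)
      (hx : C x = some (.disch A)) :
      Typing (C.discharge x) (.abs x M) (.lin (.limp (.para A) B))
  /-- Rule `⊸I_!`. -/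
  | limpIBang {C : Ctx} {M : Tm} {B : Ty} (x : ℕ) {A : Ty} (hM : Typing C M B)
      (hx : C x = some (.poly A)) :
      Typing (C.discharge x) (.abs x M) (.lin (.limp (.bang A) B))
  /-- Rule `⊸ᵥI`. -/
  | eimpI {C : Ctx} {M : Tm} {B : Ty} (x : ℕ) {A : Ty} (hM : Typing C M B)
      (hx : C x = some (.elem none A)) :
      Typing (C.discharge x) (.abs x M) (.lin (.eimp A B))
  /-- Rule `⊸E`. -/
  | limpE {C₁ C₂ C : Ctx} {M N : Tm} {A B : Ty} (hM : Typing C₁ M (.lin (.limp A B)))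
      (hN : Typing C₂ N A) (hA : ∀ A', A ≠ .bang A') (hC : Ctx.Merge C₁ C₂ C) :
      Typing C (.app M N) B
  /-- Rule `⊸E_!`: the context of the function has no elementary assignments. -/
  | limpEBang {C₁ C₂ C : Ctx} {M N : Tm} {A B : Ty}
      (hM : Typing C₁ M (.lin (.limp (.bang A) B))) (hN : Typing C₂ N (.bang A))
      (hC₁ : ∀ x g A', C₁ x ≠ some (.elem g A')) (hC : Ctx.Merge C₁ C₂ C) :
      Typing C (.app M N) B
  /-- Rule `⊸ᵥE`: the context of the argument is `∅; ∅; ℰ` with `ℰ ⊆ {(Θ; ∅)}`. -/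
  | eimpE {C₁ C₂ C : Ctx} {M N : Tm} {A B : Ty} (hM : Typing C₁ M (.lin (.eimp A B)))
      (hN : Typing C₂ N (.para A)) (hC₂ : ∀ x Z, C₂ x = some Z → ∃ A', Z = .elem none A')
      (hC : Ctx.Merge C₁ C₂ C) :
      Typing C (.app M N) B
  /-- Rule `$`. -/
  | paraBox {C C' : Ctx} {M : Tm} {B : Ty} (hM : Typing C M B)
      (hC : ∀ x, Ctx.ParaAt (C x) (C' x)) :
      Typing C' M (.para B)
  /-- Rule `!`, with the new pair `(Θ; Φ)`: if `p = none` then `Φ = ∅`, if `p = some y` then `Φ` is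
  an assignment to `y`, which occurs in `M` unless `Θ = ∅`. -/
  | bangBox {C C' : Ctx} {M : Tm} {B : Ty} (p : Option ℕ) (hM : Typing C M B)
      (hC : ∀ x, Ctx.BangAt p x (C x) (C' x))
      (hp : ∀ y, p = some y → ∃ A, C' y = some (.poly A))
      (hocc : ∀ x y A, C' x = some (.elem (some y) A) → M.occ y ≠ 0) :
      Typing C' M (.bang B)
  /-- Rule `∀I`. -/
  | allI {C : Ctx} {M : Tm} (a : ℕ) {L : LTy} (hM : Typing C M (.lin L)) (ha : ¬ C.Occurs a) :
      Typing C M (.lin (L.forallVar a))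
  /-- Rule `∀E`. -/
  | allE {C : Ctx} {M : Tm} {L : LTy} (L' : LTy) (hM : Typing C M (.lin (.all L))) :
      Typing C M (.lin (L.inst L'))

/-- `∅; ∅; ∅ ⊢ M : A`. -/
def HasType (M : Tm) (A : Ty) : Prop := Typing Ctx.empty M A

/-! ## Data-types -/

/-- `A ⊸ B` as a formula. -/
def Ty.arrow (A B : Ty) : Ty := .lin (.limp A B)

/-- A type variable as a formula. -/
def Ty.tvar (a : ℕ) : Ty := .lin (.tvar a)

/-- `A₁ ⊸ ⋯ ⊸ Aₘ ⊸ B`. -/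
def Ty.arrows (As : List Ty) (B : Ty) : Ty := As.foldr Ty.arrow B

/-- The tensor `A₁ ⊗ ⋯ ⊗ Aₘ = ∀α.(A₁ ⊸ ⋯ ⊸ Aₘ ⊸ α) ⊸ α`, with `α` fresh. -/
def tensorTy (As : List Ty) : LTy :=
  .all (.limp (.arrows (As.map (Ty.rename Nat.succ)) (.tvar 0)) (.tvar 0))

/-- The tuple `⟨M₁, …, Mₘ⟩ = \z.z M₁ ⋯ Mₘ`, with `z` fresh. -/
def tuple (Ms : List Tm) : Tm := .lam ((Ms.map Tm.shift).foldl .app (.var 0))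

/-- The booleans `𝐁ₘ = ∀α.(α ⊗ ⋯ ⊗ α) ⊸ α`, with `m` factors `α`. -/
def boolTy (m : ℕ) : LTy :=
  .all (.limp (.lin (tensorTy (List.replicate m (.tvar 0)))) (.tvar 0))

/-- The projection `πᵐᵢ = \⟨x₀ … xₘ₋₁⟩.xᵢ = \w.w(\x₀ … xₘ₋₁.xᵢ)`. -/
def proj (m i : ℕ) : Tm := .lam (.app (.var 0) (Tm.lam^[m] (.var (m - 1 - i))))

/-- The Church numerals `𝐍 = ∀α.!(α ⊸ α) ⊸ $(α ⊸ α)`. -/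
def natTy : LTy :=
  .all (.limp (.bang (.arrow (.tvar 0) (.tvar 0))) (.para (.arrow (.tvar 0) (.tvar 0))))

/-- The Church numeral `\f y.f(⋯(f y)⋯)`. -/
def church (n : ℕ) : Tm := .lam (.lam ((Tm.app (.var 1))^[n] (.var 0)))

/-- Lists `𝐋A = ∀αβ.!(A ⊸ (β ⊸ α) ⊸ α) ⊸ $(α ⊸ β ⊸ α)`, with `α`, `β` fresh. -/
def listTy (A : Ty) : LTy :=
  let α : Ty := .tvar 1
  let β : Ty := .tvar 0
  .all (.all (.limp (.bang (.arrows [A.rename (· + 2), .arrow β α] α)) (.para (.arrows [α, β] α))))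

/-- `\y.M`, with `y` fresh. -/
def thunk (M : Tm) : Tm := .lam M.shift

/-- The quasi-tape `c M₁ (\y.c M₂ (\y. ⋯ (\y.c Mₘ (\y.x)) ⋯ ))`, which is `x` for `m = 0`. -/
def quasiTape (c x : Tm) : List Tm → Tm
  | [] => x
  | M :: Ms => .app (.app c M) (thunk (quasiTape c x Ms))

/-- The list `[M₁, …, Mₘ] = \c x y.c M₁ (\y.c M₂ (⋯ (\y.c Mₘ (\y.x)) ⋯ ))`; the empty list is
`\c x y.x`. -/
def listTm (Ms : List Tm) : Tm :=
  .lam (.lam (.lam (quasiTape (.var 2) (.var 1) (Ms.map (Tm.rename (· + 3))))))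

/-! ## Turing machines -/

/-- The moves of the head. -/
inductive Move : Type
  | left
  | right
  | stay

/-- A deterministic Turing machine with one two-way infinite tape. The states are
`s₀, s₁, …`, with initial state `s₀`; the tape symbols are `σ₁, σ₂, …`, where `σᵢ₊₁` is the element
`i` of `Fin numSymbols`, with at least the symbols false, true, blank (`σ₁`, `σ₂`, `σ₃`). The
transition function `δ` maps the symbol under the head and the state to the move, the symbol to
be written, and the new state; it cannot leave the accepting state, where it does nothing. -/
structure TuringMachine where
  numStates : ℕ
  numSymbols : ℕ
  states_pos : 0 < numStates
  three_le_symbols : 3 ≤ numSymbols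
  accept : Fin numStates
  δ : Fin numSymbols → Fin numStates → Move × Fin numSymbols × Fin numStates
  δ_accept : ∀ σ, δ σ accept = (.stay, σ, accept)

namespace TuringMachine

variable (M : TuringMachine)

/-- The initial state `s₀`. -/
def start : Fin M.numStates := ⟨0, M.states_pos⟩

/-- The blank `σ₃`. -/
def blank : Fin M.numSymbols := ⟨2, M.three_le_symbols⟩

/-- A configuration: `right` holds the symbol under the head and those to its right, `left` the
symbols to the left of the head, starting with the nearest. All the other cells are blank. -/
structure Config where
  left : List (Fin M.numSymbols)
  state : Fin M.numStates
  right : List (Fin M.numSymbols)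

variable {M}

/-- One step of computation: read the symbol under the head, write, move, change state. -/
def step (c : M.Config) : M.Config :=
  match M.δ (c.right.headD M.blank) c.state with
  | (.left, σ, s) => ⟨c.left.tail, s, c.left.headD M.blank :: σ :: c.right.tail⟩
  | (.right, σ, s) => ⟨σ :: c.left, s, c.right.tail⟩
  | (.stay, σ, s) => ⟨c.left, s, σ :: c.right.tail⟩

variable (M)

/-- The initial configuration, with the head on the first symbol of the input. -/
def init (w : List (Fin M.numSymbols)) : M.Config := ⟨[], M.start, w⟩

/-- On the input tape `w`, `M` enters the accepting state with output portion `v`: the symbol under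
the head and all those to its right, up to the first blank. -/
def Outputs (w v : List (Fin M.numSymbols)) : Prop :=
  ∃ t, (step^[t] (M.init w)).state = M.accept ∧
    v = (step^[t] (M.init w)).right.takeWhile (· ≠ M.blank)

/-- On every input tape `w` of `I`, the machine `M` enters the accepting state in at most `p(|w|)`
steps. -/
def PolyTimeOn (I : Set (List (Fin M.numSymbols))) (p : Polynomial ℕ) : Prop :=
  ∀ w ∈ I, ∃ t ≤ p.eval w.length, (step^[t] (M.init w)).state = M.accept

/-! ## Encoding of symbols, states, tapes and configurations -/

/-- The type `𝚺` of the symbols of the alphabet, together with the border marks `⊥`, `⊤`. -/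
def symTy : LTy := boolTy (M.numSymbols + 2)

/-- The type `𝐒` of the states. -/
def stateTy : LTy := boolTy M.numStates

/-- The type `𝐂 = ∀αβ.!(𝚺 ⊸ ((β ⊸ β) ⊸ α) ⊸ α) ⊸
$(α ⊸ α ⊸ (((β ⊸ β) ⊸ α) ⊗ 𝐒 ⊗ ((β ⊸ β) ⊸ α)))` of the configurations. -/
def confTy : LTy :=
  let α : Ty := .tvar 1
  let side : Ty := .arrow (.arrow (.tvar 0) (.tvar 0)) α
  .all (.all (.limp (.bang (.arrows [.lin M.symTy, side] α))
    (.para (.arrows [α, α] (.lin (tensorTy [side, .lin M.stateTy, side]))))))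

variable {M}

/-- The term for the symbol `σᵢ`, that is `πᵢ`. -/
def symTm (σ : Fin M.numSymbols) : Tm := proj (M.numSymbols + 2) (σ.val + 1)

variable (M)

/-- The left border `⊥`. -/
def botTm : Tm := proj (M.numSymbols + 2) 0

/-- The right border `⊤`. -/
def topTm : Tm := proj (M.numSymbols + 2) (M.numSymbols + 1)

variable {M}

/-- The term for the state `sᵢ`, that is `πᵢ`. -/
def stateTm (s : Fin M.numStates) : Tm := proj M.numStates s.val

/-- The list that represents an input tape. -/
def tapeTm (w : List (Fin M.numSymbols)) : Tm := listTm (w.map symTm)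

/-- The configuration
`\c.\l r.⟨\y.c L₁ (\y. ⋯ c ⊥ (\y.l)), s, \y.c R₁ (\y. ⋯ c ⊤ (\y.r))⟩`. -/
def confTm (c : M.Config) : Tm :=
  .lam (.lam (.lam (tuple
    [thunk (quasiTape (.var 2) (.var 1) (c.left.map symTm ++ [M.botTm])),
      stateTm c.state,
      thunk (quasiTape (.var 2) (.var 0) (c.right.map symTm ++ [M.topTm]))])))

end TuringMachine

/-- The term `(\z.z N)(F D)`. If `F` is the Church numeral of `n`, it applies to `N` the `n`-fold
iteration of `D`. -/
def iterTm (F D N : Tm) : Tm := .app (.lam (.app (.var 0) N.shift)) (.app F D)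

end WALT

open WALT

namespace WALT

/-! ## Renaming and free variables of terms -/

namespace Tm

theorem rename_congr {M : Tm} : ∀ {f g : ℕ → ℕ}, (∀ i, M.occ i ≠ 0 → f i = g i) →
    M.rename f = M.rename g := by
  induction M with
  | var x => intro f g h; simp only [rename]; rw [h x (by simp [occ])]
  | lam M ih =>
    intro f g h
    simp only [rename]
    rw [ih]
    intro i hi
    cases i with
    | zero => rfl
    | succ i => simp only [liftRen]; rw [h i hi]
  | app M N ihM ihN =>
    intro f g h
    simp only [rename]
    rw [ihM fun i hi => h i (by simp only [occ]; omega),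
      ihN fun i hi => h i (by simp only [occ]; omega)]

theorem rename_id' (M : Tm) : ∀ {f : ℕ → ℕ}, (∀ i, M.occ i ≠ 0 → f i = i) → M.rename f = M := by
  induction M with
  | var x => intro f h; simp only [rename]; rw [h x (by simp [occ])]
  | lam M ih =>
    intro f h
    simp only [rename]
    rw [ih]
    intro i hi
    cases i with
    | zero => rfl
    | succ i => simp only [liftRen]; rw [h i hi]
  | app M N ihM ihN =>
    intro f h
    simp only [rename]
    rw [ihM fun i hi => h i (by simp only [occ]; omega),
      ihN fun i hi => h i (by simp only [occ]; omega)]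

theorem rename_rename (M : Tm) : ∀ f g : ℕ → ℕ,
    (M.rename f).rename g = M.rename fun i => g (f i) := by
  induction M with
  | var x => intro f g; rfl
  | lam M ih =>
    intro f g
    simp only [rename, ih]
    congr 2
    funext i
    cases i <;> rfl
  | app M N ihM ihN => intro f g; simp only [rename, ihM, ihN]

theorem occ_rename_ne_zero {M : Tm} : ∀ {f : ℕ → ℕ} {y : ℕ},
    (M.rename f).occ y ≠ 0 ↔ ∃ x, f x = y ∧ M.occ x ≠ 0 := by
  induction M with
  | var x => intro f y; simp [rename, occ]
  | lam M ih =>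
    intro f y
    simp only [rename, occ, ih]
    constructor
    · rintro ⟨x, hx, h⟩
      cases x with
      | zero => cases hx
      | succ x => exact ⟨x, Nat.succ.inj hx, h⟩
    · rintro ⟨x, hx, h⟩
      exact ⟨x + 1, by simp only [liftRen, hx], h⟩
  | app M N ihM ihN =>
    intro f y
    have e : ∀ a b : ℕ, a + b ≠ 0 ↔ a ≠ 0 ∨ b ≠ 0 := by intros; omega
    simp only [rename, occ, e, ihM, ihN]
    constructor
    · rintro (⟨x, h, h'⟩ | ⟨x, h, h'⟩)
      · exact ⟨x, h, .inl h'⟩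
      · exact ⟨x, h, .inr h'⟩
    · rintro ⟨x, h, h' | h'⟩
      · exact .inl ⟨x, h, h'⟩
      · exact .inr ⟨x, h, h'⟩

theorem liftRen_injective {f : ℕ → ℕ} (hf : Function.Injective f) :
    Function.Injective (liftRen f) := by
  intro a b h
  cases a <;> cases b <;> simp only [liftRen] at h <;> first | rfl | omega | skip
  rw [hf (Nat.succ.inj h)]

theorem occ_rename {M : Tm} : ∀ {f : ℕ → ℕ}, Function.Injective f → ∀ y,
    (M.rename f).occ (f y) = M.occ y := by
  induction M with
  | var x => intro f hf y; simp [rename, occ, hf.eq_iff]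
  | lam M ih =>
    intro f hf y
    exact ih (liftRen_injective hf) (y + 1)
  | app M N ihM ihN => intro f hf y; simp only [rename, occ, ihM hf, ihN hf]

theorem finite_occ (M : Tm) : {x | M.occ x ≠ 0}.Finite := by
  induction M with
  | var x => exact (Set.finite_singleton x).subset fun y hy => by simp_all [occ]
  | lam M ih =>
    exact (ih.preimage (f := Nat.succ) (Nat.succ_injective.injOn)).subset fun y hy => hy
  | app M N ihM ihN =>
    refine (ihM.union ihN).subset fun y hy => ?_
    simp only [Set.mem_ofPred_eq, occ, Set.mem_union] at *
    omega

theorem occ_abs (x : ℕ) (M : Tm) (y : ℕ) : (abs x M).occ y ≠ 0 ↔ y ≠ x ∧ M.occ y ≠ 0 := by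
  simp only [abs, occ, occ_rename_ne_zero]
  constructor
  · rintro ⟨z, hz, h⟩
    split_ifs at hz with hzx
    obtain rfl : z = y := by omega
    exact ⟨hzx, h⟩
  · rintro ⟨h, h'⟩
    exact ⟨y, by simp [h], h'⟩

theorem rename_abs {x : ℕ} {M : Tm} {f : ℕ → ℕ} (h : ∀ y, M.occ y ≠ 0 → (f y = 0 ↔ y = x)) :
    (abs x M).rename (fun y => f y - 1) = lam (M.rename f) := by
  simp only [abs, rename, rename_rename]
  congr 1
  apply rename_congr
  intro y hy
  by_cases hyx : y = x
  · simp [hyx, liftRen, (h x (hyx ▸ hy)).2 rfl]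
  · have := mt (h y hy).1 hyx
    simp only [hyx, if_false, liftRen]
    omega

end Tm

/-! ## Renaming and substitution of types -/

mutual

theorem Ty.rename_rename (f g : ℕ → ℕ) : ∀ A : Ty,
    (A.rename f).rename g = A.rename fun a => g (f a)
  | .lin L => by simp only [Ty.rename, LTy.rename_rename f g L]
  | .bang A => by simp only [Ty.rename, Ty.rename_rename f g A]
  | .para A => by simp only [Ty.rename, Ty.rename_rename f g A]

theorem LTy.rename_rename (f g : ℕ → ℕ) : ∀ L : LTy,
    (L.rename f).rename g = L.rename fun a => g (f a)
  | .tvar a => rfl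
  | .limp A B => by simp only [LTy.rename, Ty.rename_rename f g A, Ty.rename_rename f g B]
  | .eimp A B => by simp only [LTy.rename, Ty.rename_rename f g A, Ty.rename_rename f g B]
  | .all L => by
    simp only [LTy.rename, LTy.rename_rename _ _ L]
    congr 2
    funext a
    cases a <;> rfl

end

mutual

theorem Ty.subst_rename (f : ℕ → ℕ) (σ : ℕ → LTy) : ∀ A : Ty,
    (A.rename f).subst σ = A.subst fun a => σ (f a)
  | .lin L => by simp only [Ty.rename, Ty.subst, LTy.subst_rename f σ L]
  | .bang A => by simp only [Ty.rename, Ty.subst, Ty.subst_rename f σ A]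
  | .para A => by simp only [Ty.rename, Ty.subst, Ty.subst_rename f σ A]

theorem LTy.subst_rename (f : ℕ → ℕ) (σ : ℕ → LTy) : ∀ L : LTy,
    (L.rename f).subst σ = L.subst fun a => σ (f a)
  | .tvar a => rfl
  | .limp A B => by
    simp only [LTy.rename, LTy.subst, Ty.subst_rename f σ A, Ty.subst_rename f σ B]
  | .eimp A B => by
    simp only [LTy.rename, LTy.subst, Ty.subst_rename f σ A, Ty.subst_rename f σ B]
  | .all L => by
    simp only [LTy.rename, LTy.subst, LTy.subst_rename _ _ L]
    congr 2
    funext a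
    cases a <;> rfl

end

mutual

theorem Ty.rename_subst (σ : ℕ → LTy) (f : ℕ → ℕ) : ∀ A : Ty,
    (A.subst σ).rename f = A.subst fun a => (σ a).rename f
  | .lin L => by simp only [Ty.rename, Ty.subst, LTy.rename_subst σ f L]
  | .bang A => by simp only [Ty.rename, Ty.subst, Ty.rename_subst σ f A]
  | .para A => by simp only [Ty.rename, Ty.subst, Ty.rename_subst σ f A]

theorem LTy.rename_subst (σ : ℕ → LTy) (f : ℕ → ℕ) : ∀ L : LTy,
    (L.subst σ).rename f = L.subst fun a => (σ a).rename f
  | .tvar a => rfl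
  | .limp A B => by
    simp only [LTy.rename, LTy.subst, Ty.rename_subst σ f A, Ty.rename_subst σ f B]
  | .eimp A B => by
    simp only [LTy.rename, LTy.subst, Ty.rename_subst σ f A, Ty.rename_subst σ f B]
  | .all L => by
    simp only [LTy.rename, LTy.subst, LTy.rename_subst _ _ L]
    congr 2
    funext a
    cases a
    · rfl
    · simp only [LTy.liftSub, LTy.rename_rename, liftRen]

end

mutual

theorem Ty.subst_congr : ∀ (A : Ty) {σ τ : ℕ → LTy}, (∀ a, A.Occurs a → σ a = τ a) →
    A.subst σ = A.subst τ
  | .lin L, _, _, h => by simp only [Ty.subst]; rw [LTy.subst_congr L h]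
  | .bang A, _, _, h => by simp only [Ty.subst]; rw [Ty.subst_congr A h]
  | .para A, _, _, h => by simp only [Ty.subst]; rw [Ty.subst_congr A h]

theorem LTy.subst_congr : ∀ (L : LTy) {σ τ : ℕ → LTy}, (∀ a, L.Occurs a → σ a = τ a) →
    L.subst σ = L.subst τ
  | .tvar a, _, _, h => h a rfl
  | .limp A B, _, _, h => by
    simp only [LTy.subst]
    rw [Ty.subst_congr A fun a ha => h a (.inl ha), Ty.subst_congr B fun a ha => h a (.inr ha)]
  | .eimp A B, _, _, h => by
    simp only [LTy.subst]
    rw [Ty.subst_congr A fun a ha => h a (.inl ha), Ty.subst_congr B fun a ha => h a (.inr ha)]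
  | .all L, _, _, h => by
    simp only [LTy.subst]
    rw [LTy.subst_congr L]
    intro a ha
    cases a with
    | zero => rfl
    | succ a => simp only [LTy.liftSub]; rw [h a ha]

end

theorem LTy.liftSub_tvar : LTy.liftSub .tvar = .tvar := by
  funext a
  cases a <;> rfl

mutual

theorem Ty.subst_tvar : ∀ A : Ty, A.subst .tvar = A
  | .lin L => by simp only [Ty.subst, LTy.subst_tvar L]
  | .bang A => by simp only [Ty.subst, Ty.subst_tvar A]
  | .para A => by simp only [Ty.subst, Ty.subst_tvar A]

theorem LTy.subst_tvar : ∀ L : LTy, L.subst .tvar = L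
  | .tvar a => rfl
  | .limp A B => by simp only [LTy.subst, Ty.subst_tvar A, Ty.subst_tvar B]
  | .eimp A B => by simp only [LTy.subst, Ty.subst_tvar A, Ty.subst_tvar B]
  | .all L => by simp only [LTy.subst, LTy.liftSub_tvar, LTy.subst_tvar L]

end

mutual

theorem Ty.occurs_bounded : ∀ A : Ty, ∃ n, ∀ a ≥ n, ¬ A.Occurs a
  | .lin L => LTy.occurs_bounded L
  | .bang A => Ty.occurs_bounded A
  | .para A => Ty.occurs_bounded A

theorem LTy.occurs_bounded : ∀ L : LTy, ∃ n, ∀ a ≥ n, ¬ L.Occurs a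
  | .tvar b => ⟨b + 1, fun a ha h => by simp only [LTy.Occurs] at h; omega⟩
  | .limp A B => by
    obtain ⟨m, hm⟩ := Ty.occurs_bounded A
    obtain ⟨n, hn⟩ := Ty.occurs_bounded B
    exact ⟨max m n, fun a ha h => h.elim (hm a (by omega)) (hn a (by omega))⟩
  | .eimp A B => by
    obtain ⟨m, hm⟩ := Ty.occurs_bounded A
    obtain ⟨n, hn⟩ := Ty.occurs_bounded B
    exact ⟨max m n, fun a ha h => h.elim (hm a (by omega)) (hn a (by omega))⟩
  | .all L => by
    obtain ⟨n, hn⟩ := LTy.occurs_bounded L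
    exact ⟨n, fun a ha => hn (a + 1) (by omega)⟩

end

theorem LTy.forallVar_inst {L : LTy} {a : ℕ} (h : ¬ L.Occurs (a + 1)) :
    (L.inst (.tvar a)).forallVar a = .all L := by
  simp only [LTy.forallVar, LTy.inst, LTy.rename_subst]
  congr 1
  conv_rhs => rw [← LTy.subst_tvar L]
  apply LTy.subst_congr
  rintro (_ | b) hb
  · simp [LTy.rename]
  · have : b ≠ a := by rintro rfl; exact h hb
    simp [LTy.rename, this]

/-- The formula is not of the form `!A`. -/
def Ty.NotBang : Ty → Prop
  | .bang _ => False
  | _ => True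

/-! ## A judgement in de Bruijn style

The judgement `Der` has no elementary assignments, shares linear variables between the premises of
an application, and checks the number of occurrences where a variable is discharged. Its
derivations are turned into derivations of weak affine light typing by giving distinct names to the
occurrences of the variables, and contracting the polynomial ones. -/

/-- The context seen under one more binder. -/
def Ctx.cons (o : Option Zone) (C : Ctx) : Ctx
  | 0 => o
  | x + 1 => C x

/-- The context has no elementary assignments. -/
def Ctx.NoElem (C : Ctx) : Prop := ∀ x g A, C x ≠ some (.elem g A)

/-- Finitely many type variables occur in the context. -/
def Ctx.Bounded (C : Ctx) : Prop := ∃ n, ∀ a ≥ n, ¬ C.Occurs a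

/-- What a variable becomes when a paragraph box is closed. -/
inductive BoxAt : Option Zone → Option Zone → Prop
  | absent (o : Option Zone) : BoxAt none o
  | toDisch (L : LTy) : BoxAt (some (.lin L)) (some (.disch (.lin L)))
  | toPoly (L : LTy) : BoxAt (some (.lin L)) (some (.poly (.lin L)))
  | disch (A : Ty) : BoxAt (some (.disch A)) (some (.disch (.para A)))

/-- Derivations without elementary assignments, in de Bruijn style. -/
inductive Der : Ctx → Tm → Ty → Prop
  | var {Γ : Ctx} {i : ℕ} {L : LTy} (h : Γ i = some (.lin L)) : Der Γ (.var i) (.lin L)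
  | lamLin {Γ : Ctx} {M : Tm} {L : LTy} {B : Ty} (hM : Der (Γ.cons (some (.lin L))) M B)
      (hB : B.NotBang) (ho : M.occ 0 ≤ 1) : Der Γ (.lam M) (.lin (.limp (.lin L) B))
  | lamDisch {Γ : Ctx} {M : Tm} {A B : Ty} (hM : Der (Γ.cons (some (.disch A))) M B)
      (hB : B.NotBang) (ho : M.occ 0 ≤ 1) : Der Γ (.lam M) (.lin (.limp (.para A) B))
  | lamPoly {Γ : Ctx} {M : Tm} {A B : Ty} (hM : Der (Γ.cons (some (.poly A))) M B)
      (hB : B.NotBang) : Der Γ (.lam M) (.lin (.limp (.bang A) B))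
  | app {Γ : Ctx} {M N : Tm} {A B : Ty} (hM : Der Γ M (.lin (.limp A B))) (hN : Der Γ N A) :
      Der Γ (.app M N) B
  | para {Γ Γ' : Ctx} {M : Tm} {B : Ty} (hM : Der Γ' M B) (h : ∀ i, BoxAt (Γ' i) (Γ i)) :
      Der Γ M (.para B)
  | bang {Γ Γ' : Ctx} {M : Tm} {B : Ty} (hM : Der Γ' M B)
      (h : ∀ i, Γ' i ≠ none → ∃ L, Γ' i = some (.lin L) ∧ Γ i = some (.poly (.lin L)))
      (hu : ∀ i j, Γ' i ≠ none → Γ' j ≠ none → i = j) (ho : ∀ i, M.occ i ≤ 1) :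
      Der Γ M (.bang B)
  | allI {Γ : Ctx} {M : Tm} {L : LTy} (h : ∀ X, Der Γ M (.lin (L.inst X))) :
      Der Γ M (.lin (.all L))
  | allE {Γ : Ctx} {M : Tm} {L : LTy} (X : LTy) (h : Der Γ M (.lin (.all L))) :
      Der Γ M (.lin (L.inst X))

namespace Ctx

theorem NoElem.wf {C : Ctx} (h : C.NoElem) : C.WF := fun x _ A hx => absurd hx (h x _ A)

theorem NoElem.discharge {C : Ctx} (h : C.NoElem) (x : ℕ) :
    C.discharge x = fun w => if w = x then none else C w := by
  funext w
  simp only [Ctx.discharge]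
  split_ifs
  · rfl
  · match e : C w with
    | none => rfl
    | some (.lin L) => rfl
    | some (.disch A) => rfl
    | some (.poly A) => rfl
    | some (.elem g A) => exact absurd e (h _ _ _)

theorem NoElem.contract {C : Ctx} (h : C.NoElem) {x y : ℕ} {A : Ty} (hx : C x = some (.poly A)) :
    C.contract x y x A = fun w => if w = x ∨ w ≠ y then C w else none := by
  funext w
  simp only [Ctx.contract]
  by_cases h1 : w = x
  · subst h1; simp [hx]
  by_cases h2 : w = y
  · subst h2; simp [h1]
  · simp only [h1, h2, if_false, or_false, false_or, ne_eq, not_false_eq_true, if_true]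
    match e : C w with
    | none => rfl
    | some (.lin L) => rfl
    | some (.disch A) => rfl
    | some (.poly A) => rfl
    | some (.elem g A) => exact absurd e (h _ _ _)

theorem NoElem.cons {C : Ctx} (h : C.NoElem) {Z : Zone} (hZ : ∀ g A, Z ≠ .elem g A) :
    (C.cons (some Z)).NoElem := by
  rintro (_ | x) g A e
  · exact hZ g A (Option.some.inj e)
  · exact h x g A e

theorem Bounded.cons {C : Ctx} (h : C.Bounded) (Z : Zone) : (C.cons (some Z)).Bounded := by
  obtain ⟨n, hn⟩ := h
  obtain ⟨m, hm⟩ := Z.ty.occurs_bounded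
  refine ⟨max m n, fun a ha => ?_⟩
  rintro ⟨_ | x, Z', hx, ho⟩
  · obtain rfl := Option.some.inj hx
    exact hm a (by omega) ho
  · exact hn a (by omega) ⟨x, Z', hx, ho⟩

end Ctx

/-- Contraction of several polynomial variables into one. -/
theorem Typing.contr_many {B A : Ty} {x : ℕ} : ∀ (xs : List ℕ) {C : Ctx} {M : Tm}, Typing C M B →
    C.NoElem → x ∉ xs → xs.Nodup → C x = some (.poly A) → (∀ y ∈ xs, C y = some (.poly A)) →
    Typing (fun w => if w ∈ xs then none else C w) (M.rename fun w => if w ∈ xs then x else w) B := by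
  intro xs
  induction xs with
  | nil =>
    intro C M h _ _ _ _ _
    simpa [Tm.rename_id'] using h
  | cons y ys ih =>
    intro C M h hC hx hn hx' hy
    simp only [List.mem_cons, not_or, List.nodup_cons, forall_eq_or_imp] at hx hn hy
    have h1 := h.contr x y x A hx.1 hx' hy.1 (.inl rfl)
    rw [hC.contract hx'] at h1
    have h2 := ih h1 ?_ hx.2 hn.2 (by simp [hx']) ?_
    · have e1 : (fun w => if w ∈ y :: ys then none else C w) =
          fun w => if w ∈ ys then none else if w = x ∨ w ≠ y then C w else none := by
        funext w
        by_cases hw : w ∈ ys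
        · simp [hw]
        · by_cases hwy : w = y
          · subst hwy; simp [hw, Ne.symm hx.1]
          · simp [hw, hwy]
      have e2 : (fun w => if w ∈ y :: ys then x else w) = fun w =>
          (fun w => if w ∈ ys then x else w) ((fun w => if w = x ∨ w = y then x else w) w) := by
        funext w
        by_cases hw : w = x ∨ w = y
        · rcases hw with rfl | rfl <;> simp [hx.2]
        · have := not_or.1 hw
          simp [this.1, this.2]
      rw [Tm.rename_rename] at h2
      rw [e1, e2]
      exact h2
    · intro w g A' e
      simp only at e
      split_ifs at e
      exact hC w g A' e
    · intro w hw
      have : w ≠ y := by rintro rfl; exact hn.1 hw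
      simp [this, hy.2 w hw]

/-- The term `M₀`, in the context `C`, is a variant of `M` in `Γ` in which the free variables of
`M`, renamed in `S`, are distinct at distinct occurrences, up to superfluous variables in `W`. -/
structure Linearised (S : Set ℕ) (W Γ : Ctx) (M : Tm) (C : Ctx) (M₀ : Tm) (f : ℕ → ℕ) : Prop where
  out : ∀ y ∉ S, C y = W y
  inn : ∀ y ∈ S, ∀ Z, C y = some Z → Γ (f y) = some Z ∧ M₀.occ y ≠ 0
  fv : ∀ y, M₀.occ y ≠ 0 → y ∈ S ∧ C y ≠ none
  inj : ∀ y y', y ≠ y' → M₀.occ y ≠ 0 → M₀.occ y' ≠ 0 → f y = f y' → 1 < M.occ (f y)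
  ren : M₀.rename f = M

namespace Linearised

variable {S : Set ℕ} {W Γ C : Ctx} {M M₀ : Tm} {f : ℕ → ℕ}

theorem source (h : Linearised S W Γ M C M₀ f) (hW : ∀ y Z, W y = some Z → ∃ i, Γ i = some Z)
    {y : ℕ} {Z : Zone} (hy : C y = some Z) : ∃ i, Γ i = some Z := by
  by_cases hS : y ∈ S
  · exact ⟨f y, (h.inn y hS Z hy).1⟩
  · exact hW y Z (h.out y hS ▸ hy)

theorem noElem (h : Linearised S W Γ M C M₀ f) (hΓ : Γ.NoElem)
    (hW : ∀ y Z, W y = some Z → ∃ i, Γ i = some Z) : C.NoElem := by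
  intro y g A hy
  obtain ⟨i, hi⟩ := h.source hW hy
  exact hΓ i g A hi

theorem occ_ne_zero (h : Linearised S W Γ M C M₀ f) {y : ℕ} (hy : M₀.occ y ≠ 0) :
    M.occ (f y) ≠ 0 := by
  rw [← h.ren]
  exact Tm.occ_rename_ne_zero.2 ⟨y, rfl, hy⟩

theorem zone (h : Linearised S W Γ M C M₀ f) {y : ℕ} (hy : M₀.occ y ≠ 0) :
    ∃ Z, C y = some Z ∧ Γ (f y) = some Z := by
  obtain ⟨hS, hC⟩ := h.fv y hy
  obtain ⟨Z, hZ⟩ := Option.ne_none_iff_exists'.1 hC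
  exact ⟨Z, hZ, (h.inn y hS Z hZ).1⟩

/-- Discharge of a variable. -/
theorem abs {o : Option Zone} {x : ℕ} (hx : x ∈ S) (hWx : W x = none)
    (out : ∀ y ∉ S, C y = W y)
    (inn : ∀ y ∈ S, y ≠ x → ∀ Z, C y = some Z → Γ.cons o (f y) = some Z ∧ M₀.occ y ≠ 0)
    (fv : ∀ y, M₀.occ y ≠ 0 → y ∈ S ∧ C y ≠ none)
    (zero : ∀ y, M₀.occ y ≠ 0 → (f y = 0 ↔ y = x))
    (inj : ∀ y y', y ≠ y' → y ≠ x → M₀.occ y ≠ 0 → M₀.occ y' ≠ 0 → f y = f y' →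
      1 < M.occ (f y))
    (ren : M₀.rename f = M) (hC : C.NoElem) :
    Linearised S W Γ (.lam M) (C.discharge x) (Tm.abs x M₀) (fun y => f y - 1) where
  out y hy := by
    rw [hC.discharge, ← out y hy]
    simp only [ite_eq_right_iff]
    rintro rfl
    exact absurd hx hy
  inn y hy Z hZ := by
    rw [hC.discharge] at hZ
    simp only at hZ
    split_ifs at hZ with hyx
    obtain ⟨h1, h2⟩ := inn y hy hyx Z hZ
    refine ⟨?_, (Tm.occ_abs _ _ _).2 ⟨hyx, h2⟩⟩
    have := mt (zero y h2).1 hyx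
    obtain ⟨n, hn⟩ := Nat.exists_eq_succ_of_ne_zero this
    rw [hn] at h1 ⊢
    exact h1
  fv y hy := by
    rw [Tm.occ_abs] at hy
    rw [hC.discharge]
    simpa [hy.1] using fv y hy.2
  inj y y' hne hy hy' e := by
    rw [Tm.occ_abs] at hy hy'
    have h1 := mt (zero y hy.2).1 hy.1
    have h2 := mt (zero y' hy'.2).1 hy'.1
    have h3 := inj y y' hne hy.1 hy.2 hy'.2 (by omega)
    obtain ⟨n, hn⟩ := Nat.exists_eq_succ_of_ne_zero h1
    simp only [hn, Tm.occ, Nat.succ_eq_add_one, Nat.add_sub_cancel] at h3 ⊢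
    exact h3
  ren := by rw [Tm.rename_abs zero, ren]

end Linearised

/-- The body of an abstraction can be linearised so that a single variable, which is in the
context, stands for the bound one. -/
theorem exists_linearised_abs {Γ : Ctx} {M : Tm} {B : Ty} {Z : Zone}
    (hZ : M.occ 0 ≤ 1 ∨ ∃ A, Z = .poly A)
    (hΓ : (Γ.cons (some Z)).NoElem)
    (ih : ∀ S : Set ℕ, S.Infinite → ∀ W : Ctx, (∀ y ∈ S, W y = none) →
      (∀ y Z', W y = some Z' → ∃ i, Γ.cons (some Z) i = some Z') →
      ∃ C M₀ f, Linearised S W (Γ.cons (some Z)) M C M₀ f ∧ Typing C M₀ B)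
    {S : Set ℕ} (hS : S.Infinite) {W : Ctx} (hW : ∀ y ∈ S, W y = none)
    (hW' : ∀ y Z', W y = some Z' → ∃ i, Γ i = some Z') :
    ∃ C M₀ f x, C x = some Z ∧ Typing C M₀ B ∧
      Linearised S W Γ (.lam M) (C.discharge x) (Tm.abs x M₀) f := by
  by_cases h0 : M.occ 0 = 0
  · obtain ⟨s, hs⟩ := hS.nonempty
    obtain ⟨C, M₀, f, hL, hT⟩ := ih (S \ {s}) (hS.sdiff (Set.finite_singleton s))
      (fun y => if y = s then some Z else W y)
      (fun y hy => by
        have : y ≠ s := hy.2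
        simp [this, hW y hy.1])
      (fun y Z' e => by
        split_ifs at e with hy
        · exact ⟨0, e⟩
        · obtain ⟨i, hi⟩ := hW' y Z' e
          exact ⟨i + 1, hi⟩)
    have hCs : C s = some Z := by rw [hL.out s (by simp)]; simp
    have hne : C.NoElem := hL.noElem hΓ (fun y Z' e => by
        split_ifs at e with hy
        · exact ⟨0, e⟩
        · obtain ⟨i, hi⟩ := hW' y Z' e
          exact ⟨i + 1, hi⟩)
    refine ⟨C, M₀, _, s, hCs, hT, Linearised.abs (o := some Z) (f := f) hs (hW s hs) ?_ ?_ ?_ ?_ ?_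
      hL.ren hne⟩
    · intro y hy
      have h1 : y ≠ s := by rintro rfl; exact hy hs
      rw [hL.out y fun h => hy h.1]
      simp [h1]
    · intro y hy hys
      exact hL.inn y ⟨hy, hys⟩
    · intro y hy
      exact ⟨(hL.fv y hy).1.1, (hL.fv y hy).2⟩
    · intro y hy
      constructor
      · intro e
        exact absurd h0 (e ▸ hL.occ_ne_zero hy)
      · rintro rfl
        exact absurd rfl (hL.fv y hy).1.2
    · intro y y' hne _ hy hy' e
      exact hL.inj y y' hne hy hy' e
  · obtain ⟨C, M₀, f, hL, hT⟩ := ih S hS W hW (fun y Z' e => by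
      obtain ⟨i, hi⟩ := hW' y Z' e
      exact ⟨i + 1, hi⟩)
    have hne : C.NoElem := hL.noElem hΓ (fun y Z' e => by
      obtain ⟨i, hi⟩ := hW' y Z' e
      exact ⟨i + 1, hi⟩)
    rw [← hL.ren, ← Ne, Tm.occ_rename_ne_zero] at h0
    obtain ⟨x, hx0, hx⟩ := h0
    have hCx : ∀ y, M₀.occ y ≠ 0 → f y = 0 → C y = some Z := by
      intro y hy hy0
      obtain ⟨Z', h1, h2⟩ := hL.zone hy
      rw [hy0] at h2
      rw [h1, ← h2]
      rfl
    rcases hZ with hZ | ⟨A, rfl⟩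
    · refine ⟨C, M₀, _, x, hCx x hx hx0, hT, Linearised.abs (o := some Z) (f := f) (hL.fv x hx).1
        (hW x (hL.fv x hx).1) hL.out (fun y hy _ => hL.inn y hy) hL.fv ?_
        (fun y y' hne _ => hL.inj y y' hne) hL.ren hne⟩
      intro y hy
      constructor
      · intro hy0
        by_contra hyx
        have := hL.inj y x hyx hy hx (hy0.trans hx0.symm)
        rw [hy0] at this
        omega
      · rintro rfl
        exact hx0
    · have hfin : {y | M₀.occ y ≠ 0 ∧ f y = 0 ∧ y ≠ x}.Finite :=
        M₀.finite_occ.subset fun y hy => hy.1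
      set xs := hfin.toFinset.toList with hxs
      have hmem : ∀ y, y ∈ xs ↔ M₀.occ y ≠ 0 ∧ f y = 0 ∧ y ≠ x := by intro y; simp [hxs]
      have hxx : x ∉ xs := by simp [hmem]
      have hT' := hT.contr_many xs hne hxx (Finset.nodup_toList _) (hCx x hx hx0)
        (fun y hy => hCx y ((hmem y).1 hy).1 ((hmem y).1 hy).2.1)
      have hocc : ∀ y, (M₀.rename fun w => if w ∈ xs then x else w).occ y ≠ 0 ↔
          M₀.occ y ≠ 0 ∧ y ∉ xs := by
        intro y
        rw [Tm.occ_rename_ne_zero]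
        constructor
        · rintro ⟨w, hw, hw'⟩
          split_ifs at hw with h
          · subst hw; exact ⟨hx, hxx⟩
          · subst hw; exact ⟨hw', h⟩
        · rintro ⟨h1, h2⟩
          exact ⟨y, by simp [h2], h1⟩
      refine ⟨_, _, _, x, ?_, hT', Linearised.abs (o := some (.poly A)) (f := f) (hL.fv x hx).1
        (hW x (hL.fv x hx).1) ?_ ?_ ?_ ?_ ?_ ?_ ?_⟩
      · simp [hxx, hCx x hx hx0]
      · intro y hy
        have : y ∉ xs := fun h => hy (hL.fv y ((hmem y).1 h).1).1
        simp [this, hL.out y hy]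
      · intro y hy _ Z hZ
        split_ifs at hZ with h
        rw [hocc]
        exact ⟨(hL.inn y hy Z hZ).1, (hL.inn y hy Z hZ).2, h⟩
      · intro y hy
        rw [hocc] at hy
        simpa [hy.2] using hL.fv y hy.1
      · intro y hy
        rw [hocc, hmem] at hy
        constructor
        · intro h
          by_contra h'
          exact hy.2 ⟨hy.1, h, h'⟩
        · rintro rfl
          exact hx0
      · intro y y' hne _ hy hy' e
        exact hL.inj y y' hne ((hocc y).1 hy).1 ((hocc y').1 hy').1 e
      · rw [Tm.rename_rename, ← hL.ren]
        apply Tm.rename_congr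
        intro y hy
        split_ifs with h
        · rw [hx0, ((hmem y).1 h).2.1]
        · rfl
      · intro w g A' e
        simp only at e
        split_ifs at e
        exact hne w g A' e

theorem Der.linearise {Γ : Ctx} {M : Tm} {A : Ty} (h : Der Γ M A) : Γ.NoElem → Γ.Bounded →
    ∀ S : Set ℕ, S.Infinite → ∀ W : Ctx, (∀ y ∈ S, W y = none) →
      (∀ y Z, W y = some Z → ∃ i, Γ i = some Z) →
      (∀ y B, W y = some (.poly B) → A.NotBang) →
      ∃ C M₀ f, Linearised S W Γ M C M₀ f ∧ Typing C M₀ A := by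
  induction h with
  | @var Γ i L h =>
    intro hΓ _ S hS W hW hW' _
    obtain ⟨s, hs⟩ := hS.nonempty
    have hL : Linearised S W Γ (.var i) (fun y => if y = s then some (.lin L) else W y) (.var s)
        (fun _ => i) := by
      constructor
      · intro y hy
        have : y ≠ s := by rintro rfl; exact hy hs
        simp [this]
      · intro y hy Z hZ
        by_cases hys : y = s
        · subst hys
          simp only [if_true] at hZ
          exact ⟨h.trans hZ, by simp [Tm.occ]⟩
        · simp [hys, hW y hy] at hZ
      · intro y hy
        obtain rfl : s = y := by simpa [Tm.occ] using hy
        exact ⟨hs, by simp⟩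
      · intro y y' hne hy hy'
        simp only [Tm.occ, ne_eq, ite_eq_right_iff, one_ne_zero, imp_false, not_not] at hy hy'
        exact absurd (hy.symm.trans hy') hne
      · rfl
    exact ⟨_, _, _, hL, .ax (hL.noElem hΓ hW').wf (by simp)⟩
  | @lamLin Γ M L B _ hB ho ih =>
    intro hΓ hb S hS W hW hW' _
    have hΓ' : (Γ.cons (some (.lin L))).NoElem := hΓ.cons (by rintro _ _ ⟨⟩)
    obtain ⟨C, M₀, f, x, hx, hT, hL⟩ := exists_linearised_abs (.inl ho) hΓ'
      (fun S hS W h1 h2 => ih hΓ' (hb.cons _) S hS W h1 h2 fun _ _ _ => hB) hS hW hW'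
    exact ⟨_, _, _, hL, hT.limpI x hx⟩
  | @lamDisch Γ M A B _ hB ho ih =>
    intro hΓ hb S hS W hW hW' _
    have hΓ' : (Γ.cons (some (.disch A))).NoElem := hΓ.cons (by rintro _ _ ⟨⟩)
    obtain ⟨C, M₀, f, x, hx, hT, hL⟩ := exists_linearised_abs (.inl ho) hΓ'
      (fun S hS W h1 h2 => ih hΓ' (hb.cons _) S hS W h1 h2 fun _ _ _ => hB) hS hW hW'
    exact ⟨_, _, _, hL, hT.limpIPara x hx⟩
  | @lamPoly Γ M A B _ hB ih =>
    intro hΓ hb S hS W hW hW' _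
    have hΓ' : (Γ.cons (some (.poly A))).NoElem := hΓ.cons (by rintro _ _ ⟨⟩)
    obtain ⟨C, M₀, f, x, hx, hT, hL⟩ := exists_linearised_abs (.inr ⟨A, rfl⟩) hΓ'
      (fun S hS W h1 h2 => ih hΓ' (hb.cons _) S hS W h1 h2 fun _ _ _ => hB) hS hW hW'
    exact ⟨_, _, _, hL, hT.limpIBang x hx⟩
  | @app Γ M N A B _ _ ihM ihN =>
    intro hΓ hb S hS W hW hW' _
    obtain ⟨C₁, M₀, f, hL, hM⟩ := ihM hΓ hb S hS W hW hW' (fun _ _ _ => trivial)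
    obtain ⟨C₂, N₀, g, hR, hN⟩ := ihN hΓ hb (S \ {y | M₀.occ y ≠ 0})
      (hS.sdiff M₀.finite_occ) (fun _ => none) (fun _ _ => rfl) (by simp) (by simp)
    have hdis : ∀ y, C₁ y = none ∨ C₂ y = none := by
      intro y
      by_cases hy : C₂ y = none
      · exact .inr hy
      · left
        by_contra h1
        have hyS : y ∈ S \ {y | M₀.occ y ≠ 0} := by
          by_contra h
          exact hy (hR.out y h)
        obtain ⟨Z, hZ⟩ := Option.ne_none_iff_exists'.1 h1
        exact hyS.2 (hL.inn y hyS.1 Z hZ).2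
    let C : Ctx := fun y => (C₁ y).or (C₂ y)
    have hC : Ctx.Merge C₁ C₂ C := by
      intro y
      simp only [C]
      rcases hdis y with h | h
      · rw [h, Option.none_or]
        exact .right _
      · rw [h, Option.or_none]
        exact .left _
    have hg : ∀ y, N₀.occ y ≠ 0 → M₀.occ y = 0 := by
      intro y hy
      by_contra h
      exact (hR.fv y hy).1.2 h
    have hLin : Linearised S W Γ (.app M N) C (.app M₀ N₀)
        (fun y => if M₀.occ y ≠ 0 then f y else g y) := by
      constructor
      · intro y hy
        have : C₂ y = none := hR.out y fun h => hy h.1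
        simp only [C, this, Option.or_none]
        exact hL.out y hy
      · intro y hy Z hZ
        by_cases hy1 : M₀.occ y ≠ 0
        · obtain ⟨Z', h1, h2⟩ := hL.zone hy1
          simp only [C, h1, Option.some_or] at hZ
          rw [← hZ]
          simp only [Tm.occ, if_pos hy1]
          exact ⟨h2, by omega⟩
        · have h1 : C₁ y = none := by
            by_contra h
            obtain ⟨Z', hZ'⟩ := Option.ne_none_iff_exists'.1 h
            exact hy1 (hL.inn y hy Z' hZ').2
          simp only [C, h1, Option.none_or] at hZ
          obtain ⟨h2, h3⟩ := hR.inn y ⟨hy, hy1⟩ Z hZ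
          simp only [Tm.occ, if_neg hy1]
          exact ⟨h2, by omega⟩
      · intro y hy
        by_cases hy1 : M₀.occ y ≠ 0
        · obtain ⟨h1, h2⟩ := hL.fv y hy1
          refine ⟨h1, ?_⟩
          obtain ⟨Z, hZ⟩ := Option.ne_none_iff_exists'.1 h2
          simp [C, hZ]
        · have : N₀.occ y ≠ 0 := by simp only [Tm.occ] at hy; omega
          obtain ⟨h1, h2⟩ := hR.fv y this
          exact ⟨h1.1, by simp [C, h2]⟩
      · intro y y' hne hy hy' e
        simp only [Tm.occ] at hy hy' ⊢
        by_cases hy1 : M₀.occ y ≠ 0 <;> by_cases hy1' : M₀.occ y' ≠ 0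
        · simp only [if_pos hy1, if_pos hy1'] at e ⊢
          have := hL.inj y y' hne hy1 hy1' e
          omega
        · simp only [if_pos hy1, if_neg hy1'] at e ⊢
          have h1 := hL.occ_ne_zero hy1
          have h2 := hR.occ_ne_zero (y := y') (by omega)
          rw [← e] at h2
          omega
        · simp only [if_neg hy1, if_pos hy1'] at e ⊢
          have h1 := hL.occ_ne_zero hy1'
          have h2 := hR.occ_ne_zero (y := y) (by omega)
          rw [← e] at h1
          omega
        · simp only [if_neg hy1, if_neg hy1'] at e ⊢
          have := hR.inj y y' hne (by omega) (by omega) e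
          omega
      · simp only [Tm.rename]
        congr 1
        · conv_rhs => rw [← hL.ren]
          apply Tm.rename_congr
          intro y hy
          rw [if_pos hy]
        · conv_rhs => rw [← hR.ren]
          apply Tm.rename_congr
          intro y hy
          simp [hg y hy]
    refine ⟨C, _, _, hLin, ?_⟩
    cases A with
    | bang A => exact hM.limpEBang hN (hL.noElem hΓ hW') hC
    | lin L => exact hM.limpE hN (by rintro _ ⟨⟩) hC
    | para A => exact hM.limpE hN (by rintro _ ⟨⟩) hC
  | @para Γ Γ' M B hM hb ih =>
    intro hΓ hbd S hS W hW hW' _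
    have hne : Γ'.NoElem := by
      intro i g A e
      have := hb i
      rw [e] at this
      cases this
    have hbd' : Γ'.Bounded := by
      obtain ⟨n, hn⟩ := hbd
      refine ⟨n, fun a ha => ?_⟩
      rintro ⟨i, Z, hi, ho⟩
      refine hn a ha ?_
      have := hb i
      rw [hi] at this
      generalize e : Γ i = o at this
      cases this
      · exact ⟨i, _, e, ho⟩
      · exact ⟨i, _, e, ho⟩
      · exact ⟨i, _, e, ho⟩
    obtain ⟨C, M₀, f, hL, hT⟩ := ih hne hbd' S hS (fun _ => none) (fun _ _ => rfl) (by simp)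
      (by simp)
    classical
    have hin : ∀ y, C y ≠ none → y ∈ S := by
      intro y hy
      by_contra h
      exact hy (hL.out y h)
    refine ⟨fun y => if C y = none then W y else Γ (f y), M₀, f, ?_, hT.paraBox ?_⟩
    · constructor
      · intro y hy
        have : C y = none := hL.out y hy
        simp [this]
      · intro y hy Z hZ
        by_cases h : C y = none
        · simp [h, hW y hy] at hZ
        · obtain ⟨Z', hZ'⟩ := Option.ne_none_iff_exists'.1 h
          rw [if_neg h] at hZ
          exact ⟨hZ, (hL.inn y hy Z' hZ').2⟩
      · intro y hy
        obtain ⟨h1, h2⟩ := hL.fv y hy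
        obtain ⟨Z, h3, h4⟩ := hL.zone hy
        refine ⟨h1, ?_⟩
        rw [if_neg h2]
        have := hb (f y)
        rw [h4] at this
        intro h
        rw [h] at this
        cases this
      · exact hL.inj
      · exact hL.ren
    · intro y
      by_cases h : C y = none
      · simp only [h, if_true]
        match e : W y with
        | none => exact .absent
        | some (.lin L) => exact .newLin L
        | some (.disch A) => exact .newDisch A
        | some (.poly A) => exact .newPoly A
        | some (.elem g A) =>
          obtain ⟨i, hi⟩ := hW' _ _ e
          exact absurd hi (hΓ _ _ _)
      · rw [if_neg h]
        obtain ⟨Z, hZ⟩ := Option.ne_none_iff_exists'.1 h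
        have h1 := (hL.inn y (hin y h) Z hZ).1
        have := hb (f y)
        rw [h1] at this
        rw [hZ]
        generalize Γ (f y) = o at this
        cases this with
        | toDisch L => exact .toDisch L
        | toPoly L => exact .toPoly L
        | disch A => exact .disch A
  | @bang Γ Γ' M B hM hb hu ho ih =>
    intro hΓ hbd S hS W hW hW' hWp
    have hne : Γ'.NoElem := by
      intro i g A e
      obtain ⟨L, hL, -⟩ := hb i (by simp [e])
      rw [e] at hL
      cases hL
    have hbd' : Γ'.Bounded := by
      obtain ⟨n, hn⟩ := hbd
      refine ⟨n, fun a ha => ?_⟩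
      rintro ⟨i, Z, hi, ho⟩
      refine hn a ha ?_
      obtain ⟨L, h1, h2⟩ := hb i (by simp [hi])
      rw [hi] at h1
      cases h1
      exact ⟨i, _, h2, ho⟩
    obtain ⟨C, M₀, f, hL, hT⟩ := ih hne hbd' S hS (fun _ => none) (fun _ _ => rfl) (by simp)
      (by simp)
    classical
    have hin : ∀ y, C y ≠ none → y ∈ S := by
      intro y hy
      by_contra h
      exact hy (hL.out y h)
    have hCΓ : ∀ y, C y ≠ none → M₀.occ y ≠ 0 ∧
        ∃ L, C y = some (.lin L) ∧ Γ' (f y) = some (.lin L) ∧ Γ (f y) = some (.poly (.lin L)) := by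
      intro y hy
      obtain ⟨Z, hZ⟩ := Option.ne_none_iff_exists'.1 hy
      obtain ⟨h1, h2⟩ := hL.inn y (hin y hy) Z hZ
      obtain ⟨L, h3, h4⟩ := hb (f y) (by simp [h1])
      rw [h1] at h3
      obtain rfl := Option.some.inj h3
      exact ⟨h2, L, hZ, h1, h4⟩
    have huniq : ∀ y y', C y ≠ none → C y' ≠ none → y = y' := by
      intro y y' hy hy'
      by_contra hyy
      obtain ⟨h1, L, -, h2, -⟩ := hCΓ y hy
      obtain ⟨h1', L', -, h2', -⟩ := hCΓ y' hy'
      have := hL.inj y y' hyy h1 h1' (hu _ _ (by simp [h2]) (by simp [h2']))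
      have := ho (f y)
      omega
    obtain ⟨p, hp⟩ : ∃ p : Option ℕ, ∀ y, p = some y ↔ C y ≠ none := by
      by_cases h : ∃ y, C y ≠ none
      · obtain ⟨y, hy⟩ := h
        refine ⟨some y, fun y' => ?_⟩
        constructor
        · rintro ⟨⟩; exact hy
        · intro hy'; rw [huniq y y' hy hy']
      · refine ⟨none, fun y => ?_⟩
        push Not at h
        simp [h y]
    have hWe : ∀ y g A, W y ≠ some (.elem g A) := by
      intro y g A e
      obtain ⟨i, hi⟩ := hW' _ _ e
      exact hΓ _ _ _ hi
    refine ⟨fun y => if C y = none then W y else Γ (f y), M₀, f, ?_, hT.bangBox p ?_ ?_ ?_⟩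
    · constructor
      · intro y hy
        have : C y = none := hL.out y hy
        simp [this]
      · intro y hy Z hZ
        by_cases h : C y = none
        · simp [h, hW y hy] at hZ
        · rw [if_neg h] at hZ
          exact ⟨hZ, (hCΓ y h).1⟩
      · intro y hy
        obtain ⟨h1, h2⟩ := hL.fv y hy
        obtain ⟨-, L, -, -, h3⟩ := hCΓ y h2
        exact ⟨h1, by simp [h2, h3]⟩
      · exact hL.inj
      · exact hL.ren
    · intro y
      by_cases h : C y = none
      · simp only [h, if_true]
        match e : W y with
        | none => exact .absent
        | some (.lin L) => exact .newLin L
        | some (.disch A) => exact .newDisch A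
        | some (.poly A) => exact (hWp _ _ e).elim
        | some (.elem g A) => exact absurd e (hWe _ _ _)
      · rw [if_neg h]
        obtain ⟨-, L, h1, -, h3⟩ := hCΓ y h
        rw [h1, h3]
        exact .toPoly L ((hp y).2 h)
    · intro y hy
      have h := (hp y).1 hy
      obtain ⟨-, L, -, -, h3⟩ := hCΓ y h
      exact ⟨.lin L, by simp [h, h3]⟩
    · intro x y A hx
      by_cases h : C x = none
      · simp only [h, if_true] at hx
        exact absurd hx (hWe _ _ _)
      · simp only [if_neg h] at hx
        exact absurd hx (hΓ _ _ _)
  | @allI Γ M L h ih =>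
    intro hΓ hbd S hS W hW hW' hWp
    obtain ⟨n, hn⟩ := hbd
    obtain ⟨m, hm⟩ := L.occurs_bounded
    obtain ⟨C, M₀, f, hL, hT⟩ := ih (.tvar (max m n)) hΓ ⟨n, hn⟩ S hS W hW hW'
      fun _ _ _ => trivial
    refine ⟨C, M₀, f, hL, ?_⟩
    rw [← LTy.forallVar_inst (L := L) (a := max m n) (hm _ (by omega))]
    refine hT.allI _ ?_
    rintro ⟨y, Z, hy, ho⟩
    obtain ⟨i, hi⟩ := hL.source hW' hy
    exact hn (max m n) (by omega) ⟨i, Z, hi, ho⟩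
  | @allE Γ M L X h ih =>
    intro hΓ hbd S hS W hW hW' hWp
    obtain ⟨C, M₀, f, hL, hT⟩ := ih hΓ hbd S hS W hW hW' fun _ _ _ => trivial
    exact ⟨C, M₀, f, hL, hT.allE X⟩

theorem Der.hasType {M : Tm} {A : Ty} (h : Der Ctx.empty M A) : HasType M A := by
  obtain ⟨C, M₀, f, hL, hT⟩ := h.linearise (by rintro _ _ _ ⟨⟩)
    ⟨0, by rintro _ _ ⟨_, _, ⟨⟩, _⟩⟩ Set.univ Set.infinite_univ (fun _ => none) (fun _ _ => rfl)
    (by simp) (by simp)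
  have hC : C = Ctx.empty := by
    funext y
    by_contra h
    obtain ⟨Z, hZ⟩ := Option.ne_none_iff_exists'.1 h
    cases (hL.inn y trivial Z hZ).1
  have hM : M₀ = M := by
    rw [← hL.ren, Tm.rename_id']
    intro y hy
    obtain ⟨Z, -, hZ⟩ := hL.zone hy
    cases hZ
  rw [hC, hM] at hT
  exact hT

/-! ## Weakening of derivations, and closed terms -/

theorem Der.zone_of_occ {Γ : Ctx} {M : Tm} {A : Ty} (h : Der Γ M A) :
    ∀ i, M.occ i ≠ 0 → Γ i ≠ none := by
  induction h with
  | @var Γ i L h =>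
    intro j hj
    obtain rfl : i = j := by simpa [Tm.occ] using hj
    simp [h]
  | lamLin _ _ _ ih => exact fun i hi => ih (i + 1) hi
  | lamDisch _ _ _ ih => exact fun i hi => ih (i + 1) hi
  | lamPoly _ _ ih => exact fun i hi => ih (i + 1) hi
  | @app Γ M N A B _ _ ihM ihN =>
    intro i hi
    simp only [Tm.occ] at hi
    by_cases h : M.occ i = 0
    · exact ihN i (by omega)
    · exact ihM i h
  | @para Γ Γ' M B _ hb ih =>
    intro i hi h
    have := hb i
    rw [h] at this
    generalize e : Γ' i = o at this
    cases this
    exact ih i hi e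
  | bang _ hb _ _ ih =>
    intro i hi h
    obtain ⟨L, -, h'⟩ := hb i (ih i hi)
    rw [h] at h'
    cases h'
  | allI _ ih => exact ih (.tvar 0)
  | allE _ _ ih => exact ih

theorem Der.closed {M : Tm} {A : Ty} (h : Der Ctx.empty M A) : M.Closed := by
  intro i
  by_contra hi
  exact h.zone_of_occ i hi rfl

theorem Ctx.exists_push {f : ℕ → ℕ} (hf : Function.Injective f) (Γ : Ctx) :
    ∃ Δ : Ctx, (∀ i, Δ (f i) = Γ i) ∧ ∀ y, (¬ ∃ i, f i = y) → Δ y = none :=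
  ⟨Function.extend (γ := Option Zone) f Γ fun _ => none, fun _ => hf.extend_apply _ _ _,
    fun _ hy => Function.extend_apply' _ _ _ hy⟩

theorem Der.rename {Γ : Ctx} {M : Tm} {A : Ty} (h : Der Γ M A) :
    ∀ {f : ℕ → ℕ} {Δ : Ctx}, Function.Injective f → (∀ i Z, Γ i = some Z → Δ (f i) = some Z) →
      Der Δ (M.rename f) A := by
  have hcons : ∀ {f : ℕ → ℕ} {Γ Δ : Ctx} (Z : Zone), (∀ i Z, Γ i = some Z → Δ (f i) = some Z) →
      ∀ i Z', Γ.cons (some Z) i = some Z' → Δ.cons (some Z) (liftRen f i) = some Z' := by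
    rintro f Γ Δ Z h (_ | i) Z' e
    · exact e
    · exact h i Z' e
  have hocc : ∀ {f : ℕ → ℕ} (M : Tm), Function.Injective f → M.occ 0 ≤ 1 →
      (M.rename (liftRen f)).occ 0 ≤ 1 := by
    intro f M hf h
    exact (Tm.occ_rename (Tm.liftRen_injective hf) 0).trans_le h
  induction h with
  | var h => exact fun hf hΔ => .var (hΔ _ _ h)
  | lamLin _ hB ho ih =>
    exact fun hf hΔ => .lamLin (ih (Tm.liftRen_injective hf) (hcons _ hΔ)) hB (hocc _ hf ho)
  | lamDisch _ hB ho ih =>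
    exact fun hf hΔ => .lamDisch (ih (Tm.liftRen_injective hf) (hcons _ hΔ)) hB (hocc _ hf ho)
  | lamPoly _ hB ih =>
    exact fun hf hΔ => .lamPoly (ih (Tm.liftRen_injective hf) (hcons _ hΔ)) hB
  | app _ _ ihM ihN => exact fun hf hΔ => .app (ihM hf hΔ) (ihN hf hΔ)
  | @para Γ Γ' M B _ hb ih =>
    intro f Δ hf hΔ
    obtain ⟨Γ₁, hΓ, hex⟩ := Ctx.exists_push hf Γ'
    refine .para (Γ' := Γ₁) (ih hf fun i Z e => ?_) fun y => ?_
    · rw [hΓ, e]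
    · by_cases hy : ∃ i, f i = y
      · obtain ⟨i, rfl⟩ := hy
        rw [hΓ]
        have := hb i
        generalize Γ' i = o at this
        match e : Γ i with
        | none =>
          rw [e] at this
          cases this
          exact .absent _
        | some Z =>
          rw [hΔ i Z e, ← e]
          exact this
      · rw [hex y hy]
        exact .absent _
  | @bang Γ Γ' M B _ hb hu ho ih =>
    intro f Δ hf hΔ
    obtain ⟨Γ₁, hΓ, hex⟩ := Ctx.exists_push hf Γ'
    refine .bang (Γ' := Γ₁) (ih hf fun i Z e => ?_) ?_ ?_ ?_
    · rw [hΓ, e]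
    · intro y hy
      obtain ⟨i, rfl⟩ := not_imp_comm.1 (hex y) hy
      rw [hΓ] at hy ⊢
      obtain ⟨L, h1, h2⟩ := hb i hy
      exact ⟨L, h1, hΔ i _ h2⟩
    · intro y y' hy hy'
      obtain ⟨i, rfl⟩ := not_imp_comm.1 (hex y) hy
      obtain ⟨j, rfl⟩ := not_imp_comm.1 (hex y') hy'
      rw [hΓ] at hy hy'
      rw [hu i j hy hy']
    · intro y
      by_cases h : (M.rename f).occ y = 0
      · omega
      · obtain ⟨x, rfl, -⟩ := Tm.occ_rename_ne_zero.1 h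
        rw [Tm.occ_rename hf]
        exact ho x
  | allI _ ih => exact fun hf hΔ => .allI fun X => ih X hf hΔ
  | allE X _ ih => exact fun hf hΔ => .allE X (ih hf hΔ)

theorem Der.shift {Γ : Ctx} {M : Tm} {A : Ty} (h : Der Γ M A) (o : Option Zone) :
    Der (Γ.cons o) M.shift A :=
  h.rename Nat.succ_injective fun _ _ e => e

theorem Der.weaken {M : Tm} {A : Ty} (h : Der Ctx.empty M A) (Γ : Ctx) : Der Γ M A := by
  have := h.rename (f := id) (Δ := Γ) Function.injective_id (by rintro _ _ ⟨⟩)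
  rwa [Tm.rename_id' M (f := id) fun _ _ => rfl] at this

namespace BoxAt

theorem nil {Γ : Ctx} : ∀ i, BoxAt (Ctx.empty i) (Γ i) := fun _ => .absent _

theorem cons {o o' : Option Zone} {Γ Γ' : Ctx} (h : BoxAt o o') (h' : ∀ i, BoxAt (Γ i) (Γ' i)) :
    ∀ i, BoxAt (Γ.cons o i) (Γ'.cons o' i)
  | 0 => h
  | i + 1 => h' i

end BoxAt

/-- A closed box of type `!A`. -/
theorem Der.bangClosed {M : Tm} {A : Ty} (h : Der Ctx.empty M A) (Γ : Ctx) : Der Γ M (.bang A) :=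
  .bang h (fun _ hi => absurd rfl hi) (fun _ _ hi => absurd rfl hi)
    (fun i => by rw [h.closed i]; exact Nat.zero_le _)

/-! ## Substitution -/

namespace Tm

theorem subst_rename (M : Tm) : ∀ (f : ℕ → ℕ) (σ : ℕ → Tm),
    (M.rename f).subst σ = M.subst fun i => σ (f i) := by
  induction M with
  | var x => intro f σ; rfl
  | lam M ih =>
    intro f σ
    simp only [rename, subst, ih]
    congr 2
    funext i
    cases i <;> rfl
  | app M N ihM ihN => intro f σ; simp only [rename, subst, ihM, ihN]

theorem rename_subst (M : Tm) : ∀ (σ : ℕ → Tm) (f : ℕ → ℕ),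
    (M.subst σ).rename f = M.subst fun i => (σ i).rename f := by
  induction M with
  | var x => intro σ f; rfl
  | lam M ih =>
    intro σ f
    simp only [rename, subst, ih]
    congr 2
    funext i
    cases i
    · rfl
    · simp only [liftSub, shift, rename_rename, liftRen]
  | app M N ihM ihN => intro σ f; simp only [rename, subst, ihM, ihN]

theorem subst_shift (M : Tm) (σ : ℕ → Tm) : M.shift.subst (liftSub σ) = (M.subst σ).shift := by
  simp only [shift, subst_rename, rename_subst, liftSub]

theorem rename_shift (M : Tm) (f : ℕ → ℕ) : M.shift.rename (liftRen f) = (M.rename f).shift := by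
  simp only [shift, rename_rename, liftRen]

theorem subst_var (M : Tm) : ∀ {σ : ℕ → Tm}, (∀ i, M.occ i ≠ 0 → σ i = var i) → M.subst σ = M := by
  induction M with
  | var x => intro σ h; exact h x (by simp [occ])
  | lam M ih =>
    intro σ h
    simp only [subst]
    rw [ih]
    intro i hi
    cases i with
    | zero => rfl
    | succ i => simp only [liftSub]; rw [h i hi]; rfl
  | app M N ihM ihN =>
    intro σ h
    simp only [subst]
    rw [ihM fun i hi => h i (by simp only [occ]; omega),
      ihN fun i hi => h i (by simp only [occ]; omega)]

theorem inst_shift (M N : Tm) : M.shift.inst N = M := by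
  rw [inst, shift, subst_rename, subst_var]
  intros
  rfl

theorem Closed.subst {M : Tm} (h : M.Closed) (σ : ℕ → Tm) : M.subst σ = M :=
  subst_var M fun i hi => absurd (h i) hi

theorem Closed.rename {M : Tm} (h : M.Closed) (f : ℕ → ℕ) : M.rename f = M :=
  rename_id' M fun i hi => absurd (h i) hi

theorem Closed.shift {M : Tm} (h : M.Closed) : M.shift = M := h.rename _

theorem occ_shift_zero (M : Tm) : M.shift.occ 0 = 0 := by
  by_contra h
  obtain ⟨x, hx, -⟩ := occ_rename_ne_zero.1 h
  cases hx

theorem occ_shift_succ (M : Tm) (i : ℕ) : M.shift.occ (i + 1) = M.occ i :=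
  occ_rename Nat.succ_injective i

theorem IsValue.rename {M : Tm} (h : M.IsValue) (f : ℕ → ℕ) : (M.rename f).IsValue := by
  cases M with
  | var x => trivial
  | lam M => trivial
  | app M N => exact h

end Tm

/-! ## Reductions -/

/-- The reflexive transitive closure of the rewriting relation. -/
def Red : Tm → Tm → Prop := Relation.ReflTransGen Step

namespace Red

theorem refl (M : Tm) : Red M M := Relation.ReflTransGen.refl

theorem trans {M N P : Tm} (h : Red M N) (h' : Red N P) : Red M P := Relation.ReflTransGen.trans h h'

theorem step {M N : Tm} (h : Step M N) : Red M N := Relation.ReflTransGen.single h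

theorem lam {M M' : Tm} (h : Red M M') : Red (.lam M) (.lam M') :=
  Relation.ReflTransGen.lift Tm.lam (fun _ _ => Step.lam) _ _ h

theorem appL {M M' : Tm} (h : Red M M') (N : Tm) : Red (.app M N) (.app M' N) :=
  Relation.ReflTransGen.lift (fun M => Tm.app M N) (fun _ _ => Step.appL N) _ _ h

theorem appR {N N' : Tm} (h : Red N N') (M : Tm) : Red (.app M N) (.app M N') :=
  Relation.ReflTransGen.lift (fun N => Tm.app M N) (fun _ _ => Step.appR M) _ _ h

theorem app {M M' N N' : Tm} (h : Red M M') (h' : Red N N') : Red (.app M N) (.app M' N') :=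
  (h.appL N).trans (h'.appR M')

end Red

theorem Step.betaLin {M N R : Tm} (ho : M.occ 0 ≤ 1) (hN : N.IsValue) (hR : M.inst N = R) :
    Step (.app (.lam M) N) R := by
  subst hR
  refine .beta M N ?_
  rcases Nat.lt_or_ge 0 (M.occ 0) with h | h
  · exact .inr (.inl ⟨by omega, hN⟩)
  · exact .inl (by omega)

theorem Step.betaPoly {M N R : Tm} (hN : N.IsValue) (hf : ∃ y, ∀ x, N.occ x ≠ 0 → x = y)
    (hR : M.inst N = R) : Step (.app (.lam M) N) R := by
  subst hR
  refine .beta M N ?_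
  rcases Nat.lt_or_ge 1 (M.occ 0) with h | h
  · exact .inr (.inr ⟨h, hN, hf⟩)
  rcases Nat.lt_or_ge 0 (M.occ 0) with h | h
  · exact .inr (.inl ⟨by omega, hN⟩)
  · exact .inl (by omega)

theorem Step.betaClosed {M N R : Tm} (hN : N.IsValue) (hc : N.Closed) (hR : M.inst N = R) :
    Step (.app (.lam M) N) R :=
  .betaPoly hN ⟨0, fun x hx => absurd (hc x) hx⟩ hR

theorem Step.betaThunk {M N : Tm} : Step (.app (thunk M) N) M := by
  have := Step.beta M.shift N (.inl M.occ_shift_zero)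
  rwa [Tm.inst_shift] at this

theorem Red.reduces {M N P : Tm} (h : Step M N) (h' : Red N P) : Reduces M P :=
  Relation.TransGen.head' h h'

/-! ## Tuples and projections -/

namespace Ty

theorem NotBang.arrows {As : List Ty} {B : Ty} (h : B.NotBang) : (Ty.arrows As B).NotBang := by
  cases As with
  | nil => exact h
  | cons A As => trivial

theorem subst_arrows (As : List Ty) (B : Ty) (σ : ℕ → LTy) :
    (arrows As B).subst σ = arrows (As.map (Ty.subst σ)) (B.subst σ) := by
  induction As with
  | nil => rfl
  | cons A As ih => simp only [arrows, List.foldr_cons, List.map_cons, arrow, Ty.subst, LTy.subst]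
                    rw [← arrows, ih]; rfl

theorem rename_arrows (As : List Ty) (B : Ty) (f : ℕ → ℕ) :
    (arrows As B).rename f = arrows (As.map (Ty.rename f)) (B.rename f) := by
  induction As with
  | nil => rfl
  | cons A As ih => simp only [arrows, List.foldr_cons, List.map_cons, arrow, Ty.rename, LTy.rename]
                    rw [← arrows, ih]; rfl

end Ty

theorem tensorTy_subst (As : List Ty) (σ : ℕ → LTy) :
    (tensorTy As).subst σ = tensorTy (As.map (Ty.subst σ)) := by
  simp only [tensorTy, LTy.subst, Ty.subst_arrows, List.map_map]
  congr 4
  funext A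
  simp only [Function.comp, Ty.subst_rename, Ty.rename_subst]
  rfl

theorem tensorTy_rename (As : List Ty) (f : ℕ → ℕ) :
    (tensorTy As).rename f = tensorTy (As.map (Ty.rename f)) := by
  simp only [tensorTy, LTy.rename, Ty.rename_arrows, List.map_map]
  congr 4
  funext A
  simp only [Function.comp, Ty.rename_rename]
  rfl

theorem boolTy_subst (m : ℕ) (σ : ℕ → LTy) : (boolTy m).subst σ = boolTy m := by
  simp only [boolTy, LTy.subst, Ty.subst, tensorTy_subst, List.map_replicate, Ty.tvar]
  rfl

theorem boolTy_rename (m : ℕ) (f : ℕ → ℕ) : (boolTy m).rename f = boolTy m := by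
  simp only [boolTy, LTy.rename, Ty.rename, tensorTy_rename, List.map_replicate, Ty.tvar]
  rfl

theorem Ty.rename_succ_inst (A : Ty) (X : LTy) :
    ((A.rename Nat.succ).subst fun a => match a with
      | 0 => X
      | b + 1 => .tvar b) = A := by
  simp only [Ty.subst_rename, Ty.subst_tvar]

theorem Der.tensorE {Γ : Ctx} {M : Tm} {As : List Ty} (h : Der Γ M (.lin (tensorTy As)))
    (X : LTy) : Der Γ M (.lin (.limp (.arrows As (.lin X)) (.lin X))) := by
  have := h.allE X
  simp only [LTy.inst, LTy.subst, Ty.subst_arrows, List.map_map, Ty.subst, Ty.tvar] at this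
  convert this using 4
  rw [eq_comm, List.map_congr_left (g := id), List.map_id]
  intro A _
  exact A.rename_succ_inst X

theorem Der.boolE {Γ : Ctx} {M : Tm} {m : ℕ} (h : Der Γ M (.lin (boolTy m))) (X : LTy) :
    Der Γ M (.lin (.limp (.lin (tensorTy (List.replicate m (.lin X)))) (.lin X))) := by
  have := h.allE X
  simpa only [LTy.inst, LTy.subst, Ty.subst, tensorTy_subst, Ty.tvar, List.map_replicate] using this

theorem Der.foldl_app {Γ : Ctx} {As : List Ty} {B : Ty} {Ms : List Tm}
    (h : List.Forall₂ (Der Γ) Ms As) : ∀ {H : Tm}, Der Γ H (.arrows As B) →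
      Der Γ (Ms.foldl .app H) B := by
  induction h with
  | nil => exact fun h => h
  | cons h _ ih => exact fun hH => ih (.app hH h)

namespace Tm

theorem occ_foldl_app (Ms : List Tm) (i : ℕ) : ∀ H : Tm,
    (Ms.foldl app H).occ i = H.occ i + (Ms.map (occ i)).sum := by
  induction Ms with
  | nil => intro H; rfl
  | cons M Ms ih =>
    intro H
    simp only [List.foldl_cons, ih, occ, List.map_cons, List.sum_cons]
    omega

theorem subst_foldl_app (Ms : List Tm) (σ : ℕ → Tm) : ∀ H : Tm,
    (Ms.foldl app H).subst σ = (Ms.map (subst σ)).foldl app (H.subst σ) := by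
  induction Ms with
  | nil => intro H; rfl
  | cons M Ms ih => intro H; simp only [List.foldl_cons, ih, subst, List.map_cons]

theorem occ_tuple (Ms : List Tm) (i : ℕ) : (tuple Ms).occ i = (Ms.map (occ i)).sum := by
  simp [tuple, occ, occ_foldl_app, Function.comp_def, occ_shift_succ]

theorem subst_tuple (Ms : List Tm) (σ : ℕ → Tm) :
    (tuple Ms).subst σ = tuple (Ms.map (subst σ)) := by
  simp only [tuple, subst, subst_foldl_app, List.map_map, Function.comp_def, subst_shift, liftSub]

theorem occ_iterate_lam (n : ℕ) : ∀ (M : Tm) (i : ℕ), (lam^[n] M).occ i = M.occ (i + n) := by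
  induction n with
  | zero => intros; rfl
  | succ n ih => intro M i; rw [Function.iterate_succ_apply', occ, ih]; congr 1; omega

theorem subst_iterate_lam (n : ℕ) : ∀ (M : Tm) (σ : ℕ → Tm),
    (lam^[n] M).subst σ = lam^[n] (M.subst (liftSub^[n] σ)) := by
  induction n with
  | zero => intros; rfl
  | succ n ih =>
    intro M σ
    rw [Function.iterate_succ_apply', subst, ih, Function.iterate_succ_apply',
      ← Function.iterate_succ_apply liftSub]

theorem iterate_liftSub_lt (σ : ℕ → Tm) {n : ℕ} : ∀ {i : ℕ}, i < n → liftSub^[n] σ i = var i := by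
  induction n with
  | zero => intro i h; omega
  | succ n ih =>
    intro i h
    rw [Function.iterate_succ_apply']
    cases i with
    | zero => rfl
    | succ i => rw [liftSub, ih (by omega)]; rfl

theorem iterate_liftSub_self (σ : ℕ → Tm) (n : ℕ) : liftSub^[n] σ n = shift^[n] (σ 0) := by
  induction n with
  | zero => rfl
  | succ n ih => rw [Function.iterate_succ_apply', liftSub, ih, Function.iterate_succ_apply']

theorem iterate_lam_shift (E : Tm) (n : ℕ) :
    lam^[n] (shift^[n] E.shift) = (lam^[n] (shift^[n] E)).shift := by
  induction n generalizing E with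
  | zero => rfl
  | succ n ih =>
    simp only [Function.iterate_succ_apply shift, Function.iterate_succ_apply' lam, ih]
    exact congrArg lam (rename_shift _ Nat.succ).symm

@[simp] theorem inst_app (M N P : Tm) : (app M N).inst P = app (M.inst P) (N.inst P) := rfl

@[simp] theorem inst_var_zero (P : Tm) : (var 0).inst P = P := rfl

end Tm

theorem Step.tuple {Ms : List Tm} {N : Tm} (h : N.IsValue) :
    Step (.app (tuple Ms) N) (Ms.foldl .app N) := by
  refine .betaLin ?_ h ?_
  · simp [Tm.occ_foldl_app, Tm.occ, Function.comp_def, Tm.occ_shift_zero]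
  · simp only [Tm.inst, Tm.subst_foldl_app, Tm.subst, List.map_map, Function.comp_def]
    congr 1
    conv_rhs => rw [← List.map_id Ms]
    exact List.map_congr_left fun M _ => M.inst_shift N

theorem Der.tuple {Γ : Ctx} {As : List Ty} {Ms : List Tm} (h : List.Forall₂ (Der Γ) Ms As) :
    Der Γ (tuple Ms) (.lin (tensorTy As)) := by
  refine .allI fun X => ?_
  have e : LTy.inst (.limp (.arrows (As.map (Ty.rename Nat.succ)) (.tvar 0)) (.tvar 0)) X =
      .limp (.arrows As (.lin X)) (.lin X) := by
    simp only [LTy.inst, LTy.subst, Ty.subst_arrows, List.map_map, Ty.subst, Ty.tvar]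
    congr 2
    rw [List.map_congr_left (g := id), List.map_id]
    intro A _
    exact A.rename_succ_inst X
  rw [e]
  obtain ⟨L, hL⟩ : ∃ L, Ty.arrows As (.lin X) = .lin L := by
    cases As with
    | nil => exact ⟨_, rfl⟩
    | cons A As => exact ⟨_, rfl⟩
  rw [hL]
  refine .lamLin (Der.foldl_app (As := As) ?_ (hL ▸ .var rfl)) trivial ?_
  · clear e hL
    induction h with
    | nil => exact .nil
    | cons h _ ih => exact .cons (h.shift _) ih
  · simp [Tm.occ_foldl_app, Tm.occ, Function.comp_def, Tm.occ_shift_zero]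

theorem Der.thunk {Γ : Ctx} {M : Tm} {A : Ty} (h : Der Γ M A) (hA : A.NotBang) (L : LTy) :
    Der Γ (thunk M) (.lin (.limp (.lin L) A)) :=
  .lamLin (h.shift _) hA (by rw [Tm.occ_shift_zero]; exact Nat.zero_le _)

theorem Der.select {X : LTy} (m : ℕ) : ∀ {Γ : Ctx} {j : ℕ},
    (j < m ∨ (m ≤ j ∧ Γ (j - m) = some (.lin X))) →
    Der Γ (Tm.lam^[m] (.var j)) (.arrows (List.replicate m (.lin X)) (.lin X)) := by
  induction m with
  | zero =>
    intro Γ j h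
    rcases h with h | h
    · omega
    · exact .var h.2
  | succ m ih =>
    intro Γ j h
    rw [Function.iterate_succ_apply']
    refine .lamLin (ih ?_) (Ty.NotBang.arrows trivial) ?_
    · rcases Nat.lt_trichotomy j m with h' | rfl | h'
      · exact .inl h'
      · exact .inr ⟨le_rfl, by simp [Ctx.cons]⟩
      · rcases h with h | h
        · omega
        · obtain ⟨k, rfl⟩ : ∃ k, j = m + 1 + k := ⟨j - (m + 1), by omega⟩
          refine .inr ⟨by omega, ?_⟩
          rw [show m + 1 + k - m = k + 1 by omega]
          rw [show m + 1 + k - (m + 1) = k by omega] at h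
          exact h.2
    · rw [Tm.occ_iterate_lam, Tm.occ]
      split_ifs <;> omega

theorem Der.proj {m i : ℕ} (h : i < m) (Γ : Ctx) : Der Γ (proj m i) (.lin (boolTy m)) := by
  refine .allI fun X => ?_
  have e : LTy.inst (.limp (.lin (tensorTy (List.replicate m (.tvar 0)))) (.tvar 0)) X =
      .limp (.lin (tensorTy (List.replicate m (.lin X)))) (.lin X) := by
    simp only [LTy.inst, LTy.subst, Ty.subst, tensorTy_subst, Ty.tvar, List.map_replicate]
  rw [e]
  refine .lamLin (.app (Der.tensorE (.var rfl) X) (Der.select m (.inl (by omega)))) trivial ?_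
  simp only [Tm.occ, Tm.occ_iterate_lam, if_true]
  rw [if_neg (by omega)]

/-- The function that maps `πᵐᵢ` to `F i`. -/
def matchTm (m : ℕ) (F : ℕ → Tm) : Tm :=
  .lam (.app (.var 0) (tuple ((List.range m).map F)).shift)

theorem Tm.subst_matchTm (m : ℕ) (F : ℕ → Tm) (σ : ℕ → Tm) :
    (matchTm m F).subst σ = matchTm m fun i => (F i).subst σ := by
  simp only [matchTm, subst, subst_shift, subst_tuple, List.map_map]
  rfl

theorem Tm.occ_matchTm {m : ℕ} {F : ℕ → Tm} {i : ℕ} (h : ∀ j < m, (F j).occ i = 0) :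
    (matchTm m F).occ i = 0 := by
  simp only [matchTm, occ, occ_shift_succ, occ_tuple, List.map_map]
  rw [if_neg (by omega), Nat.zero_add, List.sum_eq_zero]
  intro n hn
  simp only [List.mem_map, List.mem_range] at hn
  obtain ⟨j, hj, rfl⟩ := hn
  exact h j hj

theorem Der.matchTm {Γ : Ctx} {m : ℕ} {F : ℕ → Tm} {X : LTy}
    (h : ∀ i < m, Der Γ (F i) (.lin X)) :
    Der Γ (matchTm m F) (.lin (.limp (.lin (boolTy m)) (.lin X))) := by
  refine .lamLin (.app (Der.boolE (.var rfl) X) ((Der.tuple ?_).shift _)) trivial ?_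
  · rw [List.forall₂_iff_get]
    refine ⟨by simp, fun i h₁ h₂ => ?_⟩
    simp only [List.get_eq_getElem, List.getElem_map, List.getElem_range, List.getElem_replicate]
    exact h i (by simpa using h₁)
  · simp [Tm.occ, Tm.occ_shift_zero]

theorem Red.foldl_app {M N : Tm} (h : Red M N) (Es : List Tm) :
    Red (Es.foldl .app M) (Es.foldl .app N) := by
  induction Es generalizing M N with
  | nil => exact h
  | cons E Es ih => exact ih (h.appL E)

theorem Red.discard (E : Tm) (Es : List Tm) :
    Red (Es.foldl .app (Tm.lam^[Es.length] (Tm.shift^[Es.length] E))) E := by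
  induction Es with
  | nil => exact .refl _
  | cons E' Es ih =>
    refine Red.trans ?_ ih
    simp only [List.foldl_cons, List.length_cons]
    rw [Function.iterate_succ_apply Tm.shift, Function.iterate_succ_apply' Tm.lam,
      Tm.iterate_lam_shift]
    exact Red.foldl_app (.step .betaThunk) Es

theorem Red.select (Es : List Tm) (hE : ∀ E ∈ Es, E.IsValue) : ∀ (i : ℕ) (hi : i < Es.length),
    Red (Es.foldl .app (Tm.lam^[Es.length] (.var (Es.length - 1 - i)))) Es[i] := by
  induction Es with
  | nil => intro i hi; simp at hi
  | cons E Es ih =>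
    intro i hi
    have hval : E.IsValue := hE E (by simp)
    have hocc : (Tm.lam^[Es.length] (.var (Es.length - i))).occ 0 ≤ 1 := by
      rw [Tm.occ_iterate_lam, Tm.occ]
      split_ifs <;> omega
    simp only [List.foldl_cons, List.length_cons, Nat.add_sub_cancel]
    rw [Function.iterate_succ_apply']
    cases i with
    | zero =>
      refine Red.trans (Red.foldl_app (.step (.betaLin hocc hval rfl)) Es) ?_
      rw [Tm.inst, Tm.subst_iterate_lam, Nat.sub_zero, Tm.subst, Tm.iterate_liftSub_self]
      exact Red.discard E Es
    | succ i =>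
      refine Red.trans (Red.foldl_app (.step (.betaLin hocc hval rfl)) Es) ?_
      simp only [List.length_cons] at hi
      rw [Tm.inst, Tm.subst_iterate_lam, Tm.subst, Tm.iterate_liftSub_lt _ (by omega)]
      have := ih (fun E h => hE E (by simp [h])) i (by omega)
      rwa [show Es.length - 1 - i = Es.length - (i + 1) by omega] at this

theorem Red.matchTm {m i : ℕ} {F : ℕ → Tm} (hi : i < m) (hF : ∀ j < m, (F j).IsValue) :
    Red (.app (matchTm m F) (proj m i)) (F i) := by
  refine (Red.step (.betaLin (N := WALT.proj m i) ?_ trivial rfl)).trans ?_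
  · simp [Tm.occ, Tm.occ_shift_zero]
  rw [Tm.inst_app, Tm.inst_shift, Tm.inst_var_zero]
  have hsel : (Tm.lam^[m] (.var (m - 1 - i))).Closed := by
    intro j
    rw [Tm.occ_iterate_lam, Tm.occ, if_neg (by omega)]
  refine (Red.step (Step.betaLin (N := tuple _) ?_ trivial rfl)).trans ?_
  · simp [Tm.occ, hsel 0]
  rw [Tm.inst_app, Tm.inst_var_zero, Tm.inst, hsel.subst]
  refine (Red.step (.tuple ?_)).trans ?_
  · obtain ⟨n, rfl⟩ : ∃ n, m = n + 1 := ⟨m - 1, by omega⟩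
    rw [Function.iterate_succ_apply']
    trivial
  · have := Red.select ((List.range m).map F) (by simpa using hF) i (by simpa using hi)
    simpa using this

infixl:75 "⬝" => Tm.app
prefix:70 "ƛ" => Tm.lam
prefix:max "ν" => Tm.var

/-! ## Church numerals -/

/-- The context with the single assignment `i : L`. -/
def Ctx.single (i : ℕ) (L : LTy) : Ctx := fun j => if j = i then some (.lin L) else none

@[simp] theorem Ctx.single_self (i : ℕ) (L : LTy) : Ctx.single i L i = some (.lin L) := if_pos rfl

theorem Der.bangOne {Γ : Ctx} {M : Tm} {B : Ty} {i : ℕ} {L : LTy}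
    (hM : Der (Ctx.single i L) M B) (hΓ : Γ i = some (.poly (.lin L))) (ho : M.occ i ≤ 1) :
    Der Γ M (.bang B) := by
  have h : ∀ j, Ctx.single i L j ≠ none → j = i := by
    intro j hj
    by_contra h
    exact hj (if_neg h)
  refine .bang hM ?_ ?_ ?_
  · intro j hj
    obtain rfl := h j hj
    exact ⟨L, Ctx.single_self _ _, hΓ⟩
  · intro j k hj hk
    rw [h j hj, h k hk]
  · intro j
    by_cases hj : M.occ j = 0
    · omega
    · rw [h j (hM.zone_of_occ j hj)]
      exact ho

theorem Der.bangVar {Γ : Ctx} {i : ℕ} {L : LTy} (hΓ : Γ i = some (.poly (.lin L))) :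
    Der Γ (.var i) (.bang (.lin L)) :=
  .bangOne (.var (Ctx.single_self i L)) hΓ (by simp [Tm.occ])

/-- The type of endofunctions. -/
abbrev LTy.endo (X : LTy) : LTy := .limp (.lin X) (.lin X)

theorem Der.natE {Γ : Ctx} {M : Tm} (h : Der Γ M (.lin natTy)) (X : LTy) :
    Der Γ M (.lin (.limp (.bang (.lin X.endo)) (.para (.lin X.endo)))) :=
  h.allE X

theorem Der.natI {Γ : Ctx} {M : Tm}
    (h : ∀ X : LTy, Der Γ M (.lin (.limp (.bang (.lin X.endo)) (.para (.lin X.endo))))) :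
    Der Γ M (.lin natTy) :=
  .allI h

theorem Tm.occ_iterate_app (V : Tm) (n : ℕ) (x : Tm) (i : ℕ) :
    ((app V)^[n] x).occ i = n * V.occ i + x.occ i := by
  induction n with
  | zero => simp
  | succ n ih => rw [Function.iterate_succ_apply', occ, ih]; ring

theorem Tm.subst_iterate_app (V : Tm) (n : ℕ) (x : Tm) (σ : ℕ → Tm) :
    ((app V)^[n] x).subst σ = (app (V.subst σ))^[n] (x.subst σ) := by
  induction n with
  | zero => rfl
  | succ n ih => rw [Function.iterate_succ_apply', subst, ih, Function.iterate_succ_apply']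

theorem Der.iterate {Γ : Ctx} {V x : Tm} {A : Ty} (hV : Der Γ V (.lin (.limp A A)))
    (hx : Der Γ x A) (n : ℕ) : Der Γ ((Tm.app V)^[n] x) A := by
  induction n with
  | zero => exact hx
  | succ n ih => rw [Function.iterate_succ_apply']; exact .app hV ih

theorem church_der (n : ℕ) (Γ : Ctx) : Der Γ (church n) (.lin natTy) := by
  refine .natI fun X => .lamPoly (.para (Γ' := Ctx.single 0 X.endo) ?_ ?_) trivial
  · refine .lamLin (.iterate (.var (i := 1) rfl) (.var rfl) n) trivial ?_
    simp [Tm.occ_iterate_app, Tm.occ]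
  · rintro (_ | i)
    · exact .toPoly _
    · exact .absent _

theorem church_closed (n : ℕ) : (church n).Closed := (church_der n _).closed

@[simp] theorem church_subst (n : ℕ) (σ : ℕ → Tm) : (church n).subst σ = church n :=
  (church_closed n).subst σ

@[simp] theorem church_shift (n : ℕ) : (church n).shift = church n := (church_closed n).shift

@[simp] theorem church_occ (n i : ℕ) : (church n).occ i = 0 := church_closed n i

@[simp] theorem Tm.shift_var (i : ℕ) : (ν i).shift = ν (i + 1) := rfl

/-- Application of a numeral. -/
theorem church_step (n : ℕ) {V : Tm} (hV : V.IsValue) (hf : ∃ y, ∀ x, V.occ x ≠ 0 → x = y) :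
    Step (church n⬝V) (ƛ ((Tm.app V.shift)^[n] (ν 0))) :=
  .betaPoly hV hf (by simp only [Tm.inst, Tm.subst, Tm.subst_iterate_app]; rfl)

theorem Step.iterate (n : ℕ) {V x : Tm} (hx : x.IsValue) :
    Step ((ƛ ((Tm.app V.shift)^[n] (ν 0)))⬝x) ((Tm.app V)^[n] x) := by
  refine .betaLin ?_ hx ?_
  · simp [Tm.occ_iterate_app, Tm.occ_shift_zero, Tm.occ]
  · rw [Tm.inst, Tm.subst_iterate_app, ← Tm.inst, Tm.inst_shift]
    rfl

theorem Red.iterate {V : Tm} {x : ℕ → Tm} (h : ∀ j, Red (V⬝x j) (x (j + 1))) (n : ℕ) :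
    Red ((Tm.app V)^[n] (x 0)) (x n) := by
  induction n with
  | zero => exact .refl _
  | succ n ih => rw [Function.iterate_succ_apply']; exact (ih.appR V).trans (h n)

/-- The composition of `f : α ⊸ α`, the variable `0`, with a function from `α` to `α`. -/
def composeTm : Tm := ƛ ƛ ν 2⬝(ν 1⬝ν 0)

/-- Addition of numerals. -/
def addTm : Tm := ƛ ƛ ƛ (ƛ ƛ ν 1⬝ν 0)⬝(ν 2⬝composeTm)⬝(ν 1⬝ν 0)

/-- Addition of `m`. -/
def addTo (m : ℕ) : Tm := ƛ ƛ (ƛ ƛ ν 1⬝ν 0)⬝(church m⬝composeTm)⬝(ν 1⬝ν 0)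

theorem addTm_der (Γ : Ctx) :
    Der Γ addTm (.lin (.limp (.lin natTy) (.lin (.limp (.lin natTy) (.lin natTy))))) := by
  refine .lamLin (.lamLin (.natI fun X => .lamPoly (.app (.app (A := .para (.lin X.endo.endo))
    ?_ ?_) (.app (.natE (.var rfl) X) (.bangVar rfl))) trivial) trivial ?_) trivial ?_
  · refine .lamDisch (.lamDisch (.para (Γ' := Ctx.cons (some (.lin X.endo))
      (Ctx.cons (some (.lin X.endo.endo)) Ctx.empty))
      (.app (.var rfl) (.var rfl)) ?_) trivial (by simp [Tm.occ])) trivial (by simp [Tm.occ])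
    exact .cons (.toDisch _) (.cons (.toDisch _) .nil)
  · refine .app (.natE (.var rfl) X.endo) (.bangOne (L := X.endo) (i := 0) ?_ rfl ?_)
    · refine .lamLin (.lamLin (.app (.var (i := 2) rfl) (.app (.var rfl) (.var rfl)))
        trivial ?_) trivial ?_ <;> simp [Tm.occ]
    · simp [Tm.occ, composeTm]
  · simp [Tm.occ, composeTm]
  · simp [Tm.occ, composeTm]

theorem addTm_closed : addTm.Closed := (addTm_der _).closed

theorem addTm_church_step (m : ℕ) : Step (addTm⬝church m) (addTo m) :=
  .betaClosed trivial (church_closed m)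
    (by simp [Tm.inst, Tm.subst, Tm.liftSub, addTo, composeTm])

theorem addTo_der (m : ℕ) (Γ : Ctx) :
    Der Γ (addTo m) (.lin (.limp (.lin natTy) (.lin natTy))) := by
  refine .lamLin (.natI fun X => .lamPoly (.app (.app (A := .para (.lin X.endo.endo))
    ?_ ?_) (.app (.natE (.var rfl) X) (.bangVar rfl))) trivial) trivial ?_
  · refine .lamDisch (.lamDisch (.para (Γ' := Ctx.cons (some (.lin X.endo))
      (Ctx.cons (some (.lin X.endo.endo)) Ctx.empty))
      (.app (.var rfl) (.var rfl)) ?_) trivial (by simp [Tm.occ])) trivial (by simp [Tm.occ])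
    exact .cons (.toDisch _) (.cons (.toDisch _) .nil)
  · refine .app (.natE (church_der m _) X.endo) (.bangOne (L := X.endo) (i := 0) ?_ rfl ?_)
    · refine .lamLin (.lamLin (.app (.var (i := 2) rfl) (.app (.var rfl) (.var rfl)))
        trivial ?_) trivial ?_ <;> simp [Tm.occ]
    · simp [Tm.occ, composeTm]
  · simp [Tm.occ, composeTm, church_closed m _]

theorem addTo_closed (m : ℕ) : (addTo m).Closed := (addTo_der m _).closed

theorem apply_red {U V : Tm} (hU : U.IsValue) (hV : V.IsValue) :
    Red ((ƛ ƛ ν 1⬝ν 0)⬝U⬝V) (U⬝V) := by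
  refine (Red.appL (.step (.betaLin (by simp [Tm.occ]) hU rfl)) _).trans ?_
  refine .step (.betaLin ?_ hV ?_)
  · simp only [Tm.subst, Tm.occ, Tm.liftSub]
    rw [Tm.occ_shift_zero]
    simp
  · simp only [Tm.subst, Tm.inst_app, Tm.liftSub, Tm.inst_shift]
    rfl

theorem addTo_red (m n : ℕ) : Red (addTo m⬝church n) (church (m + n)) := by
  refine (Red.step (.betaClosed (N := church n) trivial (church_closed n)
    (R := ƛ (ƛ ƛ ν 1⬝ν 0)⬝(church m⬝composeTm)⬝(church n⬝ν 0))
    (by simp [Tm.inst, Tm.subst, Tm.liftSub, composeTm]))).trans (Red.lam ?_)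
  have hf : ∃ y, ∀ x, composeTm.occ x ≠ 0 → x = y := ⟨0, fun x hx => by
    simp only [composeTm, Tm.occ] at hx
    by_contra h
    apply hx
    rw [if_neg (by omega), if_neg (by omega), if_neg (by omega)]⟩
  refine (Red.app (Red.app (.refl _) (.step (church_step m (by trivial) hf)))
    (.step (church_step n (by trivial) ⟨0, fun x hx => by simpa [Tm.occ, eq_comm] using hx⟩))).trans ?_
  refine (apply_red (U := ƛ _) (V := ƛ _) trivial trivial).trans ?_
  refine (Red.step (.iterate m (by trivial))).trans ?_
  have := Red.iterate (V := composeTm) (x := fun j => ƛ ((Tm.app (ν 1))^[j + n] (ν 0))) ?_ m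
  · simpa using this
  · intro j
    refine (Red.step (.betaLin (by simp [Tm.occ]) (by trivial)
      (R := ƛ ν 1⬝((ƛ ((Tm.app (ν 2))^[j + n] (ν 0)))⬝ν 0)) ?_)).trans ?_
    · simp only [Tm.inst, Tm.subst, Tm.liftSub, Tm.shift, Tm.rename]
      congr 3
      congr 1
      induction j + n with
      | zero => rfl
      | succ k ih =>
        rw [Function.iterate_succ_apply', Function.iterate_succ_apply', Tm.rename, ih]
        rfl
    · refine Red.lam ?_
      rw [show j + 1 + n = (j + n) + 1 by omega, Function.iterate_succ_apply']
      exact Red.appR (.step (Step.iterate (V := ν 1) (j + n) (by trivial))) _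

/-! ## The polynomial clock -/

/-- Closed terms for functions from numerals to numerals, with `a` boxes around the result. -/
structure Clock (a : ℕ) (φ : ℕ → ℕ) (F : Tm) : Prop where
  der : Der Ctx.empty F (.lin (.limp (.lin natTy) (.paras a (.lin natTy))))
  red : ∀ n, Red (F⬝church n) (church (φ n))

theorem Ty.paras_succ (n : ℕ) (A : Ty) : Ty.paras (n + 1) A = .para (Ty.paras n A) :=
  Function.iterate_succ_apply' _ _ _

theorem Ty.paras_add (m n : ℕ) (A : Ty) : Ty.paras (m + n) A = Ty.paras m (Ty.paras n A) :=
  Function.iterate_add_apply _ _ _ _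

theorem Ty.NotBang.paras {A : Ty} (h : A.NotBang) (n : ℕ) : (Ty.paras n A).NotBang := by
  cases n with
  | zero => exact h
  | succ n => rw [Ty.paras_succ]; trivial

theorem Der.paras {M : Tm} {A : Ty} (h : Der Ctx.empty M A) (n : ℕ) : Der Ctx.empty M (.paras n A) := by
  induction n with
  | zero => exact h
  | succ n ih => rw [Ty.paras_succ]; exact .para ih .nil

/-- Boxes around a term with a linear variable. -/
theorem Der.parasOne {M : Tm} {B : Ty} {L : LTy} (h : Der (Ctx.cons (some (.lin L)) Ctx.empty) M B)
    (n : ℕ) : ∀ {Γ : Ctx},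
    Der (Γ.cons (some (.disch (.paras n (.lin L))))) M (.paras (n + 1) B) := by
  induction n with
  | zero => exact .para h (.cons (.toDisch _) .nil)
  | succ n ih =>
    intro Γ
    rw [Ty.paras_succ, Ty.paras_succ (n + 1)]
    exact .para (ih (Γ := Ctx.empty)) (.cons (.disch _) .nil)

/-- The composition of two functions, the second one in a box. -/
def seqTm (F G : Tm) : Tm := ƛ (ƛ G⬝ν 0)⬝(F⬝ν 0)

theorem Clock.seq {a b : ℕ} {φ ψ : ℕ → ℕ} {F G : Tm} (hF : Clock (a + 1) φ F) (hG : Clock b ψ G) :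
    Clock (a + 1 + b) (fun n => ψ (φ n)) (seqTm F G) := by
  have hFc := hF.der.closed
  have hGc := hG.der.closed
  constructor
  · refine .lamLin (.app (A := .para (.paras a (.lin natTy))) ?_ ?_) ?_ ?_
    · refine .lamDisch ?_ (Ty.NotBang.paras (by trivial) _) (by simp [Tm.occ, hGc 0])
      rw [Ty.paras_add]
      exact .parasOne (.app (hG.der.weaken _) (.var rfl)) a
    · rw [← Ty.paras_succ]
      exact .app (hF.der.weaken _) (.var rfl)
    · exact (Ty.NotBang.paras (by trivial) _)
    · simp [Tm.occ, hGc 1, hFc 0]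
  · intro n
    refine (Red.step (.betaClosed (by trivial) (church_closed n) (R := (ƛ G⬝ν 0)⬝(F⬝church n)) ?_)).trans ?_
    · simp [Tm.inst, Tm.subst, Tm.liftSub, hGc.subst, hFc.subst]
    refine (Red.appR (hF.red n) _).trans ?_
    refine (Red.step (.betaClosed (by trivial) (church_closed _) (R := G⬝church (φ n)) ?_)).trans
      (hG.red _)
    simp [Tm.inst, Tm.subst, hGc.subst]

/-- Multiplication by `k`. -/
def mulTm (k : ℕ) : Tm := ƛ (ƛ ν 0⬝church 0)⬝(ν 0⬝addTo k)

/-- Iteration of a closed function inside a box. -/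
theorem church_box_red {V B : Tm} {x : ℕ → Tm} (hV : V.IsValue) (hc : V.Closed)
    (hx : (x 0).IsValue) (h : ∀ j, Red (V⬝x j) (x (j + 1))) (n : ℕ)
    (ho : B.occ 0 = 1) (Es : List Tm) (hB : ∀ N, B.inst N = Es.foldl .app (N⬝x 0)) :
    Red ((ƛ B)⬝(church n⬝V)) (Es.foldl .app (x n)) := by
  refine (Red.appR (.step (church_step n hV ⟨0, fun y hy => absurd (hc y) hy⟩)) _).trans ?_
  refine (Red.step (.betaLin ho.le (by trivial) (hB _))).trans (Red.foldl_app ?_ _)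
  exact (Red.step (.iterate n hx)).trans (Red.iterate h n)

@[simp] theorem addTo_subst (n : ℕ) (σ : ℕ → Tm) : (addTo n).subst σ = addTo n :=
  (addTo_closed n).subst σ

@[simp] theorem addTo_occ (n i : ℕ) : (addTo n).occ i = 0 := addTo_closed n i

theorem Clock.mul (k : ℕ) : Clock 1 (fun n => k * n) (mulTm k) := by
  constructor
  · refine .lamLin (.app (A := .para (.lin natTy.endo)) ?_
      (.app (.natE (.var rfl) natTy) (.bangClosed (addTo_der k _) _))) trivial
      (by simp [Tm.occ])
    exact .lamDisch (.para (Γ' := Ctx.cons (some (.lin natTy.endo)) Ctx.empty)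
      (.app (.var rfl) (church_der 0 _)) (.cons (.toDisch _) .nil)) trivial (by simp [Tm.occ])
  · intro n
    refine (Red.step (.betaClosed (by trivial) (church_closed n)
      (R := (ƛ ν 0⬝church 0)⬝(church n⬝addTo k)) ?_)).trans ?_
    · simp [Tm.inst, Tm.subst, Tm.liftSub]
    refine church_box_red (x := fun j => church (k * j)) (by trivial) (addTo_closed k) trivial ?_ n
      (by simp [Tm.occ]) [] (by simp [Tm.inst, Tm.subst])
    intro j
    have := addTo_red k (k * j)
    rwa [show k + k * j = k * (j + 1) by ring] at this

/-- Two copies of a numeral. -/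
def twice (j : ℕ) : Tm := ƛ ν 0⬝church j⬝church j

/-- The successor of both copies. -/
def twiceSucc : Tm := ƛ ƛ ν 1⬝(ƛ ƛ ν 2⬝(addTo 1⬝ν 1)⬝(addTo 1⬝ν 0))

/-- The product of two numerals. -/
def prodTm : Tm := ƛ ƛ (ƛ ν 0⬝church 0)⬝(ν 0⬝(addTm⬝ν 1))

/-- Squaring. -/
def squareTm : Tm := ƛ (ƛ ν 0⬝twice 0⬝prodTm)⬝(ν 0⬝twiceSucc)

/-- The type of `prodTm`. -/
def prodTy : LTy := .limp (.bang (.lin natTy)) (.lin (.limp (.lin natTy) (.para (.lin natTy))))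

/-- The type of `twice`. -/
def twiceTy : LTy := .limp (.lin prodTy) (.para (.lin natTy))

theorem prodTm_der (Γ : Ctx) : Der Γ prodTm (.lin prodTy) := by
  refine .lamPoly (.lamLin (.app (A := .para (.lin natTy.endo)) ?_
      (.app (.natE (.var rfl) natTy) (.bangOne (i := 1) (L := natTy)
        (.app (addTm_der _) (.var rfl)) rfl ?_))) trivial ?_) trivial
  · exact .lamDisch (.para (Γ' := Ctx.cons (some (.lin natTy.endo)) Ctx.empty)
      (.app (.var rfl) (church_der 0 _)) (.cons (.toDisch _) .nil)) trivial (by simp [Tm.occ])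
  · simp [Tm.occ, addTm_closed _]
  · simp [Tm.occ, addTm_closed _]

theorem twice_der (j : ℕ) (Γ : Ctx) : Der Γ (twice j) (.lin twiceTy) :=
  .lamLin (.app (.app (.var rfl) (.bangClosed (church_der j _) _)) (church_der j _)) trivial
    (by simp [Tm.occ])

theorem twiceSucc_der (Γ : Ctx) : Der Γ twiceSucc (.lin twiceTy.endo) := by
  refine .lamLin (.lamLin (.app (.var (i := 1) rfl) (.lamPoly (.lamLin (.app (.app
    (.var (i := 2) rfl) (.bangOne (i := 1) (L := natTy) (.app (addTo_der _ _) (.var rfl)) rfl ?_))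
    (.app (addTo_der _ _) (.var rfl))) trivial ?_) trivial)) trivial ?_) trivial ?_
  all_goals simp [Tm.occ]

theorem twiceSucc_closed : twiceSucc.Closed := (twiceSucc_der _).closed

theorem prodTm_closed : prodTm.Closed := (prodTm_der _).closed

theorem twice_closed (j : ℕ) : (twice j).Closed := (twice_der j _).closed

theorem twiceSucc_red (j : ℕ) : Red (twiceSucc⬝twice j) (twice (j + 1)) := by
  refine (Red.step (.betaClosed (by trivial) (twice_closed j)
    (R := ƛ twice j⬝(ƛ ƛ ν 2⬝(addTo 1⬝ν 1)⬝(addTo 1⬝ν 0))) ?_)).trans (Red.lam ?_)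
  · simp [Tm.inst, Tm.subst, Tm.liftSub, (twice_closed j).shift]
  refine (Red.step (.betaLin (by simp [Tm.occ]) (by trivial)
    (R := (ƛ ƛ ν 2⬝(addTo 1⬝ν 1)⬝(addTo 1⬝ν 0))⬝church j⬝church j) ?_)).trans ?_
  · simp [Tm.inst, Tm.subst]
  refine (Red.appL (.step (.betaClosed (by trivial) (church_closed j)
    (R := ƛ ν 1⬝(addTo 1⬝church j)⬝(addTo 1⬝ν 0)) ?_)) _).trans ?_
  · simp [Tm.inst, Tm.subst, Tm.liftSub]
  refine (Red.step (.betaClosed (by trivial) (church_closed j)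
    (R := ν 0⬝(addTo 1⬝church j)⬝(addTo 1⬝church j)) ?_)).trans ?_
  · simp [Tm.inst, Tm.subst]
  have := addTo_red 1 j
  rw [Nat.add_comm] at this
  exact Red.app (Red.appR this _) this

theorem prodTm_red (m n : ℕ) : Red (prodTm⬝church m⬝church n) (church (m * n)) := by
  refine (Red.appL (.step (.betaClosed (by trivial) (church_closed m)
    (R := ƛ (ƛ ν 0⬝church 0)⬝(ν 0⬝(addTm⬝church m))) ?_)) _).trans ?_
  · simp [Tm.inst, Tm.subst, Tm.liftSub, addTm_closed.subst]
  refine (Red.step (.betaClosed (by trivial) (church_closed n)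
    (R := (ƛ ν 0⬝church 0)⬝(church n⬝(addTm⬝church m))) ?_)).trans ?_
  · simp [Tm.inst, Tm.subst, Tm.liftSub, addTm_closed.subst]
  refine (Red.appR (Red.appR (.step (addTm_church_step m)) _) _).trans ?_
  refine church_box_red (x := fun j => church (m * j)) (by trivial) (addTo_closed m) trivial ?_ n
      (by simp [Tm.occ]) [] (by simp [Tm.inst, Tm.subst])
  intro j
  have := addTo_red m (m * j)
  rwa [show m + m * j = m * (j + 1) by ring] at this

theorem Clock.square : Clock 2 (fun n => n ^ 2) squareTm := by
  constructor
  · refine .lamLin (.app (A := .para (.lin twiceTy.endo)) ?_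
      (.app (.natE (.var rfl) twiceTy) (.bangClosed (twiceSucc_der _) _))) trivial
      (by simp [Tm.occ, twice_closed _ _, prodTm_closed _, twiceSucc_closed _])
    exact .lamDisch (.para (Γ' := Ctx.cons (some (.lin twiceTy.endo)) Ctx.empty)
      (.app (.app (A := .lin twiceTy) (.var rfl) (twice_der 0 _)) (prodTm_der _))
      (.cons (.toDisch _) .nil)) trivial
      (by simp [Tm.occ, twice_closed _ _, prodTm_closed _])
  · intro n
    refine (Red.step (.betaClosed (by trivial) (church_closed n)
      (R := (ƛ ν 0⬝twice 0⬝prodTm)⬝(church n⬝twiceSucc)) ?_)).trans ?_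
    · simp [Tm.inst, Tm.subst, Tm.liftSub, (twice_closed _).subst, prodTm_closed.subst,
        twiceSucc_closed.subst]
    refine (church_box_red (x := twice) (by trivial) twiceSucc_closed trivial twiceSucc_red n
      (by simp [Tm.occ, twice_closed _ _, prodTm_closed _]) [prodTm]
      (by simp [Tm.inst, Tm.subst, (twice_closed _).subst, prodTm_closed.subst])).trans ?_
    refine (Red.step (.betaClosed (by trivial) prodTm_closed
      (R := prodTm⬝church n⬝church n) ?_)).trans ?_
    · simp [Tm.inst, Tm.subst]
    · have := prodTm_red n n
      rwa [← sq] at this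

theorem Clock.exists_pow (k e : ℕ) : ∃ F, Clock (2 * e + 1) (fun n => (k * n) ^ 2 ^ e) F := by
  induction e with
  | zero => exact ⟨_, by simpa using Clock.mul k⟩
  | succ e ih =>
    obtain ⟨F, hF⟩ := ih
    refine ⟨seqTm F squareTm, ?_⟩
    have := hF.seq Clock.square
    rw [show 2 * (e + 1) + 1 = 2 * e + 1 + 2 by ring]
    simpa only [← pow_mul, ← pow_succ] using this

theorem Clock.exists_pad {a : ℕ} {φ : ℕ → ℕ} {F : Tm} (h : Clock (a + 1) φ F) (j : ℕ) :
    ∃ G, Clock (a + 1 + j) φ G := by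
  induction j with
  | zero => exact ⟨F, h⟩
  | succ j ih =>
    obtain ⟨G, hG⟩ := ih
    rw [Nat.add_right_comm] at hG
    have := hG.seq (Clock.mul 1)
    simp only [Nat.one_mul] at this
    refine ⟨seqTm G (mulTm 1), ?_⟩
    rw [show a + 1 + (j + 1) = a + j + 1 + 1 by omega]
    exact this

theorem Clock.exists_of_le (k : ℕ) {e m : ℕ} (h : 2 * e + 1 ≤ m) :
    ∃ F, Clock m (fun n => (k * n) ^ 2 ^ e) F := by
  obtain ⟨F, hF⟩ := Clock.exists_pow k e
  obtain ⟨G, hG⟩ := hF.exists_pad (m - (2 * e + 1))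
  exact ⟨G, by rwa [show 2 * e + 1 + (m - (2 * e + 1)) = m by omega] at hG⟩

/-- A clock as a function of an elementary argument. -/
theorem Clock.eimp {m : ℕ} {φ : ℕ → ℕ} {F : Tm} (h : Clock m φ F) :
    (ƛ F⬝ν 0).Closed ∧
      HasType (ƛ F⬝ν 0) (.lin (.eimp (.lin natTy) (.paras (m + 1) (.lin natTy)))) ∧
      ∀ n, Reduces ((ƛ F⬝ν 0)⬝church n) (church (φ n)) := by
  have hc := h.der.closed
  refine ⟨fun i => by simp [Tm.occ, hc _], ?_, fun n => ?_⟩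
  · have hax : Typing (Ctx.single 0 natTy) (ν 0) (.lin natTy) := by
      refine .ax ?_ (Ctx.single_self _ _)
      intro x y A hx
      unfold Ctx.single at hx
      split_ifs at hx
      cases Option.some.inj hx
    have happ : Typing (Ctx.single 0 natTy) (F⬝ν 0) (.paras m (.lin natTy)) :=
      h.der.hasType.limpE hax (by rintro _ ⟨⟩) fun x => .right _
    have hbox : Typing (fun x => if x = 0 then some (.elem none (.lin natTy)) else none) (F⬝ν 0)
        (.paras (m + 1) (.lin natTy)) := by
      rw [Ty.paras_succ]
      refine happ.paraBox fun x => ?_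
      unfold Ctx.single
      split_ifs
      · exact .toElem _
      · exact .absent
    have := hbox.eimpI 0 (A := .lin natTy) (if_pos rfl)
    have e1 : Ctx.discharge (fun x => if x = 0 then some (.elem none (.lin natTy)) else none) 0 =
        Ctx.empty := by
      funext x
      simp only [Ctx.discharge, Ctx.empty]
      split_ifs <;> rfl
    have e2 : Tm.abs 0 (F⬝ν 0) = ƛ F⬝ν 0 := by simp [Tm.abs, Tm.rename, hc.rename]
    rwa [e1, e2] at this
  · exact Red.reduces (.betaClosed (by trivial) (church_closed n)
      (by simp [Tm.inst, Tm.subst, hc.subst])) (h.red n)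

/-! ## Several reductions at once -/

namespace Tm

/-- The substitution of a term for the variable `0`, which removes this variable. -/
def single (N : Tm) : ℕ → Tm
  | 0 => N
  | y + 1 => var y

/-- The substitution of three terms for the variables `2`, `1`, `0`, which removes them. -/
def triple (A B C : Tm) : ℕ → Tm
  | 0 => C
  | 1 => B
  | 2 => A
  | y + 3 => var y

/-- The substitution of two terms for the variables `1`, `0`, which removes them. -/
def double (A B : Tm) : ℕ → Tm
  | 0 => B
  | 1 => A
  | y + 2 => var y

theorem inst_eq (M N : Tm) : M.inst N = M.subst (single N) := by
  rw [inst]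
  congr 1

@[simp] theorem shift_subst_single (M N : Tm) : M.shift.subst (single N) = M := by
  rw [← inst_eq, inst_shift]

@[simp] theorem shift_subst_double (M A B : Tm) : M.shift.shift.subst (double A B) = M := by
  rw [shift, shift, rename_rename, subst_rename, subst_var]
  exact fun _ _ => rfl

@[simp] theorem shift_subst_triple (M A B C : Tm) :
    M.shift.shift.shift.subst (triple A B C) = M := by
  rw [shift, shift, shift, rename_rename, rename_rename, subst_rename, subst_var]
  exact fun _ _ => rfl

@[simp] theorem shift_subst_liftSub (M : Tm) (σ : ℕ → Tm) :
    M.shift.subst (liftSub σ) = (M.subst σ).shift := subst_shift M σ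

attribute [simp] occ_shift_zero occ_shift_succ

theorem subst_subst (M : Tm) : ∀ σ τ : ℕ → Tm,
    (M.subst σ).subst τ = M.subst fun i => (σ i).subst τ := by
  induction M with
  | var x => intros; rfl
  | lam M ih =>
    intro σ τ
    simp only [subst, ih]
    congr 2
    funext i
    cases i
    · rfl
    · simp only [liftSub, subst_shift]
  | app M N ihM ihN => intro σ τ; simp only [subst, ihM, ihN]

theorem occ_subst (M : Tm) : ∀ {σ : ℕ → Tm} {i i' : ℕ},
    (∀ j, (σ j).occ i = if j = i' then 1 else 0) → (M.subst σ).occ i = M.occ i' := by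
  induction M with
  | var x => intro σ i i' h; exact h x
  | lam M ih =>
    intro σ i i' h
    refine ih fun j => ?_
    cases j with
    | zero => simp [liftSub, occ]
    | succ j => simp [liftSub, h]
  | app M N ihM ihN => intro σ i i' h; simp only [subst, occ, ihM h, ihN h]

theorem occ_subst_liftSub (M : Tm) (σ : ℕ → Tm) : (M.subst (liftSub σ)).occ 0 = M.occ 0 := by
  refine M.occ_subst fun j => ?_
  cases j with
  | zero => simp [liftSub, occ]
  | succ j => simp [liftSub]

theorem rename_inst (M N : Tm) (f : ℕ → ℕ) :
    (M.inst N).rename f = (M.rename (liftRen f)).inst (N.rename f) := by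
  rw [inst_eq, inst_eq, rename_subst, subst_rename]
  congr 1
  funext x
  cases x <;> rfl

end Tm

theorem Red.beta2 {M A B : Tm} (hA : A.IsValue) (hB : B.IsValue)
    (h : M.occ 0 ≤ 1) (h' : M.occ 1 ≤ 1) : Red ((ƛ ƛ M)⬝A⬝B) (M.subst (Tm.double A B)) := by
  refine (Red.appL (.step (.betaLin (by simpa [Tm.occ] using h') hA rfl)) _).trans
    (.step (.betaLin ?_ hB ?_))
  · rwa [Tm.occ_subst_liftSub]
  · rw [Tm.inst_eq, Tm.subst_subst]
    congr 1
    funext x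
    rcases x with _ | _ | x
    · rfl
    · exact Tm.shift_subst_single _ _
    · rfl

theorem Red.beta3 {M A B C : Tm} (hA : A.IsValue) (hB : B.IsValue) (hC : C.IsValue)
    (h : M.occ 0 ≤ 1) (h' : M.occ 1 ≤ 1) (h'' : M.occ 2 ≤ 1) :
    Red ((ƛ ƛ ƛ M)⬝A⬝B⬝C) (M.subst (Tm.triple A B C)) := by
  refine (Red.appL (Red.appL (.step (.betaLin (by simpa [Tm.occ] using h'') hA
    (R := ƛ ƛ M.subst (Tm.liftSub (Tm.liftSub (Tm.single A)))) (Tm.inst_eq _ _))) _) _).trans ?_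
  refine (Red.beta2 hB hC ?_ ?_).trans ?_
  · rwa [Tm.occ_subst_liftSub]
  · rw [M.occ_subst (i' := 1)]
    · exact h'
    · intro j
      rcases j with _ | _ | j <;> simp [Tm.liftSub, Tm.occ]
  · rw [Tm.subst_subst]
    have e : (fun i => (Tm.liftSub (Tm.liftSub (Tm.single A)) i).subst (Tm.double B C)) =
        Tm.triple A B C := by
      funext x
      rcases x with _ | _ | _ | x
      · rfl
      · rfl
      · exact Tm.shift_subst_double _ _ _
      · rfl
    rw [e]
    exact .refl _

theorem Step.rename {M N : Tm} (h : Step M N) :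
    ∀ {f : ℕ → ℕ}, Function.Injective f → Step (M.rename f) (N.rename f) := by
  induction h with
  | beta M N h =>
    intro f hf
    rw [Tm.rename_inst]
    refine .beta _ _ ?_
    have e : (M.rename (liftRen f)).occ 0 = M.occ 0 := Tm.occ_rename (Tm.liftRen_injective hf) 0
    rw [e]
    rcases h with h | h | ⟨h, hv, y, hy⟩
    · exact .inl h
    · exact .inr (.inl ⟨h.1, h.2.rename f⟩)
    · refine .inr (.inr ⟨h, hv.rename f, f y, fun x hx => ?_⟩)
      obtain ⟨z, rfl, hz⟩ := Tm.occ_rename_ne_zero.1 hx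
      rw [hy z hz]
  | lam _ ih => exact fun hf => .lam (ih (Tm.liftRen_injective hf))
  | appL N _ ih => exact fun hf => .appL _ (ih hf)
  | appR M _ ih => exact fun hf => .appR _ (ih hf)

theorem Red.shift {M N : Tm} (h : Red M N) : Red M.shift N.shift :=
  Relation.ReflTransGen.lift Tm.shift (fun _ _ h => Step.rename h Nat.succ_injective) _ _ h

theorem Red.thunk {M N : Tm} (h : Red M N) : Red (thunk M) (thunk N) := h.shift.lam

theorem Red.tuple {Ms Ns : List Tm} (h : List.Forall₂ Red Ms Ns) : Red (tuple Ms) (tuple Ns) := by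
  have : ∀ {H H' : Tm}, Red H H' →
      Red ((Ms.map Tm.shift).foldl .app H) ((Ns.map Tm.shift).foldl .app H') := by
    induction h with
    | nil => exact fun h => h
    | cons h _ ih => exact fun hH => ih (hH.app h.shift)
  exact (this (.refl _)).lam

/-! ## Quasi-tapes -/

@[simp] theorem Tm.subst_thunk (M : Tm) (σ : ℕ → Tm) : (thunk M).subst σ = thunk (M.subst σ) := by
  simp only [thunk, subst, subst_shift]

@[simp] theorem Tm.shift_thunk (M : Tm) : (thunk M).shift = thunk M.shift :=
  congrArg lam (rename_shift M Nat.succ)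

@[simp] theorem Tm.occ_thunk (M : Tm) (i : ℕ) : (thunk M).occ i = M.occ i := by
  simp [thunk, occ]

attribute [simp] Tm.subst_tuple Tm.occ_tuple

theorem Tm.subst_quasiTape (c x : Tm) (Ms : List Tm) (σ : ℕ → Tm) :
    (quasiTape c x Ms).subst σ = quasiTape (c.subst σ) (x.subst σ) (Ms.map (subst σ)) := by
  induction Ms with
  | nil => rfl
  | cons M Ms ih => simp only [quasiTape, subst, subst_thunk, ih, List.map_cons]

theorem Tm.subst_quasiTape_closed (c x : Tm) {Ms : List Tm} (h : ∀ M ∈ Ms, M.Closed)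
    (σ : ℕ → Tm) : (quasiTape c x Ms).subst σ = quasiTape (c.subst σ) (x.subst σ) Ms := by
  rw [subst_quasiTape, List.map_congr_left (g := id), List.map_id]
  exact fun M hM => (h M hM).subst σ

theorem Tm.shift_eq_subst (M : Tm) : M.shift = M.subst fun i => ν (i + 1) := by
  have := M.subst_rename Nat.succ Tm.var
  rw [subst_var _ fun _ _ => rfl] at this
  exact this

theorem Tm.occ_quasiTape (c x : Tm) {Ms : List Tm} (h : ∀ M ∈ Ms, M.Closed) (i : ℕ) :
    (quasiTape c x Ms).occ i = Ms.length * c.occ i + x.occ i := by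
  induction Ms with
  | nil => simp [quasiTape]
  | cons M Ms ih =>
    have := ih fun M hM => h M (by simp [hM])
    simp only [quasiTape, occ, occ_thunk, this, h M (by simp) i, List.length_cons]
    ring

/-- The type of the constructors: `S ⊸ (Z ⊸ X) ⊸ X`. -/
def consTy (S : Ty) (Z X : LTy) : LTy :=
  .limp S (.lin (.limp (.lin (.limp (.lin Z) (.lin X))) (.lin X)))

theorem quasiTape_der {Γ : Ctx} {c x : Tm} {S : Ty} {Z X : LTy}
    (hc : Der Γ c (.lin (consTy S Z X))) (hx : Der Γ x (.lin X)) {Ms : List Tm}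
    (hM : ∀ M ∈ Ms, Der Γ M S) : Der Γ (quasiTape c x Ms) (.lin X) := by
  induction Ms with
  | nil => exact hx
  | cons M Ms ih =>
    exact .app (.app hc (hM M (by simp)))
      (.thunk (ih fun M h => hM M (by simp [h])) trivial Z)

namespace TuringMachine

variable {M : TuringMachine}

theorem symTm_der (σ : Fin M.numSymbols) (Γ : Ctx) : Der Γ (symTm σ) (.lin M.symTy) :=
  .proj (by omega) Γ

theorem botTm_der (Γ : Ctx) : Der Γ M.botTm (.lin M.symTy) := .proj (by omega) Γ

theorem topTm_der (Γ : Ctx) : Der Γ M.topTm (.lin M.symTy) := .proj (by omega) Γ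

theorem stateTm_der (s : Fin M.numStates) (Γ : Ctx) : Der Γ (stateTm s) (.lin M.stateTy) :=
  .proj s.2 Γ

theorem stateTm_closed (s : Fin M.numStates) : (stateTm s).Closed := (stateTm_der s _).closed

/-- The symbols on the tape to the left of the head, with the border. -/
def leftSyms (c : M.Config) : List Tm := c.left.map symTm ++ [M.botTm]

/-- The symbols on the tape from the head rightwards, with the border. -/
def rightSyms (c : M.Config) : List Tm := c.right.map symTm ++ [M.topTm]

theorem leftSyms_der (c : M.Config) (Γ : Ctx) : ∀ N ∈ leftSyms c, Der Γ N (.lin M.symTy) := by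
  intro N hN
  simp only [leftSyms, List.mem_append, List.mem_map, List.mem_singleton] at hN
  rcases hN with ⟨σ, -, rfl⟩ | rfl
  · exact symTm_der _ _
  · exact botTm_der _

theorem rightSyms_der (c : M.Config) (Γ : Ctx) : ∀ N ∈ rightSyms c, Der Γ N (.lin M.symTy) := by
  intro N hN
  simp only [rightSyms, List.mem_append, List.mem_map, List.mem_singleton] at hN
  rcases hN with ⟨σ, -, rfl⟩ | rfl
  · exact symTm_der _ _
  · exact topTm_der _

theorem leftSyms_closed (c : M.Config) : ∀ N ∈ leftSyms c, N.Closed :=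
  fun N hN => (leftSyms_der c _ N hN).closed

theorem rightSyms_closed (c : M.Config) : ∀ N ∈ rightSyms c, N.Closed :=
  fun N hN => (rightSyms_der c _ N hN).closed

/-- The body of the term for a configuration. -/
def confBody (t l r : Tm) (c : M.Config) : Tm :=
  tuple [thunk (quasiTape t l (leftSyms c)), stateTm c.state, thunk (quasiTape t r (rightSyms c))]

theorem confTm_eq (c : M.Config) : confTm c = ƛ ƛ ƛ confBody (ν 2) (ν 1) (ν 0) c := rfl

theorem confBody_subst (t l r : Tm) (c : M.Config) (σ : ℕ → Tm) :
    (confBody t l r c).subst σ = confBody (t.subst σ) (l.subst σ) (r.subst σ) c := by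
  simp [confBody, Tm.subst_quasiTape_closed _ _ (leftSyms_closed c),
    Tm.subst_quasiTape_closed _ _ (rightSyms_closed c), (stateTm_closed _).subst]

theorem confBody_occ (t l r : Tm) (c : M.Config) (i : ℕ) :
    (confBody t l r c).occ i = ((leftSyms c).length + (rightSyms c).length) * t.occ i +
      l.occ i + r.occ i := by
  simp only [confBody, Tm.occ_tuple, List.map_cons, List.map_nil, List.sum_cons, List.sum_nil,
    Tm.occ_thunk, Tm.occ_quasiTape _ _ (leftSyms_closed c),
    Tm.occ_quasiTape _ _ (rightSyms_closed c), stateTm_closed _ i]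
  ring

/-- The type of the parts of the tape: `(Y ⊸ Y) ⊸ X`. -/
def sideTy (X Y : LTy) : LTy := .limp (.lin Y.endo) (.lin X)

variable (M) in
/-- The type of a configuration without the borders of the tape. -/
def bodyTy (X Y : LTy) : LTy :=
  tensorTy [.lin (sideTy X Y), .lin M.stateTy, .lin (sideTy X Y)]

theorem confTy_inst (X Y : LTy) :
    ((LTy.limp (.bang (.arrows [.lin M.symTy, .arrow (.arrow (.tvar 0) (.tvar 0)) (.tvar 1)]
        (.tvar 1))) (.para (.arrows [.tvar 1, .tvar 1] (.lin (tensorTy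
          [.arrow (.arrow (.tvar 0) (.tvar 0)) (.tvar 1), .lin M.stateTy,
            .arrow (.arrow (.tvar 0) (.tvar 0)) (.tvar 1)]))))).subst
      (LTy.liftSub fun a => match a with
        | 0 => X
        | b + 1 => .tvar b)).inst Y =
    .limp (.bang (.lin (consTy (.lin M.symTy) Y.endo X)))
      (.para (.lin (.limp (.lin X) (.lin (.limp (.lin X) (.lin (M.bodyTy X Y))))))) := by
  simp only [LTy.inst, LTy.subst, Ty.subst, Ty.subst_arrows, List.map_cons, List.map_nil, Ty.arrow,
    Ty.tvar, LTy.liftSub, tensorTy_subst, symTy, stateTy, boolTy_subst, LTy.subst_rename,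
    LTy.subst_tvar]
  rfl

theorem confE {Γ : Ctx} {N : Tm} (h : Der Γ N (.lin M.confTy)) (X Y : LTy) :
    Der Γ N (.lin (.limp (.bang (.lin (consTy (.lin M.symTy) Y.endo X)))
      (.para (.lin (.limp (.lin X) (.lin (.limp (.lin X) (.lin (M.bodyTy X Y))))))))) := by
  rw [← confTy_inst]
  exact (h.allE X).allE Y

theorem confI {Γ : Ctx} {N : Tm} (h : ∀ X Y : LTy,
    Der Γ N (.lin (.limp (.bang (.lin (consTy (.lin M.symTy) Y.endo X)))
      (.para (.lin (.limp (.lin X) (.lin (.limp (.lin X) (.lin (M.bodyTy X Y)))))))))) :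
    Der Γ N (.lin M.confTy) := by
  refine .allI fun X => .allI fun Y => ?_
  have := h X Y
  rw [← confTy_inst] at this
  exact this

theorem confTm_der (c : M.Config) (Γ : Ctx) : Der Γ (confTm c) (.lin M.confTy) := by
  rw [confTm_eq]
  refine confI fun X Y => .lamPoly (.para (Γ' := Ctx.single 0 (consTy (.lin M.symTy) Y.endo X))
    (.lamLin (.lamLin (.tuple ?_) trivial ?_) trivial ?_) ?_) trivial
  · refine .cons (.thunk (quasiTape_der (.var (i := 2) rfl) (.var rfl) (leftSyms_der c _))
      trivial _) (.cons (stateTm_der _ _) (.cons (.thunk (quasiTape_der (.var (i := 2) rfl)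
      (.var rfl) (rightSyms_der c _)) trivial _) .nil))
  · rw [confBody_occ]
    simp [Tm.occ]
  · rw [Tm.occ, confBody_occ]
    simp [Tm.occ]
  · rintro (_ | i)
    · exact .toPoly _
    · exact .absent _

theorem confTm_closed (c : M.Config) : (confTm c).Closed := (confTm_der c _).closed

end TuringMachine

namespace TuringMachine

variable {M : TuringMachine}

/-! ## Transformations of configurations -/

/-- A transformation of configurations, which iterates `cs` on both parts of the tape, starting
with `b`, and then applies `K` to the results and the state. -/
def opTm (cs b K : Tm → Tm) : Tm :=
  ƛ ƛ (ƛ ƛ ƛ ν 2⬝b (ν 1)⬝b (ν 0)⬝K (ν 3))⬝(ν 1⬝cs (ν 0))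

/-- The operations on terms are compatible with substitution and give values. -/
structure ConfOp (cs b K : Tm → Tm) : Prop where
  cs_subst : ∀ c σ, (cs c).subst σ = cs (c.subst σ)
  b_subst : ∀ c σ, (b c).subst σ = b (c.subst σ)
  K_subst : ∀ c σ, (K c).subst σ = K (c.subst σ)
  cs_val : ∀ c, c.IsValue → (cs c).IsValue
  b_val : ∀ c, c.IsValue → (b c).IsValue
  K_val : ∀ c, (K c).IsValue
  cs_occ : ∀ c i, (cs c).occ i = c.occ i
  b_occ : ∀ c i, (b c).occ i = c.occ i
  K_occ : ∀ c i, c.occ i = 0 → (K c).occ i = 0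

namespace ConfOp

variable {cs b K : Tm → Tm}

theorem der (h : ConfOp cs b K)
    (hd : ∀ X Y : LTy, ∃ X' : LTy,
      Der (Ctx.single 0 (consTy (.lin M.symTy) Y.endo X)) (cs (ν 0))
        (.lin (consTy (.lin M.symTy) Y.endo X')) ∧
      (∀ (Γ : Ctx) i, Γ i = some (.lin X) → Der Γ (b (ν i)) (.lin X')) ∧
      ∀ (Γ : Ctx) i, Γ i = some (.lin (consTy (.lin M.symTy) Y.endo X)) →
        Der Γ (K (ν i)) (.arrows [.lin (sideTy X' Y), .lin M.stateTy, .lin (sideTy X' Y)]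
          (.lin (M.bodyTy X Y)))) :
    Der Ctx.empty (opTm cs b K) (.lin (.limp (.lin M.confTy) (.lin M.confTy))) := by
  refine .lamLin (confI fun X Y => ?_) trivial ?_
  · obtain ⟨X', h1, h2, h3⟩ := hd X Y
    refine .lamPoly (.app (A := .para (.lin (.limp (.lin X') (.lin (.limp (.lin X')
      (.lin (M.bodyTy X' Y))))))) (.lamDisch (.para (Γ' := Ctx.cons
        (some (.lin (.limp (.lin X') (.lin (.limp (.lin X') (.lin (M.bodyTy X' Y)))))))
        (Ctx.single 0 (consTy (.lin M.symTy) Y.endo X))) (.lamLin (.lamLin (.app (Der.tensorE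
        (.app (.app (.var (i := 2) rfl) (h2 _ _ rfl)) (h2 _ _ rfl)) _) (h3 _ _ rfl))
        trivial ?_) trivial ?_) ?_) trivial ?_)
        (.app (confE (.var rfl) X' Y) (.bangOne h1 rfl ?_))) trivial
    · simp [Tm.occ, h.b_occ, h.K_occ]
    · simp [Tm.occ, h.b_occ, h.K_occ]
    · refine .cons (.toDisch _) ?_
      rintro (_ | i)
      · exact .toPoly _
      · exact .absent _
    · simp [Tm.occ, h.b_occ, h.K_occ]
    · simp [Tm.occ, h.cs_occ]
  · simp [Tm.occ, h.b_occ, h.K_occ, h.cs_occ]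

theorem reduces (h : ConfOp cs b K) (c : M.Config) :
    Reduces (opTm cs b K⬝confTm c)
      (ƛ ƛ ƛ K (ν 2)⬝thunk (quasiTape (cs (ν 2)) (b (ν 1)) (leftSyms c))⬝stateTm c.state⬝
        thunk (quasiTape (cs (ν 2)) (b (ν 0)) (rightSyms c))) := by
  have hcs : ∀ c, (cs c).shift = cs c.shift := fun c => by simp only [Tm.shift_eq_subst, h.cs_subst]
  refine Red.reduces (.betaClosed (by trivial) (confTm_closed c)
    (R := ƛ (ƛ ƛ ƛ ν 2⬝b (ν 1)⬝b (ν 0)⬝K (ν 3))⬝(confTm c⬝cs (ν 0))) ?_) (Red.lam ?_)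
  · simp [Tm.inst_eq, Tm.subst, Tm.liftSub, Tm.single, h.cs_subst, h.b_subst, h.K_subst,
      (confTm_closed c).shift]
  rw [confTm_eq]
  refine (Red.appR (.step (.betaPoly (h.cs_val _ (by trivial)) ⟨0, fun x hx => ?_⟩
    (R := ƛ ƛ confBody (cs (ν 2)) (ν 1) (ν 0) c) ?_)) _).trans ?_
  · rw [h.cs_occ] at hx
    simpa [Tm.occ, eq_comm] using hx
  · simp [Tm.inst_eq, Tm.subst, Tm.liftSub, Tm.single, confBody_subst, hcs]
  refine (Red.step (.betaLin ?_ (by trivial)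
    (R := ƛ ƛ (ƛ ƛ confBody (cs (ν 4)) (ν 1) (ν 0) c)⬝b (ν 1)⬝b (ν 0)⬝K (ν 2)) ?_)).trans
    (Red.lam (Red.lam ?_))
  · simp [Tm.occ, h.b_occ, h.K_occ]
  · simp [Tm.inst_eq, Tm.subst, Tm.liftSub, Tm.single, h.b_subst, h.K_subst, Tm.shift_eq_subst,
      confBody_subst, h.cs_subst]
  refine (Red.appL (Red.beta2 (h.b_val _ (by trivial)) (h.b_val _ (by trivial)) ?_ ?_) _).trans ?_
  · simp [confBody_occ, h.cs_occ, Tm.occ]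
  · simp [confBody_occ, h.cs_occ, Tm.occ]
  rw [confBody_subst, h.cs_subst]
  exact .step (.tuple (h.K_val _))

end ConfOp

/-! ## Reading the first symbol of a quasi-tape -/

/-- The identity. -/
def idTm : Tm := ƛ ν 0

/-- The function which puts a quasi-tape that has been split together again. -/
def pickTm : Tm := ƛ ƛ ƛ ν 1⬝ν 2⬝ν 0

/-- The constructor for split quasi-tapes. -/
def splitCons (c : Tm) : Tm := ƛ ƛ tuple [ν 1, c.shift.shift, ƛ ν 1⬝idTm⬝pickTm]

variable (M) in
/-- The split empty quasi-tape. -/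
def splitNil (l : Tm) : Tm := tuple [M.botTm, ƛ ƛ ν 0⬝idTm, thunk l]

theorem botTm_closed : M.botTm.Closed := (botTm_der _).closed

theorem splitCons_subst (c : Tm) (σ : ℕ → Tm) : (splitCons c).subst σ = splitCons (c.subst σ) := by
  simp [splitCons, Tm.subst, Tm.liftSub, idTm, pickTm]

theorem splitNil_subst (l : Tm) (σ : ℕ → Tm) :
    (M.splitNil l).subst σ = M.splitNil (l.subst σ) := by
  simp [splitNil, Tm.subst, Tm.liftSub, idTm, botTm_closed.subst]

theorem splitCons_occ (c : Tm) (i : ℕ) : (splitCons c).occ i = c.occ i := by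
  simp [splitCons, Tm.occ, idTm, pickTm]

theorem splitNil_occ (l : Tm) (i : ℕ) : (M.splitNil l).occ i = l.occ i := by
  simp [splitNil, Tm.occ, idTm, botTm_closed i]

theorem pickTm_red {A B C : Tm} (hA : A.IsValue) (hB : B.IsValue) (hC : C.IsValue) :
    Red (pickTm⬝A⬝B⬝C) (B⬝A⬝C) :=
  Red.beta3 hA hB hC (by simp [Tm.occ]) (by simp [Tm.occ]) (by simp [Tm.occ])

theorem splitCons_red {c N T : Tm} (hN : N.IsValue) (hT : T.IsValue) :
    Red (splitCons c⬝N⬝T) (tuple [N, c, thunk (T⬝idTm⬝pickTm)]) := by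
  refine (Red.beta2 hN hT (by simp [Tm.occ, idTm, pickTm]) (by simp [Tm.occ, idTm, pickTm])).trans ?_
  have e : (tuple [ν 1, c.shift.shift, ƛ ν 1⬝idTm⬝pickTm]).subst (Tm.double N T) =
      tuple [N, c, thunk (T⬝idTm⬝pickTm)] := by
    simp [Tm.subst, Tm.liftSub, Tm.double, idTm, pickTm, thunk]
    rfl
  rw [e]
  exact .refl _

theorem split_red (Ms : List Tm) : ∀ {N c l : Tm}, N.IsValue → (∀ N ∈ Ms, N.IsValue) →
    c.IsValue →
    Red (quasiTape (splitCons c) (M.splitNil l) (N :: Ms))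
      (tuple [N, c, thunk (quasiTape c l Ms)]) := by
  induction Ms with
  | nil =>
    intro N c l hN _ hc
    refine (splitCons_red hN (by trivial)).trans
      (.tuple (.cons (.refl _) (.cons (.refl _) (.cons (.thunk ?_) .nil))))
    refine (Red.appL (.step .betaThunk) _).trans ?_
    refine (Red.step (.tuple (by trivial))).trans ?_
    refine (pickTm_red (by trivial) (by trivial) (by trivial)).trans ?_
    refine (Red.appL (.step (Step.betaClosed (N := M.botTm) (by trivial) botTm_closed
      (R := ƛ ν 0⬝idTm) ?_)) _).trans ?_
    · rfl
    refine (Red.step (.betaLin (R := thunk l⬝idTm) ?_ (by trivial) ?_)).trans (.step .betaThunk)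
    · simp [Tm.occ, idTm]
    · rfl
  | cons N' Ms ih =>
    intro N c l hN hMs hc
    have hN' : N'.IsValue := hMs N' (by simp)
    refine (splitCons_red hN (by trivial)).trans
      (.tuple (.cons (.refl _) (.cons (.refl _) (.cons (.thunk ?_) .nil))))
    refine (Red.appL (.step .betaThunk) _).trans ?_
    refine (Red.appL (ih hN' (fun N h => hMs N (by simp [h])) hc) _).trans ?_
    exact (Red.step (.tuple (by trivial))).trans (pickTm_red hN' hc (by trivial))

/-! ## The transition function -/

/-- Push symbols on a part of a tape. -/
def pushTm (c : Tm) (Ms : List Tm) (t : Tm) : Tm := Ms.foldr (fun N t => thunk (c⬝N⬝t)) t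

theorem pushTm_thunk (c l : Tm) (Ms Ns : List Tm) :
    pushTm c Ms (thunk (quasiTape c l Ns)) = thunk (quasiTape c l (Ms ++ Ns)) := by
  induction Ms with
  | nil => rfl
  | cons N Ms ih =>
    simp only [pushTm, List.foldr_cons] at ih ⊢
    rw [ih]
    rfl

theorem pushTm_subst {Ms : List Tm} (h : ∀ N ∈ Ms, N.Closed) (c t : Tm) (σ : ℕ → Tm) :
    (pushTm c Ms t).subst σ = pushTm (c.subst σ) Ms (t.subst σ) := by
  induction Ms with
  | nil => rfl
  | cons N Ms ih =>
    have := ih fun M hM => h M (by simp [hM])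
    simp only [pushTm, List.foldr_cons] at this ⊢
    simp [Tm.subst, this, (h N (by simp)).subst]

theorem pushTm_occ {Ms : List Tm} (h : ∀ N ∈ Ms, N.Closed) (c t : Tm) (i : ℕ) :
    (pushTm c Ms t).occ i = Ms.length * c.occ i + t.occ i := by
  induction Ms with
  | nil => simp [pushTm]
  | cons N Ms ih =>
    have := ih fun M hM => h M (by simp [hM])
    simp only [pushTm, List.foldr_cons, List.length_cons] at this ⊢
    simp only [Tm.occ_thunk, Tm.occ, this, h N (by simp) i]
    ring

theorem pushTm_der {Γ : Ctx} {c t : Tm} {S : Ty} {X Y : LTy}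
    (hc : Der Γ c (.lin (consTy S Y.endo X))) (ht : Der Γ t (.lin (sideTy X Y))) {Ms : List Tm}
    (hM : ∀ N ∈ Ms, Der Γ N S) : Der Γ (pushTm c Ms t) (.lin (sideTy X Y)) := by
  induction Ms with
  | nil => exact ht
  | cons N Ms ih =>
    exact .thunk (.app (.app hc (hM N (by simp))) (ih fun M h => hM M (by simp [h]))) trivial _

/-- The symbol with a number, unless it is a border. -/
def decode (i : ℕ) : Option (Fin M.numSymbols) :=
  if h : 0 < i ∧ i ≤ M.numSymbols then some ⟨i - 1, by omega⟩ else none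

/-- The state with a number. -/
def decodeState (j : ℕ) : Fin M.numStates := if h : j < M.numStates then ⟨j, h⟩ else M.start

/-- The first symbol of the left part of the tape. -/
def firstLeft : Option (Fin M.numSymbols) → Tm
  | none => M.botTm
  | some σ => symTm σ

/-- The right border, if the right part of the tape is empty. -/
def borderRight : Option (Fin M.numSymbols) → List Tm
  | none => [M.topTm]
  | some _ => []

/-- The left border, if the left part of the tape is empty. -/
def borderLeft : Option (Fin M.numSymbols) → List Tm
  | none => [M.botTm]
  | some _ => []

/-- The symbols to be pushed on the left and on the right part of the tape, without their first
symbols `l` and `r`, and the new state. -/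
def entry (r : Option (Fin M.numSymbols)) (s : Fin M.numStates) (l : Option (Fin M.numSymbols)) :
    List Tm × Fin M.numStates × List Tm :=
  match M.δ (r.getD M.blank) s with
  | (.left, σ, s') => (borderLeft l, s', symTm (l.getD M.blank) :: symTm σ :: borderRight r)
  | (.right, σ, s') => ([symTm σ, firstLeft l], s', borderRight r)
  | (.stay, σ, s') => ([firstLeft l], s', symTm σ :: borderRight r)

theorem firstLeft_der (l : Option (Fin M.numSymbols)) (Γ : Ctx) :
    Der Γ (firstLeft l) (.lin M.symTy) := by
  cases l with
  | none => exact botTm_der _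
  | some σ => exact symTm_der _ _

theorem borderLeft_der (l : Option (Fin M.numSymbols)) (Γ : Ctx) :
    ∀ N ∈ borderLeft l, Der Γ N (.lin M.symTy) := by
  cases l with
  | none => simpa [borderLeft] using botTm_der _
  | some σ => simp [borderLeft]

theorem borderRight_der (l : Option (Fin M.numSymbols)) (Γ : Ctx) :
    ∀ N ∈ borderRight l, Der Γ N (.lin M.symTy) := by
  cases l with
  | none => simpa [borderRight] using topTm_der _
  | some σ => simp [borderRight]

theorem entry_der (r : Option (Fin M.numSymbols)) (s : Fin M.numStates)
    (l : Option (Fin M.numSymbols)) (Γ : Ctx) :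
    (∀ N ∈ (entry r s l).1, Der Γ N (.lin M.symTy)) ∧
      ∀ N ∈ (entry r s l).2.2, Der Γ N (.lin M.symTy) := by
  unfold entry
  have h1 := borderLeft_der l Γ
  have h2 := borderRight_der r Γ
  split
  · exact ⟨h1, by simpa [symTm_der] using h2⟩
  · exact ⟨by simp [symTm_der, firstLeft_der], h2⟩
  · exact ⟨by simp [firstLeft_der], by simpa [symTm_der] using h2⟩

theorem entry_left_closed (r : Option (Fin M.numSymbols)) (s : Fin M.numStates)
    (l : Option (Fin M.numSymbols)) : ∀ N ∈ (entry r s l).1, N.Closed :=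
  fun N h => ((entry_der r s l _).1 N h).closed

theorem entry_right_closed (r : Option (Fin M.numSymbols)) (s : Fin M.numStates)
    (l : Option (Fin M.numSymbols)) : ∀ N ∈ (entry r s l).2.2, N.Closed :=
  fun N h => ((entry_der r s l _).2 N h).closed

/-- The function that builds the new configuration from the rests of the tape. -/
def branchTm (c : Tm) (r : Option (Fin M.numSymbols)) (s : Fin M.numStates)
    (l : Option (Fin M.numSymbols)) : Tm :=
  ƛ ƛ tuple [pushTm c.shift.shift (entry r s l).1 (ν 1), stateTm (entry r s l).2.1,
    pushTm c.shift.shift (entry r s l).2.2 (ν 0)]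

theorem branchTm_subst (c : Tm) (r : Option (Fin M.numSymbols)) (s : Fin M.numStates)
    (l : Option (Fin M.numSymbols)) (σ : ℕ → Tm) :
    (branchTm c r s l).subst σ = branchTm (c.subst σ) r s l := by
  simp [branchTm, Tm.subst, pushTm_subst (entry_left_closed r s l),
    pushTm_subst (entry_right_closed r s l), (stateTm_closed _).subst, Tm.liftSub]

theorem branchTm_occ {c : Tm} (r : Option (Fin M.numSymbols)) (s : Fin M.numStates)
    (l : Option (Fin M.numSymbols)) {i : ℕ} (h : c.occ i = 0) : (branchTm c r s l).occ i = 0 := by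
  simp [branchTm, Tm.occ, pushTm_occ (entry_left_closed r s l),
    pushTm_occ (entry_right_closed r s l), stateTm_closed _ _, h]

theorem branchTm_der {Γ : Ctx} {i : ℕ} {X Y : LTy} (r : Option (Fin M.numSymbols))
    (s : Fin M.numStates) (l : Option (Fin M.numSymbols))
    (h : Γ i = some (.lin (consTy (.lin M.symTy) Y.endo X))) :
    Der Γ (branchTm (ν i) r s l)
      (.arrows [.lin (sideTy X Y), .lin (sideTy X Y)] (.lin (M.bodyTy X Y))) := by
  refine .lamLin (.lamLin (.tuple (.cons (pushTm_der (.var (i := i + 2) (by exact h))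
    (.var rfl) (entry_der r s l _).1) (.cons (stateTm_der _ _) (.cons (pushTm_der
    (.var (i := i + 2) (by exact h)) (.var rfl) (entry_der r s l _).2) .nil))))
    trivial ?_) trivial ?_
  · simp [Tm.occ, pushTm_occ (entry_left_closed r s l), pushTm_occ (entry_right_closed r s l),
      stateTm_closed _ _]
  · simp [Tm.occ, pushTm_occ (entry_left_closed r s l), pushTm_occ (entry_right_closed r s l),
      stateTm_closed _ _]

theorem branchTm_red {c L R : Tm} (r : Option (Fin M.numSymbols)) (s : Fin M.numStates)
    (l : Option (Fin M.numSymbols)) (hL : L.IsValue) (hR : R.IsValue) :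
    Red (branchTm c r s l⬝L⬝R) (tuple [pushTm c (entry r s l).1 L, stateTm (entry r s l).2.1,
      pushTm c (entry r s l).2.2 R]) := by
  refine (Red.beta2 hL hR ?_ ?_).trans ?_
  · simp [Tm.occ, pushTm_occ (entry_left_closed r s l), pushTm_occ (entry_right_closed r s l),
      stateTm_closed _ _]
  · simp [Tm.occ, pushTm_occ (entry_left_closed r s l), pushTm_occ (entry_right_closed r s l),
      stateTm_closed _ _]
  · simp only [Tm.subst_tuple, List.map_cons, List.map_nil, pushTm_subst (entry_left_closed r s l),
      pushTm_subst (entry_right_closed r s l), (stateTm_closed _).subst, Tm.shift_subst_double]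
    exact .refl _

variable (M) in
/-- The table of the transition function. -/
def tableTm (c : Tm) : Tm :=
  matchTm (M.numSymbols + 2) fun i => matchTm M.numStates fun j => matchTm (M.numSymbols + 2)
    fun m => branchTm c (M.decode i) (M.decodeState j) (M.decode m)

theorem tableTm_subst (c : Tm) (σ : ℕ → Tm) : (M.tableTm c).subst σ = M.tableTm (c.subst σ) := by
  simp only [tableTm, Tm.subst_matchTm, branchTm_subst]

theorem tableTm_occ {c : Tm} {i : ℕ} (h : c.occ i = 0) : (M.tableTm c).occ i = 0 :=
  Tm.occ_matchTm fun _ _ => Tm.occ_matchTm fun _ _ => Tm.occ_matchTm fun _ _ => branchTm_occ _ _ _ h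

theorem tableTm_der {Γ : Ctx} {i : ℕ} {X Y : LTy}
    (h : Γ i = some (.lin (consTy (.lin M.symTy) Y.endo X))) :
    Der Γ (M.tableTm (ν i)) (.arrows [.lin M.symTy, .lin M.stateTy, .lin M.symTy,
      .lin (sideTy X Y), .lin (sideTy X Y)] (.lin (M.bodyTy X Y))) :=
  .matchTm fun _ _ => .matchTm fun _ _ => .matchTm fun _ _ => branchTm_der _ _ _ h

theorem tableTm_red (c : Tm) {i m : ℕ} (hi : i < M.numSymbols + 2) (s : Fin M.numStates)
    (hm : m < M.numSymbols + 2) :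
    Red (M.tableTm c⬝proj (M.numSymbols + 2) i⬝stateTm s⬝proj (M.numSymbols + 2) m)
      (branchTm c (M.decode i) s (M.decode m)) := by
  have hs : M.decodeState s = s := by simp [decodeState]
  have h1 := Red.matchTm (F := fun i => matchTm M.numStates fun j =>
    matchTm (M.numSymbols + 2) fun m => branchTm c (M.decode i) (M.decodeState j) (M.decode m))
    hi fun _ _ => trivial
  have h2 := Red.matchTm (F := fun j => matchTm (M.numSymbols + 2) fun m =>
    branchTm c (M.decode i) (M.decodeState j) (M.decode m)) s.2 fun _ _ => trivial
  have h3 := Red.matchTm (F := fun m => branchTm c (M.decode i) (M.decodeState s) (M.decode m)) hm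
    fun _ _ => trivial
  rw [hs] at h3
  exact (Red.appL (Red.appL h1 _) _).trans ((Red.appL h2 _).trans (by simpa only [hs] using h3))

variable (M) in
/-- Split both parts of the tape, and look up the transition. -/
def stepTm (c : Tm) : Tm :=
  ƛ ƛ ƛ ν 2⬝idTm⬝(ƛ ƛ ƛ ν 3⬝idTm⬝(ƛ ƛ ƛ
    M.tableTm c.shift.shift.shift.shift.shift.shift.shift.shift.shift⬝ν 2⬝ν 7⬝ν 5⬝ν 3⬝ν 0))

variable (M) in
/-- The transition function. -/
def transTm : Tm := opTm splitCons M.splitNil M.stepTm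

theorem confOp_trans : ConfOp splitCons M.splitNil M.stepTm where
  cs_subst := splitCons_subst
  b_subst := splitNil_subst
  K_subst c σ := by simp [stepTm, Tm.subst, Tm.liftSub, tableTm_subst, idTm]
  cs_val _ _ := trivial
  b_val _ _ := trivial
  K_val _ := trivial
  cs_occ := splitCons_occ
  b_occ := splitNil_occ
  K_occ c i h := by
    simp only [stepTm, Tm.occ, idTm]
    rw [tableTm_occ (by simpa using h)]
    simp

theorem stepTm_der {Γ : Ctx} {i : ℕ} {X Y : LTy}
    (h : Γ i = some (.lin (consTy (.lin M.symTy) Y.endo X))) :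
    Der Γ (M.stepTm (ν i)) (.arrows
      [.lin (sideTy (tensorTy [.lin M.symTy, .lin (consTy (.lin M.symTy) Y.endo X),
          .lin (sideTy X Y)]) Y), .lin M.stateTy,
        .lin (sideTy (tensorTy [.lin M.symTy, .lin (consTy (.lin M.symTy) Y.endo X),
          .lin (sideTy X Y)]) Y)] (.lin (M.bodyTy X Y))) := by
  have hid : ∀ Δ : Ctx, Der Δ idTm (.lin Y.endo) :=
    fun Δ => .lamLin (.var rfl) trivial (by simp [Tm.occ])
  refine .lamLin (.lamLin (.lamLin (.app (Der.tensorE (.app (.var rfl) (hid _)) _)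
    (.lamLin (.lamLin (.lamLin (.app (Der.tensorE (.app (.var rfl) (hid _)) _)
    (.lamLin (.lamLin (.lamLin (.app (.app (.app (.app (.app (tableTm_der (i := i + 9) (by exact h)) (.var rfl))
      (.var rfl)) (.var rfl)) (.var rfl)) (.var rfl)) ?_ ?_) ?_ ?_) ?_ ?_)) ?_ ?_)
      ?_ ?_) ?_ ?_)) ?_ ?_) ?_ ?_) ?_ ?_
  all_goals first
    | trivial
    | (simp only [Tm.occ, idTm]
       rw [tableTm_occ (by simp [Tm.occ])]
       simp)

end TuringMachine

namespace TuringMachine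

variable {M : TuringMachine}

theorem stepTm_red {c QL QR σl σr tl tr : Tm} (s : Fin M.numStates) (hc : c.IsValue)
    (hL : Red QL (tuple [σl, c, tl])) (hR : Red QR (tuple [σr, c, tr]))
    (hσl : σl.IsValue) (hσr : σr.IsValue) (htl : tl.IsValue) (htr : tr.IsValue) :
    Red (M.stepTm c⬝thunk QL⬝stateTm s⬝thunk QR) (M.tableTm c⬝σr⬝stateTm s⬝σl⬝tl⬝tr) := by
  have hs := stateTm_closed s
  have ho : ∀ (c : Tm) i, i < 3 → (M.tableTm c.shift.shift.shift).occ i = 0 := by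
    intro c i hi
    apply tableTm_occ
    interval_cases i <;> simp
  have ho' : ∀ (c : Tm) i, i < 6 →
      (M.tableTm c.shift.shift.shift.shift.shift.shift).occ i = 0 := by
    intro c i hi
    apply tableTm_occ
    interval_cases i <;> simp
  have ho'' : ∀ (c : Tm) i, i < 9 →
      (M.tableTm c.shift.shift.shift.shift.shift.shift.shift.shift.shift).occ i = 0 := by
    intro c i hi
    apply tableTm_occ
    interval_cases i <;> simp
  refine (Red.beta3 (by trivial) (by trivial) (by trivial) ?_ ?_ ?_).trans ?_
  iterate 3 simp [Tm.occ, idTm, ho'']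
  have e1 : (ν 2⬝idTm⬝(ƛ ƛ ƛ ν 3⬝idTm⬝(ƛ ƛ ƛ
      M.tableTm c.shift.shift.shift.shift.shift.shift.shift.shift.shift⬝ν 2⬝ν 7⬝ν 5⬝ν 3⬝ν 0))).subst
        (Tm.triple (thunk QL) (stateTm s) (thunk QR)) =
      thunk QL⬝idTm⬝(ƛ ƛ ƛ (thunk QR).shift.shift.shift⬝idTm⬝(ƛ ƛ ƛ
        M.tableTm c.shift.shift.shift.shift.shift.shift⬝ν 2⬝stateTm s⬝ν 5⬝ν 3⬝ν 0)) := by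
    simp [Tm.subst, Tm.liftSub, Tm.triple, idTm, tableTm_subst, hs.shift]
  rw [e1]
  refine (Red.appL ((Red.step .betaThunk).trans hL) _).trans ((Red.step (.tuple (by trivial))).trans ?_)
  refine (Red.beta3 hσl hc htl ?_ ?_ ?_).trans ?_
  iterate 3 simp [Tm.occ, idTm, ho', hs _]
  have e2 : ((thunk QR).shift.shift.shift⬝idTm⬝(ƛ ƛ ƛ
        M.tableTm c.shift.shift.shift.shift.shift.shift⬝ν 2⬝stateTm s⬝ν 5⬝ν 3⬝ν 0)).subst
        (Tm.triple σl c tl) = thunk QR⬝idTm⬝(ƛ ƛ ƛ M.tableTm c.shift.shift.shift⬝ν 2⬝stateTm s⬝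
          σl.shift.shift.shift⬝tl.shift.shift.shift⬝ν 0) := by
    simp [Tm.subst, Tm.liftSub, Tm.triple, idTm, tableTm_subst, hs.subst, -Tm.shift_thunk]
  rw [e2]
  refine (Red.appL ((Red.step .betaThunk).trans hR) _).trans ((Red.step (.tuple (by trivial))).trans ?_)
  refine (Red.beta3 hσr hc htr ?_ ?_ ?_).trans ?_
  iterate 3 simp [Tm.occ, ho, hs _]
  have e3 : (M.tableTm c.shift.shift.shift⬝ν 2⬝stateTm s⬝
      σl.shift.shift.shift⬝tl.shift.shift.shift⬝ν 0).subst (Tm.triple σr c tr) =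
      M.tableTm c⬝σr⬝stateTm s⬝σl⬝tl⬝tr := by
    simp [Tm.subst, Tm.triple, tableTm_subst, hs.subst]
  rw [e3]
  exact .refl _

/-- The left part of the tape without its first symbol. -/
def restLeft : List (Fin M.numSymbols) → List Tm
  | [] => []
  | _ :: l => l.map symTm ++ [M.botTm]

/-- The right part of the tape without its first symbol. -/
def restRight : List (Fin M.numSymbols) → List Tm
  | [] => []
  | _ :: r => r.map symTm ++ [M.topTm]

/-- The first symbol of the right part of the tape. -/
def firstRight : Option (Fin M.numSymbols) → Tm
  | none => M.topTm
  | some σ => symTm σ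

theorem leftSyms_eq (c : M.Config) : leftSyms c = firstLeft c.left.head? :: restLeft c.left := by
  rcases c with ⟨_ | ⟨a, l⟩, s, r⟩ <;> rfl

theorem rightSyms_eq (c : M.Config) :
    rightSyms c = firstRight c.right.head? :: restRight c.right := by
  rcases c with ⟨l, s, _ | ⟨a, r⟩⟩ <;> rfl

theorem decode_left (l : Option (Fin M.numSymbols)) :
    ∃ i < M.numSymbols + 2, firstLeft l = proj (M.numSymbols + 2) i ∧ M.decode i = l := by
  cases l with
  | none => exact ⟨0, by omega, rfl, by simp [decode]⟩
  | some σ => exact ⟨σ + 1, by omega, rfl, by simp [decode]⟩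

theorem decode_right (r : Option (Fin M.numSymbols)) :
    ∃ i < M.numSymbols + 2, firstRight r = proj (M.numSymbols + 2) i ∧ M.decode i = r := by
  cases r with
  | none => exact ⟨M.numSymbols + 1, by omega, rfl, by simp [decode]⟩
  | some σ => exact ⟨σ + 1, by omega, rfl, by simp [decode]⟩

theorem entry_step (c : M.Config) :
    (entry c.right.head? c.state c.left.head?).1 ++ restLeft c.left = leftSyms (step c) ∧
    (entry c.right.head? c.state c.left.head?).2.1 = (step c).state ∧
    (entry c.right.head? c.state c.left.head?).2.2 ++ restRight c.right = rightSyms (step c) := by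
  rcases c with ⟨l, s, r⟩
  have hr : r.head?.getD M.blank = r.headD M.blank := by cases r <;> rfl
  simp only [entry, step, hr]
  rcases M.δ (r.headD M.blank) s with ⟨_ | _ | _, σ, s'⟩ <;> cases l <;> cases r <;>
    simp [borderLeft, borderRight, restLeft, restRight, leftSyms, rightSyms, firstLeft]

theorem transTm_reduces (c : M.Config) : Reduces (M.transTm⬝confTm c) (confTm (step c)) := by
  refine (confOp_trans.reduces c).trans_left ?_
  rw [confTm_eq]
  refine Red.lam (Red.lam (Red.lam ?_))
  have hval : ∀ (c : M.Config), (∀ N ∈ leftSyms c, N.IsValue) ∧ ∀ N ∈ rightSyms c, N.IsValue := by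
    intro c
    constructor <;> intro N hN <;>
    · simp only [leftSyms, rightSyms, List.mem_append, List.mem_map, List.mem_singleton] at hN
      rcases hN with ⟨σ, -, rfl⟩ | rfl <;> trivial
  have hl := (hval c).1
  have hr := (hval c).2
  rw [leftSyms_eq, List.forall_mem_cons] at hl
  rw [rightSyms_eq, List.forall_mem_cons] at hr
  rw [leftSyms_eq, rightSyms_eq]
  obtain ⟨h1, h2, h3⟩ := entry_step c
  refine (stepTm_red c.state (by trivial) (split_red (restLeft c.left) hl.1 hl.2 (by trivial))
    (split_red (restRight c.right) hr.1 hr.2 (by trivial)) hl.1 hr.1 (by trivial)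
    (by trivial)).trans ?_
  obtain ⟨i, hi, ei, di⟩ := decode_left c.left.head?
  obtain ⟨j, hj, ej, dj⟩ := decode_right c.right.head?
  rw [ei, ej]
  refine (Red.appL (Red.appL (tableTm_red _ hj c.state hi) _) _).trans ?_
  rw [di, dj]
  refine (branchTm_red _ _ _ (by trivial) (by trivial)).trans ?_
  rw [pushTm_thunk, pushTm_thunk, h1, h2, h3]
  exact .refl _

theorem transTm_der : Der Ctx.empty M.transTm (.lin (.limp (.lin M.confTy) (.lin M.confTy))) := by
  refine confOp_trans.der fun X Y => ⟨tensorTy [.lin M.symTy, .lin (consTy (.lin M.symTy) Y.endo X),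
    .lin (sideTy X Y)], ?_, ?_, fun Γ i h => stepTm_der h⟩
  · have hid : ∀ Δ : Ctx, Der Δ idTm (.lin Y.endo) :=
      fun Δ => .lamLin (.var rfl) trivial (by simp [Tm.occ])
    refine .lamLin (.lamLin (.tuple (.cons (.var rfl) (.cons (.var rfl) (.cons (.lamLin (.app
      (Der.tensorE (.app (.var (i := 1) rfl) (hid _)) X) ?_) trivial ?_) .nil)))) trivial ?_)
      trivial ?_
    · exact .lamLin (.lamLin (.lamLin (.app (.app (.var (i := 1) rfl) (.var (i := 2) rfl))
        (.var rfl)) trivial (by simp [Tm.occ])) trivial (by simp [Tm.occ])) trivial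
        (by simp [Tm.occ])
    all_goals simp [Tm.occ, idTm, pickTm]
  · intro Γ i h
    have hid : ∀ Δ : Ctx, Der Δ idTm (.lin Y.endo) :=
      fun Δ => .lamLin (.var rfl) trivial (by simp [Tm.occ])
    refine .tuple (.cons (botTm_der _) (.cons (.lamLin (.lamLin (.app (.var (i := 0) rfl) (hid _))
      trivial ?_) trivial ?_) (.cons (.thunk (.var h) trivial _) .nil)))
    all_goals simp [Tm.occ, idTm]

end TuringMachine

namespace TuringMachine

variable {M : TuringMachine}

/-! ## Loading the input tape -/

theorem listTy_inst (X Y : LTy) :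
    ((LTy.limp (.bang (.arrows [(Ty.lin M.symTy).rename (· + 2), .arrow (.tvar 0) (.tvar 1)]
        (.tvar 1))) (.para (.arrows [.tvar 1, .tvar 0] (.tvar 1)))).subst
      (LTy.liftSub fun a => match a with
        | 0 => X
        | b + 1 => .tvar b)).inst Y =
    .limp (.bang (.lin (consTy (.lin M.symTy) Y X)))
      (.para (.lin (.limp (.lin X) (.lin (.limp (.lin Y) (.lin X)))))) := by
  simp only [LTy.inst, LTy.subst, Ty.subst, Ty.subst_arrows, List.map_cons, List.map_nil, Ty.arrow,
    Ty.tvar, LTy.liftSub, symTy, boolTy_subst, Ty.rename, boolTy_rename, LTy.subst_rename,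
    LTy.subst_tvar]
  rfl

theorem listE {Γ : Ctx} {N : Tm} (h : Der Γ N (.lin (listTy (.lin M.symTy)))) (X Y : LTy) :
    Der Γ N (.lin (.limp (.bang (.lin (consTy (.lin M.symTy) Y X)))
      (.para (.lin (.limp (.lin X) (.lin (.limp (.lin Y) (.lin X)))))))) := by
  rw [← listTy_inst]
  exact (h.allE X).allE Y

theorem listI {Γ : Ctx} {N : Tm} (h : ∀ X Y : LTy,
    Der Γ N (.lin (.limp (.bang (.lin (consTy (.lin M.symTy) Y X)))
      (.para (.lin (.limp (.lin X) (.lin (.limp (.lin Y) (.lin X))))))))) :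
    Der Γ N (.lin (listTy (.lin M.symTy))) := by
  refine .allI fun X => .allI fun Y => ?_
  have := h X Y
  rw [← listTy_inst] at this
  exact this

theorem symTm_closed (σ : Fin M.numSymbols) : (symTm σ).Closed := (symTm_der σ _).closed

theorem map_symTm_closed (w : List (Fin M.numSymbols)) : ∀ N ∈ w.map symTm, N.Closed := by
  simpa using fun σ _ => symTm_closed σ

theorem tapeTm_eq (w : List (Fin M.numSymbols)) :
    tapeTm w = ƛ ƛ ƛ quasiTape (ν 2) (ν 1) (w.map symTm) := by
  rw [tapeTm, listTm, List.map_map]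
  congr 4
  exact List.map_congr_left fun σ _ => (symTm_closed σ).rename _

theorem tapeTm_der (w : List (Fin M.numSymbols)) (Γ : Ctx) :
    Der Γ (tapeTm w) (.lin (listTy (.lin M.symTy))) := by
  rw [tapeTm_eq]
  refine listI fun X Y => .lamPoly (.para (Γ' := Ctx.single 0 (consTy (.lin M.symTy) Y X))
    (.lamLin (.lamLin (quasiTape_der (.var (i := 2) rfl) (.var rfl) ?_) trivial ?_) trivial ?_) ?_)
    trivial
  · simpa using fun σ _ => symTm_der σ _
  · simp [Tm.occ_quasiTape _ _ (map_symTm_closed w), Tm.occ]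
  · simp [Tm.occ_quasiTape _ _ (map_symTm_closed w), Tm.occ]
  · rintro (_ | i)
    · exact .toPoly _
    · exact .absent _

theorem tapeTm_closed (w : List (Fin M.numSymbols)) : (tapeTm w).Closed := (tapeTm_der w _).closed

/-- Write a symbol on the right part of the tape. -/
def writeTm (N : Tm) : Tm :=
  opTm id id fun c => ƛ ƛ ƛ tuple [ν 2, ν 1, thunk (c.shift.shift.shift⬝N⬝ν 0)]

theorem confOp_write {N : Tm} (hN : N.Closed) :
    ConfOp id id fun c => ƛ ƛ ƛ tuple [ν 2, ν 1, thunk (c.shift.shift.shift⬝N⬝ν 0)] where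
  cs_subst _ _ := rfl
  b_subst _ _ := rfl
  K_subst c σ := by simp [Tm.subst, Tm.liftSub, hN.subst]
  cs_val _ h := h
  b_val _ h := h
  K_val _ := trivial
  cs_occ _ _ := rfl
  b_occ _ _ := rfl
  K_occ c i h := by simp [Tm.occ, h, hN _]

theorem writeTm_der {N : Tm} (hN : Der Ctx.empty N (.lin M.symTy)) :
    Der Ctx.empty (writeTm N) (.lin (.limp (.lin M.confTy) (.lin M.confTy))) := by
  have hc := hN.closed
  refine (confOp_write hc).der fun X Y => ⟨X, .var rfl, fun Γ i h => .var h, fun Γ i h => ?_⟩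
  refine .lamLin (.lamLin (.lamLin (.tuple (.cons (.var rfl) (.cons (.var rfl) (.cons
    (.thunk (.app (.app (.var (i := i + 3) (by exact h)) (hN.weaken _)) (.var rfl)) (by trivial) _)
    .nil)))) trivial ?_) trivial ?_) trivial ?_
  all_goals simp [Tm.occ, hc _]

theorem writeTm_red (σ : Fin M.numSymbols) (l r : List (Fin M.numSymbols)) (s : Fin M.numStates) :
    Red (writeTm (symTm σ)⬝confTm ⟨l, s, r⟩) (confTm ⟨l, s, σ :: r⟩) := by
  have hσ := symTm_closed σ
  refine ((confOp_write hσ).reduces ⟨l, s, r⟩).to_reflTransGen.trans ?_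
  refine Red.lam (Red.lam (Red.lam ?_))
  refine (Red.beta3 (by trivial) (by trivial) (by trivial) ?_ ?_ ?_).trans ?_
  iterate 3 simp [Tm.occ, hσ _]
  have e : (tuple [ν 2, ν 1, thunk ((ν 2).shift.shift.shift⬝symTm σ⬝ν 0)]).subst
      (Tm.triple (thunk (quasiTape (id (ν 2)) (id (ν 1)) (leftSyms ⟨l, s, r⟩))) (stateTm s)
        (thunk (quasiTape (id (ν 2)) (id (ν 0)) (rightSyms ⟨l, s, r⟩)))) =
      confBody (ν 2) (ν 1) (ν 0) ⟨l, s, σ :: r⟩ := by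
    simp [Tm.subst, Tm.triple, hσ.subst]
    rfl
  rw [e]
  exact .refl _

variable (M) in
/-- `n` boxes around the type of configurations. -/
abbrev boxedConf (n : ℕ) : Ty := .paras n (.lin M.confTy)

variable (M) in
/-- The type of pairs of a numeral and a configuration in boxes, with results of the same type. -/
def loadTy (n : ℕ) : LTy :=
  .limp (.lin (.limp (.lin natTy) (.lin (.limp (M.boxedConf n) (M.boxedConf n)))))
    (M.boxedConf n)

/-- The pair of a numeral and a configuration. -/
def loadVal (j : ℕ) (c : M.Config) : Tm := ƛ ν 0⬝church j⬝confTm c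

/-- Increment the numeral, and write a symbol. -/
def loadWrite (N : Tm) : Tm := ƛ ƛ ν 1⬝(ƛ ƛ ν 2⬝(addTo 1⬝ν 1)⬝(writeTm N⬝ν 0))

variable (M) in
/-- Load a symbol. -/
def loadStep : Tm :=
  ƛ ƛ matchTm (M.numSymbols + 2) (fun i => loadWrite (proj (M.numSymbols + 2) i))⬝ν 1⬝(ν 0⬝idTm)

theorem loadVal_der (n j : ℕ) (c : M.Config) (Γ : Ctx) : Der Γ (loadVal j c) (.lin (M.loadTy n)) :=
  .lamLin (.app (.app (.var rfl) (church_der j _)) (((confTm_der c _).paras n).weaken _))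
    (Ty.NotBang.paras (by trivial) _) (by simp [Tm.occ, confTm_closed c _])

theorem loadVal_closed (j : ℕ) (c : M.Config) : (loadVal j c).Closed := (loadVal_der 0 j c _).closed

theorem loadWrite_der {N : Tm} (hN : Der Ctx.empty N (.lin M.symTy)) (n : ℕ) (Γ : Ctx) :
    Der Γ (loadWrite N) (.lin (M.loadTy (n + 1)).endo) := by
  have hw := writeTm_der hN
  have hc := hw.closed
  have hR : (M.boxedConf (n + 1)).NotBang := Ty.NotBang.paras (by trivial) _
  refine .lamLin (.lamLin (.app (.var (i := 1) rfl) (.lamLin (L := natTy) ?_ trivial ?_))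
    hR ?_) trivial ?_
  · have hlam : ∀ {Δ : Ctx} {T : Tm}, Der (Δ.cons (some (.disch (M.boxedConf n)))) T
        (M.boxedConf (n + 1)) → T.occ 0 ≤ 1 →
        Der Δ (ƛ T) (.lin (.limp (M.boxedConf (n + 1)) (M.boxedConf (n + 1)))) := by
      intro Δ T hT ho
      have := hT.lamDisch hR ho
      rwa [← Ty.paras_succ] at this
    refine hlam (.app (.app (.var (i := 2) rfl) (.app (addTo_der 1 _) (.var rfl)))
      (.parasOne (.app (hw.weaken _) (.var rfl)) n)) ?_
    simp [Tm.occ, hc _]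
  all_goals simp [Tm.occ, hc _]

theorem loadStep_der (n : ℕ) (Γ : Ctx) : Der Γ M.loadStep
    (.lin (consTy (.lin M.symTy) natTy.endo (M.loadTy (n + 1)))) := by
  have hm : ∀ Γ, Der Γ (matchTm (M.numSymbols + 2)
      (fun i => loadWrite (proj (M.numSymbols + 2) i)))
      (.lin (.limp (.lin M.symTy) (.lin (M.loadTy (n + 1)).endo))) :=
    fun Γ => .matchTm fun i hi => loadWrite_der (.proj hi _) n Γ
  refine .lamLin (.lamLin (.app (.app (hm _) (.var rfl)) (.app (A := .lin natTy.endo)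
    (.var (i := 0) rfl) (.lamLin (.var rfl) trivial (by simp [Tm.occ])))) trivial ?_) trivial ?_
  all_goals simp [Tm.occ, (hm Ctx.empty).closed _, idTm]

theorem loadStep_closed : M.loadStep.Closed := (loadStep_der 0 _).closed

theorem loadWrite_red (σ : Fin M.numSymbols) (j : ℕ) (l r : List (Fin M.numSymbols))
    (s : Fin M.numStates) :
    Red (loadWrite (symTm σ)⬝loadVal j ⟨l, s, r⟩) (loadVal (j + 1) ⟨l, s, σ :: r⟩) := by
  have hc := (writeTm_der (symTm_der σ _)).closed
  have hl := loadVal_closed j (M := M) ⟨l, s, r⟩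
  have hcf := confTm_closed (M := M) ⟨l, s, r⟩
  refine (Red.step (.betaClosed (by trivial) hl
    (R := ƛ loadVal j ⟨l, s, r⟩⬝(ƛ ƛ ν 2⬝(addTo 1⬝ν 1)⬝(writeTm (symTm σ)⬝ν 0))) ?_)).trans
    (Red.lam ?_)
  · simp [Tm.inst_eq, Tm.subst, Tm.liftSub, Tm.single, hl.shift, hc.subst]
  refine (Red.step (.betaLin (by simp [Tm.occ, hcf _]) (by trivial)
    (R := (ƛ ƛ ν 2⬝(addTo 1⬝ν 1)⬝(writeTm (symTm σ)⬝ν 0))⬝church j⬝confTm ⟨l, s, r⟩) ?_)).trans ?_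
  · simp [Tm.inst_eq, Tm.subst, Tm.single, hcf.subst]
  refine (Red.beta2 (by trivial) (by trivial) (by simp [Tm.occ, hc _])
    (by simp [Tm.occ, hc _])).trans ?_
  have e : (ν 2⬝(addTo 1⬝ν 1)⬝(writeTm (symTm σ)⬝ν 0)).subst
      (Tm.double (church j) (confTm ⟨l, s, r⟩)) =
      ν 0⬝(addTo 1⬝church j)⬝(writeTm (symTm σ)⬝confTm ⟨l, s, r⟩) := by
    simp [Tm.subst, Tm.double, hc.subst]
  rw [e]
  have := addTo_red 1 j
  rw [Nat.add_comm] at this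
  exact Red.app (Red.appR this _) (writeTm_red σ l r s)

theorem load_red (w : List (Fin M.numSymbols)) :
    Red (quasiTape M.loadStep (loadVal 1 (M.init [])) (w.map symTm))
      (loadVal (w.length + 1) (M.init w)) := by
  induction w with
  | nil => exact .refl _
  | cons σ w ih =>
    have hm : (matchTm (M.numSymbols + 2)
        (fun i => loadWrite (proj (M.numSymbols + 2) i))).Closed :=
      (Der.matchTm (Γ := Ctx.empty) (X := (M.loadTy 1).endo)
        fun i hi => loadWrite_der (.proj hi _) 0 _).closed
    refine (Red.beta2 (by trivial) (by trivial) (by simp [Tm.occ, hm _, idTm])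
      (by simp [Tm.occ, hm _, idTm])).trans ?_
    refine Red.trans (N := matchTm (M.numSymbols + 2)
      (fun i => loadWrite (proj (M.numSymbols + 2) i))⬝symTm σ⬝(thunk (quasiTape M.loadStep
        (loadVal 1 (M.init [])) (w.map symTm))⬝idTm)) ?_ ?_
    · rw [Tm.subst, Tm.subst, Tm.subst, hm.subst]
      exact .refl _
    refine (Red.app (Red.matchTm (F := fun i => loadWrite (proj (M.numSymbols + 2) i))
      (by omega) fun _ _ => trivial) ((Red.step .betaThunk).trans ih)).trans ?_
    exact loadWrite_red σ _ _ _ _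

/-! ## The machine -/

theorem Der.parasTwo {N : Tm} {A B : Ty} {L : LTy}
    (h : Der (Ctx.cons (some (.lin L)) (Ctx.cons (some (.disch A)) Ctx.empty)) N B)
    (n : ℕ) : ∀ {Γ : Ctx},
    Der ((Γ.cons (some (.disch (.paras (n + 1) A)))).cons (some (.disch (.paras n (.lin L))))) N
      (.paras (n + 1) B) := by
  induction n with
  | zero => exact .para h (.cons (.toDisch _) (.cons (.disch _) .nil))
  | succ n ih =>
    intro Γ
    rw [Ty.paras_succ, Ty.paras_succ (n + 1), Ty.paras_succ (n + 1)]
    exact .para (ih (Γ := Ctx.empty)) (.cons (.disch _) (.cons (.disch _) .nil))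

/-- Compute the number of steps with `F`, and iterate the transition function. -/
def runTm (D F : Tm) : Tm := ƛ ƛ (ƛ (ƛ ν 0⬝ν 2)⬝(ν 0⬝D))⬝(F⬝ν 1)

theorem runTm_der {D F : Tm} {n : ℕ} {φ : ℕ → ℕ}
    (hD : Der Ctx.empty D (.lin (.limp (.lin M.confTy) (.lin M.confTy)))) (hF : Clock (n + 1) φ F)
    (Γ : Ctx) : Der Γ (runTm D F)
      (.lin (.limp (.lin natTy) (.lin (.limp (M.boxedConf (n + 2)) (M.boxedConf (n + 2)))))) := by
  have hR : (M.boxedConf (n + 2)).NotBang := Ty.NotBang.paras (by trivial) _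
  have hlam : ∀ {Δ : Ctx} {T : Tm}, Der (Δ.cons (some (.disch (M.boxedConf (n + 1))))) T
      (M.boxedConf (n + 2)) → T.occ 0 ≤ 1 →
      Der Δ (ƛ T) (.lin (.limp (M.boxedConf (n + 2)) (M.boxedConf (n + 2)))) := by
    intro Δ T hT ho
    have := hT.lamDisch hR ho
    rwa [← Ty.paras_succ] at this
  refine .lamLin (hlam (.app (A := .para (.paras n (.lin natTy))) (.lamDisch ?_ hR ?_) ?_) ?_)
    trivial ?_
  · have : M.boxedConf (n + 2) = .paras (n + 1) (.para (.lin M.confTy)) := by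
      rw [boxedConf, show n + 2 = (n + 1) + 1 from rfl, Ty.paras_add]
      rfl
    rw [this]
    refine Der.parasTwo (.app (A := .para (.lin (LTy.endo M.confTy))) (.lamDisch (.para
      (Γ' := Ctx.cons (some (.lin (LTy.endo M.confTy))) (Ctx.cons none (Ctx.cons
        (some (.lin M.confTy)) Ctx.empty))) (.app (.var rfl) (.var (i := 2) rfl))
      (.cons (.toDisch _) (.cons (.absent _) (.cons (.toDisch _) .nil)))) trivial ?_)
      (.app (.natE (.var rfl) _) (.bangClosed hD _))) n
    simp [Tm.occ]
  · simp [Tm.occ, hD.closed _]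
  · rw [← Ty.paras_succ]
    exact .app (hF.der.weaken _) (.var rfl)
  · simp [Tm.occ, hD.closed _, hF.der.closed _]
  · simp [Tm.occ, hD.closed _, hF.der.closed _]

theorem runTm_red {D F : Tm} {n : ℕ} {φ : ℕ → ℕ} (hD : D.Closed) (hF : Clock n φ F) (j : ℕ)
    (c : M.Config) :
    Red (runTm D F⬝church j⬝confTm c) (iterTm (church (φ j)) D (confTm c)) := by
  have hc := confTm_closed c
  have hFc := hF.der.closed
  refine (Red.beta2 (by trivial) (by trivial) (by simp [Tm.occ, hD _, hFc _])
    (by simp [Tm.occ, hD _, hFc _])).trans ?_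
  have e : ((ƛ (ƛ ν 0⬝ν 2)⬝(ν 0⬝D))⬝(F⬝ν 1)).subst (Tm.double (church j) (confTm c)) =
      (ƛ (ƛ ν 0⬝confTm c)⬝(ν 0⬝D))⬝(F⬝church j) := by
    simp [Tm.subst, Tm.double, Tm.liftSub, hD.subst, hFc.subst, hc.shift]
  rw [e]
  refine (Red.appR (hF.red j) _).trans (.step (.betaClosed (by trivial) (church_closed _) ?_))
  simp [Tm.inst_eq, Tm.subst, Tm.single, Tm.liftSub, hD.subst, hc.subst, iterTm, hc.shift]

variable (M) in
/-- The machine, as a function of the list of the input symbols. -/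
def machineTm (D F : Tm) : Tm :=
  ƛ (ƛ ν 0⬝loadVal 1 (M.init [])⬝idTm⬝runTm D F)⬝(ν 0⬝M.loadStep)

theorem machineTm_der {D F : Tm} {n : ℕ} {φ : ℕ → ℕ}
    (hD : Der Ctx.empty D (.lin (.limp (.lin M.confTy) (.lin M.confTy))))
    (hF : Clock (n + 1) φ F) :
    Der Ctx.empty (M.machineTm D F)
      (.lin (.limp (.lin (listTy (.lin M.symTy))) (M.boxedConf (n + 3)))) := by
  have hR : (M.boxedConf (n + 3)).NotBang := Ty.NotBang.paras (by trivial) _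
  have hrun := runTm_der hD hF
  refine .lamLin (.app (A := .para (.lin (.limp (.lin (M.loadTy (n + 2)))
    (.lin (.limp (.lin natTy.endo) (.lin (M.loadTy (n + 2)))))))) (.lamDisch ?_ hR ?_)
    (.app (listE (.var rfl) _ _) (.bangClosed (loadStep_der _ _) _))) hR ?_
  · rw [boxedConf, Ty.paras_succ]
    refine .para (Γ' := Ctx.cons (some (.lin (.limp (.lin (M.loadTy (n + 2)))
      (.lin (.limp (.lin natTy.endo) (.lin (M.loadTy (n + 2)))))))) Ctx.empty)
      (.app (.app (.app (.var rfl) (loadVal_der _ _ _ _))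
        (.lamLin (.var rfl) trivial (by simp [Tm.occ]))) (hrun _)) (.cons (.toDisch _) .nil)
  · simp [Tm.occ, loadVal_closed _ _ _, idTm, (hrun _).closed _]
  · simp [Tm.occ, loadVal_closed _ _ _, idTm, (hrun _).closed _, loadStep_closed _]

theorem machineTm_reduces {D F : Tm} {n : ℕ} {φ : ℕ → ℕ}
    (hD : Der Ctx.empty D (.lin (.limp (.lin M.confTy) (.lin M.confTy))))
    (hF : Clock (n + 1) φ F) (w : List (Fin M.numSymbols)) :
    Reduces (M.machineTm D F⬝tapeTm w)
      (iterTm (church (φ (w.length + 1))) D (confTm (M.init w))) := by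
  have hrun := (runTm_der hD hF Ctx.empty).closed
  have hl := loadVal_closed 1 (M.init [])
  have hls := loadStep_closed (M := M)
  refine Red.reduces (.betaClosed (by trivial) (tapeTm_closed w)
    (R := (ƛ ν 0⬝loadVal 1 (M.init [])⬝idTm⬝runTm D F)⬝(tapeTm w⬝M.loadStep)) ?_) ?_
  · simp [Tm.inst_eq, Tm.subst, Tm.single, Tm.liftSub, hl.subst, hls.subst, hrun.subst, idTm]
  rw [tapeTm_eq]
  refine (Red.appR (.step (.betaClosed (by trivial) hls
    (R := ƛ ƛ quasiTape M.loadStep (ν 1) (w.map symTm)) ?_)) _).trans ?_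
  · simp [Tm.inst_eq, Tm.subst, Tm.single, Tm.liftSub,
      Tm.subst_quasiTape_closed _ _ (map_symTm_closed w), hls.shift]
  refine (Red.step (.betaLin (by simp [Tm.occ, hl _, idTm, hrun _]) (by trivial)
    (R := (ƛ ƛ quasiTape M.loadStep (ν 1) (w.map symTm))⬝loadVal 1 (M.init [])⬝idTm⬝runTm D F)
    ?_)).trans ?_
  · simp [Tm.inst_eq, Tm.subst, Tm.single, Tm.liftSub, hl.subst, hrun.subst, idTm]
  have ho := Tm.occ_quasiTape M.loadStep (ν 1) (map_symTm_closed w)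
  refine (Red.appL (Red.beta2 (by trivial) (by trivial) (by simp [ho, hls _, Tm.occ])
    (by simp [ho, hls _, Tm.occ])) _).trans ?_
  rw [Tm.subst_quasiTape_closed _ _ (map_symTm_closed w), hls.subst]
  refine (Red.appL (load_red w) _).trans ?_
  refine (Red.step (.betaClosed (by trivial) hrun
    (R := runTm D F⬝church (w.length + 1)⬝confTm (M.init w)) ?_)).trans (runTm_red hD.closed hF _ _)
  simp [Tm.inst_eq, Tm.subst, Tm.single, (confTm_closed _).subst]

theorem iterTm_reduces {D : Tm} (hD : D.Closed) (hD' : D.IsValue)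
    (h : ∀ c : M.Config, Red (D⬝confTm c) (confTm (step c))) (n : ℕ) (c : M.Config) :
    Reduces (iterTm (church n) D (confTm c)) (confTm (step^[n] c)) := by
  have hred : Red (iterTm (church n) D (confTm c)) (confTm (step^[n] c)) := by
    refine church_box_red (x := fun j => confTm (step^[j] c)) hD' hD (by trivial) (fun j => ?_) n
      ?_ [] fun N => ?_
    · rw [Function.iterate_succ_apply']
      exact h _
    · simp [Tm.occ]
    · simp [Tm.inst_eq, Tm.subst, Tm.single]
  rcases Relation.ReflTransGen.cases_head hred with h | ⟨N, h1, h2⟩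
  · cases h
  · exact Red.reduces h1 h2

/-! ## Accepting computations -/

theorem step_accept {c : M.Config} (h : c.state = M.accept) :
    (step c).state = M.accept ∧
      (step c).right.takeWhile (· ≠ M.blank) = c.right.takeWhile (· ≠ M.blank) := by
  rcases c with ⟨l, s, r⟩
  obtain rfl : s = M.accept := h
  simp only [step, M.δ_accept]
  cases r <;> simp

theorem iterate_step_accept {c : M.Config} (h : c.state = M.accept) (n : ℕ) :
    (step^[n] c).state = M.accept ∧
      (step^[n] c).right.takeWhile (· ≠ M.blank) = c.right.takeWhile (· ≠ M.blank) := by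
  induction n with
  | zero => exact ⟨h, rfl⟩
  | succ n ih =>
    rw [Function.iterate_succ_apply']
    obtain ⟨h1, h2⟩ := step_accept ih.1
    exact ⟨h1, h2.trans ih.2⟩

theorem iterate_step_of_outputs {w v : List (Fin M.numSymbols)} (hv : M.Outputs w v) {t n : ℕ}
    (ht : (step^[t] (M.init w)).state = M.accept) (hn : t ≤ n) :
    ∃ l r : List (Fin M.numSymbols), (r = [] ∨ r.head? = some M.blank) ∧
      step^[n] (M.init w) = ⟨l, M.accept, v ++ r⟩ := by
  obtain ⟨t', ht', rfl⟩ := hv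
  obtain ⟨d, rfl⟩ := Nat.exists_eq_add_of_le hn
  have h1 : (step^[t + d] (M.init w)).state = M.accept := by
    rw [Nat.add_comm, Function.iterate_add_apply]
    exact (iterate_step_accept ht d).1
  have h2 := (iterate_step_accept h1 t').2
  have h3 := (iterate_step_accept ht' (t + d)).2
  rw [← Function.iterate_add_apply] at h2 h3
  rw [Nat.add_comm] at h3
  have h4 := h2.symm.trans h3
  generalize step^[t + d] (M.init w) = c at *
  rcases c with ⟨l, s, r⟩
  obtain rfl : s = M.accept := h1
  refine ⟨l, r.dropWhile (· ≠ M.blank), ?_, ?_⟩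
  · match e : r.dropWhile (· ≠ M.blank) with
    | [] => exact .inl rfl
    | a :: as =>
      right
      have := List.head?_dropWhile_not (· ≠ M.blank) r
      rw [e] at this
      simpa using this
  · rw [← h4, List.takeWhile_append_dropWhile]

end TuringMachine

theorem eval_le_of_natDegree_le (p : Polynomial ℕ) {d : ℕ} (h : p.natDegree ≤ d) (n : ℕ) :
    p.eval n ≤ p.eval 1 * (n + 1) ^ d := by
  rw [Polynomial.eval_eq_sum_range, Polynomial.eval_eq_sum_range, Finset.sum_mul]
  refine Finset.sum_le_sum fun i hi => ?_
  rw [one_pow, mul_one]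
  refine Nat.mul_le_mul_left _ ?_
  have hi' := Finset.mem_range.1 hi
  exact (Nat.pow_le_pow_left (Nat.le_succ n) i).trans
    (Nat.pow_le_pow_right (Nat.succ_pos n) (by omega))

end WALT

theorem mainTheorem8 (M : TuringMachine) (I : Set (List (Fin M.numSymbols))) (p : Polynomial ℕ)
    (hM : M.PolyTimeOn I p) (e : ℕ) (he : 1 ≤ e) (hdeg : p.natDegree ≤ 2 ^ e) :
    ∃ (K : ℕ) (D P T : Tm),
      -- the encoded transition function
      (D.Closed ∧ HasType D (.lin (.limp (.lin M.confTy) (.lin M.confTy))) ∧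
        ∀ c : M.Config, Reduces (.app D (TuringMachine.confTm c))
          (TuringMachine.confTm (TuringMachine.step c))) ∧
      -- the encoded polynomial clock
      (P.Closed ∧ HasType P (.lin (.eimp (.lin natTy) (.paras (4 * e) (.lin natTy)))) ∧
        (∀ n : ℕ, Reduces (.app P (church n)) (church (K * n ^ 2 ^ e))) ∧
        ∀ n : ℕ, p.eval n ≤ K * (n + 1) ^ 2 ^ e) ∧
      -- the encoded machine
      (T.Closed ∧
        HasType T (.lin (.limp (.lin (listTy (.lin M.symTy)))
          (.paras (4 * e + 1) (.lin M.confTy)))) ∧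
        ∀ w : List (Fin M.numSymbols),
          HasType (TuringMachine.tapeTm w) (.lin (listTy (.lin M.symTy))) ∧
          Reduces (.app T (TuringMachine.tapeTm w))
            (iterTm (church (K * (w.length + 1) ^ 2 ^ e)) D (TuringMachine.confTm (M.init w))) ∧
          ∀ v : List (Fin M.numSymbols), w ∈ I → M.Outputs w v →
            ∃ l r : List (Fin M.numSymbols),
              (r = [] ∨ r.head? = some M.blank) ∧
              HasType (TuringMachine.confTm ⟨l, M.accept, v ++ r⟩)
                (.paras (4 * e + 1) (.lin M.confTy)) ∧
              Reduces
                (iterTm (church (K * (w.length + 1) ^ 2 ^ e)) D (TuringMachine.confTm (M.init w)))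
                (TuringMachine.confTm ⟨l, M.accept, v ++ r⟩) ∧
              Reduces (.app T (TuringMachine.tapeTm w))
                (TuringMachine.confTm ⟨l, M.accept, v ++ r⟩)) := by
  obtain ⟨e, rfl⟩ : ∃ e', e = e' + 1 := ⟨e - 1, by omega⟩
  obtain ⟨F, hF⟩ := Clock.exists_of_le (p.eval 1) (e := e + 1) (m := 4 * e + 2 + 1) (by omega)
  have hφ : (fun n => (p.eval 1 * n) ^ 2 ^ (e + 1)) =
      fun n => p.eval 1 ^ 2 ^ (e + 1) * n ^ 2 ^ (e + 1) := funext fun n => mul_pow _ _ _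
  rw [hφ] at hF
  have hp : ∀ n, p.eval n ≤ p.eval 1 ^ 2 ^ (e + 1) * (n + 1) ^ 2 ^ (e + 1) := fun n =>
    (eval_le_of_natDegree_le p hdeg n).trans
      (Nat.mul_le_mul_right _ (Nat.le_self_pow (by positivity) _))
  have hD := TuringMachine.transTm_der (M := M)
  have hT := TuringMachine.machineTm_der hD hF
  refine ⟨p.eval 1 ^ 2 ^ (e + 1), M.transTm, _, M.machineTm M.transTm F,
    ⟨hD.closed, hD.hasType, TuringMachine.transTm_reduces⟩,
    ⟨hF.eimp.1, hF.eimp.2.1, hF.eimp.2.2, hp⟩, hT.closed, hT.hasType, fun w => ?_⟩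
  have hrun := TuringMachine.machineTm_reduces hD hF w
  refine ⟨(TuringMachine.tapeTm_der w _).hasType, hrun, fun v hw hv => ?_⟩
  obtain ⟨t, htp, ht⟩ := hM w hw
  obtain ⟨l, r, hr, h⟩ :=
    TuringMachine.iterate_step_of_outputs hv ht (htp.trans (hp w.length))
  have hit := TuringMachine.iterTm_reduces hD.closed trivial
    (fun c => (TuringMachine.transTm_reduces c).to_reflTransGen)
    (p.eval 1 ^ 2 ^ (e + 1) * (w.length + 1) ^ 2 ^ (e + 1)) (M.init w)
  rw [h] at hit
  exact ⟨l, r, hr, ((TuringMachine.confTm_der _ _).paras _).hasType, hit, hrun.trans hit⟩
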